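/- Let $\Omega\subset\mathbb R^d$, $d\ge 1$, be a bounded measurable set (for instance a bounded domain or $[0,1]^d$) and let $p\in\,]1,\infty[$. For $T>0$, a kernel $K:\Omega^2\to\mathbb R$ and data $f:\Omega\times[0,T]\to\mathbb R$, $g:\Omega\to\mathbb R$, consider the nonlocal $p$-Laplacian evolution problem $$\partial_t u(x,t)=-\Delta_p^K u(\cdot,t)(x)+f(x,t),\qquad u(x,0)=g(x),\qquad (\mathcal P)$$ $$\Delta_p^K v(x)=-\int_\Omega K(x,y)\,|v(y)-v(x)|^{p-2}(v(y)-v(x))\,dy .$$ The domain of $\Delta_p^K$ consists of the $v\in L^1(\Omega)$ for which $(x,y)\mapsto K(x,y)|v(y)-v(x)|^{p-2}(v(y)-v(x))$ is integrable over $\Omega^2$. A solution of $(\mathcal P)$ on $[0,T]$ is a function $u\in C([0,T];L^1(\Omega))\cap W^{1,1}(]0,T[;L^1(\Omega))$ with $u(\cdot,0)=g$ a.e. on $\Omega$ such that, for a.e. $t\in\,]0,T[$, $u(\cdot,t)$ lies in the domain of $\Delta_p^K$ and $\partial_t u(x,t)=-\Delta_p^Ku(\cdot,t)(x)+f(x,t)$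 for a.e. $x\in\Omega$. Write $\|F\|_{L^{\infty,2}(\Omega^2)}=\sup_{x\in\Omega}\|F(x,\cdot)\|_{L^2(\Omega)}$ and $\|u\|_{C([0,T];L^2(\Omega))}=\sup_{t\in[0,T]}\|u(\cdot,t)\|_{L^2(\Omega)}$; the space $L^1([0,T];L^q(\Omega))$ consists of the measurable $f$ on $\Omega\times[0,T]$ with $\|f\|_{L^1([0,T];L^q(\Omega))}=\int_0^T\|f(\cdot,t)\|_{L^q(\Omega)}\,dt<\infty$. Let $K$ and $K_n$ ($n\in\mathbb N$) be nonnegative, measurable and symmetric kernels with $K,K_n\in L^{\infty,2}(\Omega^2)$, and assume that one of the following holds: (a) $p\in\,]1,2[$, $g,g_n\in L^2(\Omega)$ and $f,f_n\in L^1([0,T];L^2(\Omega))$ for all $n$; (b) $p\ge 2$, $g,g_n\in L^{2(p-1)}(\Omega)$ and $f,f_n\in L^1([0,T];L^{2(p-1)}(\Omega))$ for all $n$; (c) $g,g_n\in L^\infty(\Omega)$ and $f,f_n\in L^1([0,T];L^\infty(\Omega))$ for all $n$. Then the following hold. (i) Problem $(\mathcal P)$ with kernel $K$ and data $(f,g)$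 has a unique solution $u$ on $[0,T]$, and for each $n$ problem $(\mathcal P)$ with kernel $K_n$ and data $(f_n,g_n)$ has a unique solution $u_n$ on $[0,T]$. (ii) $u,u_n\in C([0,T];L^2(\Omega))$ and, for every $n$, $$\|u_n-u\|_{C([0,T];L^2(\Omega))}\le\|g_n-g\|_{L^2(\Omega)}+\|f_n-f\|_{L^1([0,T];L^2(\Omega))}+CT\begin{cases}\|K_n-K\|_{L^{\infty,2}(\Omega^2)}&\text{under (a) or (b)},\\ \|K_n-K\|_{L^2(\Omega^2)}&\text{under (c)},\end{cases}$$ where $C>0$ depends only on $p$, on $g$ and $f$, and on their domain $\Omega$. Here $f$ enters as a function of $t\in[0,T]$ extended by zero, so that $C$ does not otherwise depend on $T$. (iii) Suppose that (c) holds, that there is a constant $M$ with $\sup_n|g_n(x)|\le M$ for a.e. $x\in\Omega$ and $\sup_n|f_n(x,t)|\le M$ for a.e. $(x,t)\in\Omega\times[0,T]$, that $g_n\to g$ a.e. on $\Omega$, $f_n\to f$ a.e. on $\Omega\times[0,T]$ and $K_n\to K$ a.e. on $\Omega^2$, and that the sequence $(|K_n|^2)_n$ is uniformly integrable over $\Omega^2$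 (for every $\varepsilon>0$ there is $\delta>0$ such that $\int_E|K_n|^2\le\varepsilon$ for all $n$ and all measurable $E\subset\Omega^2$ with $|E|\le\delta$). Then $\|u_n-u\|_{C([0,T];L^2(\Omega))}\to 0$ as $n\to\infty$. -/

import Mathlib

open MeasureTheory Set Filter Topology
open scoped ENNReal ContDiff

noncomputable section

namespace NonlocalPLaplacian

/-- The space `ℝᵈ`. -/
abbrev Space (d : ℕ) : Type := EuclideanSpace ℝ (Fin d)

variable {d : ℕ}

/-- Lebesgue measure on `Ω`. -/
abbrev leb (Ω : Set (Space d)) : Measure (Space d) := volume.restrict Ω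

/-- The Banach space `L¹(Ω)`. -/
abbrev L1 (Ω : Set (Space d)) : Type := Lp ℝ 1 (leb Ω)

/-- The norm `‖F‖_{L^{∞,q}(Ω²)} = sup_{x ∈ Ω} ‖F(x, ·)‖_{L^q(Ω)}`. -/
def normLinfq (Ω : Set (Space d)) (q : ℝ≥0∞) (F : Space d → Space d → ℝ) : ℝ≥0∞ :=
  ⨆ x ∈ Ω, eLpNorm (F x) q (leb Ω)

/-- The norm of `L²(Ω²)`. -/
def normL2sq (Ω : Set (Space d)) (F : Space d → Space d → ℝ) : ℝ≥0∞ :=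
  eLpNorm (Function.uncurry F) 2 ((leb Ω).prod (leb Ω))

/-- Nonnegative, measurable, symmetric kernels on `Ω²` that belong to `L^{∞,2}(Ω²)`. -/
structure IsKernel (Ω : Set (Space d)) (K : Space d → Space d → ℝ) : Prop where
  nonneg : ∀ x ∈ Ω, ∀ y ∈ Ω, 0 ≤ K x y
  measurable : AEStronglyMeasurable (Function.uncurry K) ((leb Ω).prod (leb Ω))
  symm : ∀ x ∈ Ω, ∀ y ∈ Ω, K x y = K y x
  norm_lt_top : normLinfq Ω 2 K < ⊤

/-- The norm `∫₀ᵀ ‖f(t)‖_{L^q(Ω)} dt` of `L¹([0,T]; L^q(Ω))`; here `f t x` is the value of `f`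
at the time `t` and the point `x`. -/
def normL1Lq (Ω : Set (Space d)) (T : ℝ) (q : ℝ≥0∞) (f : ℝ → Space d → ℝ) : ℝ≥0∞ :=
  ∫⁻ t in Icc 0 T, eLpNorm (f t) q (leb Ω)

/-- `g ∈ L^q(Ω)` and `f ∈ L¹([0,T]; L^q(Ω))`. -/
structure DataIn (Ω : Set (Space d)) (T : ℝ) (q : ℝ≥0∞)
    (g : Space d → ℝ) (f : ℝ → Space d → ℝ) : Prop where
  initial : MemLp g q (leb Ω)
  source_measurable :
    AEStronglyMeasurable (Function.uncurry f) ((volume.restrict (Icc 0 T)).prod (leb Ω))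
  source_norm_lt_top : normL1Lq Ω T q f < ⊤

/-- `Ψ(s) = |s|^{p-2} s`. -/
def psi (p s : ℝ) : ℝ := |s| ^ (p - 2) * s

/-- The domain of the nonlocal `p`-Laplacian in `L¹(Ω)`: the integrand
`K(x,y) |v(y) - v(x)|^{p-2} (v(y) - v(x))` is integrable over `Ω²`. -/
def InDomain (Ω : Set (Space d)) (p : ℝ) (K : Space d → Space d → ℝ) (v : Space d → ℝ) : Prop :=
  Integrable (fun z : Space d × Space d => K z.1 z.2 * psi p (v z.2 - v z.1))
    ((leb Ω).prod (leb Ω))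

/-- The nonlocal `p`-Laplacian
`(Δ v)(x) = - ∫_Ω K(x,y) |v(y) - v(x)|^{p-2} (v(y) - v(x)) dy`. -/
def pLap (Ω : Set (Space d)) (p : ℝ) (K : Space d → Space d → ℝ) (v : Space d → ℝ)
    (x : Space d) : ℝ :=
  - ∫ y in Ω, K x y * psi p (v y - v x)

/-- `u ∈ W^{1,1}(]0,T[; X)` with weak derivative `u'`. -/
structure HasWeakTimeDeriv {X : Type*} [NormedAddCommGroup X] [NormedSpace ℝ X]
    (T : ℝ) (u u' : ℝ → X) : Prop where
  integrable : IntegrableOn u (Ioo 0 T)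
  integrable_deriv : IntegrableOn u' (Ioo 0 T)
  integral_eq : ∀ φ : ℝ → ℝ, ContDiff ℝ ∞ φ → HasCompactSupport φ → tsupport φ ⊆ Ioo 0 T →
    ∫ t in Ioo 0 T, deriv φ t • u t = - ∫ t in Ioo 0 T, φ t • u' t

/-- `u ∈ C([0,T]; L¹(Ω)) ∩ W^{1,1}(]0,T[; L¹(Ω))` is a solution on `[0,T]` of
`∂ₜ u = - Δ u + f`, `u(0) = g`, with `Δ` the nonlocal `p`-Laplacian with kernel `K` on `Ω`. -/
structure IsSolution (Ω : Set (Space d)) (p T : ℝ) (K : Space d → Space d → ℝ)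
    (g : Space d → ℝ) (f : ℝ → Space d → ℝ) (u : ℝ → L1 Ω) : Prop where
  continuousOn : ContinuousOn u (Icc 0 T)
  initial : ∀ᵐ x ∂(leb Ω), u 0 x = g x
  equation : ∃ u' : ℝ → L1 Ω, HasWeakTimeDeriv T u u' ∧
    ∀ᵐ t ∂(volume.restrict (Ioo 0 T)), InDomain Ω p K (u t) ∧
      ∀ᵐ x ∂(leb Ω), u' t x = - pLap Ω p K (u t) x + f t x

/-- There is a solution on `[0,T]`, and any two solutions coincide on `[0,T]`. -/
def HasUniqueSolution (Ω : Set (Space d)) (p T : ℝ) (K : Space d → Space d → ℝ)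
    (g : Space d → ℝ) (f : ℝ → Space d → ℝ) : Prop :=
  (∃ u, IsSolution Ω p T K g f u) ∧
    ∀ u v, IsSolution Ω p T K g f u → IsSolution Ω p T K g f v → EqOn u v (Icc 0 T)

/-- `u ∈ C([0,T]; L²(Ω))`. -/
def InCL2 (Ω : Set (Space d)) (T : ℝ) (u : ℝ → L1 Ω) : Prop :=
  (∀ t ∈ Icc 0 T, MemLp (u t) 2 (leb Ω)) ∧
    ∀ t ∈ Icc 0 T, Tendsto (fun s => eLpNorm (u s - u t : L1 Ω) 2 (leb Ω)) (𝓝[Icc 0 T] t) (𝓝 0)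

/-- The norm `sup_{t ∈ [0,T]} ‖u(t)‖_{L²(Ω)}` of `C([0,T]; L²(Ω))`. -/
def normCL2 (Ω : Set (Space d)) (T : ℝ) (u : ℝ → L1 Ω) : ℝ≥0∞ :=
  ⨆ t ∈ Icc 0 T, eLpNorm (u t) 2 (leb Ω)

/-- Case (a): `p < 2`, data in `L²`. -/
def CaseA (Ω : Set (Space d)) (p T : ℝ) (g : Space d → ℝ) (gn : ℕ → Space d → ℝ)
    (f : ℝ → Space d → ℝ) (fn : ℕ → ℝ → Space d → ℝ) : Prop :=
  p < 2 ∧ DataIn Ω T 2 g f ∧ ∀ n, DataIn Ω T 2 (gn n) (fn n)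

/-- Case (b): `p ≥ 2`, data in `L^{2(p-1)}`. -/
def CaseB (Ω : Set (Space d)) (p T : ℝ) (g : Space d → ℝ) (gn : ℕ → Space d → ℝ)
    (f : ℝ → Space d → ℝ) (fn : ℕ → ℝ → Space d → ℝ) : Prop :=
  2 ≤ p ∧ DataIn Ω T (ENNReal.ofReal (2 * (p - 1))) g f ∧
    ∀ n, DataIn Ω T (ENNReal.ofReal (2 * (p - 1))) (gn n) (fn n)

/-- Case (c): data in `L^∞`. -/
def CaseC (Ω : Set (Space d)) (T : ℝ) (g : Space d → ℝ) (gn : ℕ → Space d → ℝ)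
    (f : ℝ → Space d → ℝ) (fn : ℕ → ℝ → Space d → ℝ) : Prop :=
  DataIn Ω T ⊤ g f ∧ ∀ n, DataIn Ω T ⊤ (gn n) (fn n)

/-- The initial data are uniformly bounded and converge almost everywhere on `Ω`, the sources are
uniformly bounded and converge almost everywhere on `[0,T] × Ω`, the squares of the kernels are
uniformly integrable over `Ω²`, and the kernels converge almost everywhere on `Ω²`. -/
structure DataConverge (Ω : Set (Space d)) (T : ℝ)
    (K : Space d → Space d → ℝ) (Kn : ℕ → Space d → Space d → ℝ)
    (g : Space d → ℝ) (gn : ℕ → Space d → ℝ)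
    (f : ℝ → Space d → ℝ) (fn : ℕ → ℝ → Space d → ℝ) : Prop where
  initial_bounded : ∃ M : ℝ, ∀ᵐ x ∂(leb Ω), ∀ n, |gn n x| ≤ M
  initial_tendsto : ∀ᵐ x ∂(leb Ω), Tendsto (fun n => gn n x) atTop (𝓝 (g x))
  source_bounded : ∃ M : ℝ, ∀ᵐ z ∂((volume.restrict (Icc 0 T)).prod (leb Ω)),
    ∀ n, |fn n z.1 z.2| ≤ M
  source_tendsto : ∀ᵐ z ∂((volume.restrict (Icc 0 T)).prod (leb Ω)),
    Tendsto (fun n => fn n z.1 z.2) atTop (𝓝 (f z.1 z.2))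
  kernel_unifIntegrable : UnifIntegrable
    (fun n (z : Space d × Space d) => |Kn n z.1 z.2| ^ 2) 1 ((leb Ω).prod (leb Ω))
  kernel_tendsto : ∀ᵐ z ∂((leb Ω).prod (leb Ω)),
    Tendsto (fun n => Kn n z.1 z.2) atTop (𝓝 (K z.1 z.2))

end NonlocalPLaplacian

end

/-!
Write `Ψ(s) = |s|^{p-2} s`, so that the equation reads `∂ₜ u = A_K u + f` with the drift
`A_K v (x) = ∫ K(x,y) Ψ(v(y) - v(x)) dy`. Everything rests on one property, complete accretivity:
since `K` is symmetric and nonnegative and `Ψ` is odd and monotone, symmetrizing the double integral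
gives `∫ β(v - w) (A_K v - A_K w) ≤ 0` for every bounded monotone `β`
(`integral_comp_mul_drift_sub_nonpos`). For two curves in `L¹` this is turned into an estimate of
their distance in `L^q`, `1 < q < ∞`, by a chain rule for convex functionals along absolutely
continuous curves (`chain_rule_le`, `eLpNorm_le_of_dissipative`): if `u` solves the problem with
data `(f, g)`, and `u'` another problem, the `L^q` norm of `u - u'` grows at most like the `L^q`
norm of the residual of `u'` in the equation of `u` (`IsStrong.eLpNorm_sub_le`). No regularity of
the solutions beyond `L¹` is needed, so the following holds for every solution in the sense of the
statement.

* With zero residual this is uniqueness (`IsStrong.eqOn`). Comparison with the zero solution bounds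
  `u(t)` in `L^q` by the data, and `q → ∞` gives the maximum principle (`IsStrong.eLpNorm_top_le`).
* For two kernels the residual is `A_{K_n} u - A_K u + f_n - f`, evaluated at the solution `u` of
  the limit problem, whose norms are controlled by `f` and `g` alone. The `L²` norm of its first
  part is bounded by Hölder's inequality: by `‖K_n - K‖_{L^{∞,2}}` if `|u|^{p-1}` is in `L²`
  (`eLpNorm_absDrift_le`), which is why the data are taken in `L^q`, `q = max(2, 2(p-1))`, in the
  first two cases; and by `‖K_n - K‖_{L²}` if `u` is bounded (`eLpNorm_absDrift_le_of_bounded`).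
  The drift at `u` being bounded in `L²`, the solution is also continuous in time with values in
  `L²` (`IsStrong.tendsto_eLpNorm_two`).
* Existence is obtained in three steps. For a Lipschitz nonlinearity the drift is Lipschitz on `L¹`,
  and Picard's fixed point theorem applies (`exists_isStrong_of_lipschitz`). For bounded data the
  solutions stay bounded, `Ψ` can be approximated uniformly on their range by Lipschitz monotone
  odd functions, and the accretivity estimate makes the solutions a Cauchy sequence
  (`exists_isStrong_of_bounded`). For data in `L^q` the data are truncated (`exists_isStrong`). Both
  limits use the continuity of `A_K` from `L^q` to `L¹` (`exists_modulus`,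
  `exists_isStrong_of_approx`).

The weak formulation of the statement is equivalent to the integral equation used here, by the lemma
of du Bois-Reymond (`isSolution_iff`). The convergence result follows from the estimate for bounded
data, by dominated convergence for the data and Vitali's theorem for the kernels.
-/

namespace NonlocalPLaplacian

/-! ### Weak time derivatives -/

section WeakDerivative

variable {E : Type*} [NormedAddCommGroup E] [NormedSpace ℝ E]

lemma integral_deriv_Ioc_eq_neg {T : ℝ} {φ : ℝ → ℝ} (hφ : ContDiff ℝ ∞ φ)
    (hs : tsupport φ ⊆ Ioo 0 T) {s : ℝ} (hsT : s ≤ T) :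
    ∫ t in Ioc s T, deriv φ t = - φ s := by
  rw [← intervalIntegral.integral_of_le hsT,
    intervalIntegral.integral_deriv_eq_sub (fun x _ => hφ.differentiable (by simp) x)
      ((hφ.continuous_deriv (by simp)).intervalIntegrable _ _)]
  have : φ T = 0 := image_eq_zero_of_notMem_tsupport (fun h => by simpa using (hs h).2)
  simp [this]

/-- Integration by parts against the primitive of a Bochner integrable function, by Fubini's
theorem on the triangle `s ≤ t`. -/
lemma integral_deriv_smul_primitive [CompleteSpace E] {T : ℝ} (hT : 0 < T) {h : ℝ → E}
    (hh : IntegrableOn h (Ioo 0 T)) (c : E) {φ : ℝ → ℝ} (hφ : ContDiff ℝ ∞ φ)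
    (hs : tsupport φ ⊆ Ioo 0 T) :
    ∫ t in Ioo 0 T, deriv φ t • (c + ∫ s in (0 : ℝ)..t, h s) = - ∫ t in Ioo 0 T, φ t • h t := by
  set ν := volume.restrict (Ioo (0 : ℝ) T) with hν
  have hcd : Continuous (deriv φ) := hφ.continuous_deriv (by simp)
  have hid : Integrable (deriv φ) ν :=
    (hcd.integrableOn_Icc (a := 0) (b := T)).mono_set Ioo_subset_Icc_self
  have hφ0 : φ 0 = 0 := image_eq_zero_of_notMem_tsupport (fun h => by simpa using (hs h).1)
  have hF : Integrable (Function.uncurry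
      (fun t s : ℝ => ({z : ℝ × ℝ | z.2 ≤ z.1}.indicator (fun z => deriv φ z.1 • h z.2)) (t, s)))
      (ν.prod ν) := by
    have : Integrable (fun z : ℝ × ℝ => deriv φ z.1 • h z.2) (ν.prod ν) := hid.smul_prod hh
    exact this.indicator (measurableSet_le measurable_snd measurable_fst)
  have hsw := integral_integral_swap hF
  have hleft : ∀ t ∈ Ioo (0 : ℝ) T, (∫ s, ({z : ℝ × ℝ | z.2 ≤ z.1}.indicator
      (fun z => deriv φ z.1 • h z.2)) (t, s) ∂ν) = deriv φ t • ∫ s in (0 : ℝ)..t, h s := by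
    intro t ht
    rw [intervalIntegral.integral_of_le ht.1.le, ← integral_smul]
    have : (fun s => ({z : ℝ × ℝ | z.2 ≤ z.1}.indicator (fun z => deriv φ z.1 • h z.2)) (t, s))
        = (Iic t).indicator (fun s => deriv φ t • h s) := by
      ext s; simp [indicator]
    rw [this, integral_indicator measurableSet_Iic, hν, Measure.restrict_restrict measurableSet_Iic]
    congr 2
    ext s; simp only [mem_inter_iff, mem_Iic, mem_Ioo, mem_Ioc]
    constructor
    · rintro ⟨h1, h2, h3⟩; exact ⟨h2, h1⟩
    · rintro ⟨h1, h2⟩; exact ⟨h2, h1, h2.trans_lt ht.2⟩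
  have hright : ∀ s ∈ Ioo (0 : ℝ) T, (∫ t, ({z : ℝ × ℝ | z.2 ≤ z.1}.indicator
      (fun z => deriv φ z.1 • h z.2)) (t, s) ∂ν) = - (φ s • h s) := by
    intro s hs'
    have : (fun t => ({z : ℝ × ℝ | z.2 ≤ z.1}.indicator (fun z => deriv φ z.1 • h z.2)) (t, s))
        = (Ici s).indicator (fun t => deriv φ t • h s) := by
      ext t; simp [indicator]
    rw [this, integral_indicator measurableSet_Ici, hν, Measure.restrict_restrict measurableSet_Ici]
    have : Ici s ∩ Ioo 0 T = Ico s T := by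
      ext t; simp only [mem_inter_iff, mem_Ici, mem_Ioo, mem_Ico]
      constructor
      · rintro ⟨h1, h2, h3⟩; exact ⟨h1, h3⟩
      · rintro ⟨h1, h2⟩; exact ⟨h1, hs'.1.trans_le h1, h2⟩
    rw [this, integral_smul_const, integral_Ico_eq_integral_Ioo, ← integral_Ioc_eq_integral_Ioo,
      integral_deriv_Ioc_eq_neg hφ hs hs'.2.le, neg_smul]
  have e1 : ∫ t in Ioo 0 T, deriv φ t • ∫ s in (0 : ℝ)..t, h s = - ∫ t in Ioo 0 T, φ t • h t := by
    rw [← integral_neg, ← setIntegral_congr_fun measurableSet_Ioo hleft,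
      ← setIntegral_congr_fun measurableSet_Ioo hright]
    exact hsw
  have e2 : ∫ t in Ioo 0 T, deriv φ t • c = 0 := by
    rw [integral_smul_const, ← integral_Ioc_eq_integral_Ioo,
      integral_deriv_Ioc_eq_neg hφ hs hT.le, hφ0]; simp
  have hprim : ContinuousOn (fun t => ∫ s in (0 : ℝ)..t, h s) (Icc 0 T) := by
    have := intervalIntegral.continuousOn_primitive_interval (f := h) (a := 0) (b := T)
      (μ := volume) (by rw [uIcc_of_le hT.le, integrableOn_Icc_iff_integrableOn_Ioo]; exact hh)
    rwa [uIcc_of_le hT.le] at this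
  have i1 : Integrable (fun t => deriv φ t • ∫ s in (0 : ℝ)..t, h s) ν :=
    ((hcd.continuousOn.smul hprim).integrableOn_Icc).mono_set Ioo_subset_Icc_self
  simp only [smul_add]
  rw [integral_add (hid.smul_const c) i1, e1, e2, zero_add]

/-- A function of the form `c + ∫₀ᵗ h` has weak derivative `h`. -/
lemma hasWeakTimeDeriv_of_primitive [CompleteSpace E] {T : ℝ} (hT : 0 < T) {u h : ℝ → E} {c : E}
    (hh : IntegrableOn h (Ioo 0 T)) (hu : ∀ t ∈ Icc 0 T, u t = c + ∫ s in (0 : ℝ)..t, h s) :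
    ContinuousOn u (Icc 0 T) ∧ HasWeakTimeDeriv T u h := by
  have hprim : ContinuousOn (fun t => c + ∫ s in (0 : ℝ)..t, h s) (Icc 0 T) := by
    have := intervalIntegral.continuousOn_primitive_interval (f := h) (a := 0) (b := T)
      (μ := volume) (by rw [uIcc_of_le hT.le, integrableOn_Icc_iff_integrableOn_Ioo]; exact hh)
    rw [uIcc_of_le hT.le] at this
    exact continuousOn_const.add this
  have hc : ContinuousOn u (Icc 0 T) := hprim.congr hu
  refine ⟨hc, hc.integrableOn_Icc.mono_set Ioo_subset_Icc_self, hh, fun φ hφ _ hs => ?_⟩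
  rw [← integral_deriv_smul_primitive hT hh c hφ hs]
  exact setIntegral_congr_fun measurableSet_Ioo
    (fun t ht => by simp only [hu t (Ioo_subset_Icc_self ht)])

/-- A smooth function of zero mean with support in `(0,T)` is the derivative of a test function. -/
lemma exists_testFunction_deriv_eq {T : ℝ} {χ : ℝ → ℝ} (hχ : ContDiff ℝ ∞ χ)
    (hc : HasCompactSupport χ) (hs : tsupport χ ⊆ Ioo 0 T) (h0 : ∫ t in Ioo 0 T, χ t = 0) :
    ∃ φ : ℝ → ℝ, ContDiff ℝ ∞ φ ∧ HasCompactSupport φ ∧ tsupport φ ⊆ Ioo 0 T ∧ deriv φ = χ := by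
  rcases (tsupport χ).eq_empty_or_nonempty with he | hne
  · refine ⟨0, contDiff_const, HasCompactSupport.zero, by simp, ?_⟩
    have : χ = 0 := tsupport_eq_empty_iff.1 he
    simp [this]
  obtain ⟨a, ha, hal⟩ := hc.isCompact.exists_isLeast hne
  obtain ⟨b, hb, hbl⟩ := hc.isCompact.exists_isGreatest hne
  have hzl : ∀ t, t < a → χ t = 0 := fun t ht =>
    image_eq_zero_of_notMem_tsupport (fun h => absurd (hal h) (not_le.2 ht))
  have hzr : ∀ t, b < t → χ t = 0 := fun t ht =>
    image_eq_zero_of_notMem_tsupport (fun h => absurd (hbl h) (not_le.2 ht))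
  have hab : a ≤ b := hal hb
  have haT := hs ha
  have hbT := hs hb
  have hd : ∀ t, HasDerivAt (fun t => ∫ s in a..t, χ s) (χ t) t := fun t =>
    intervalIntegral.integral_hasDerivAt_right (hχ.continuous.intervalIntegrable _ _)
      (hχ.continuous.stronglyMeasurableAtFilter _ _) hχ.continuous.continuousAt
  have hder : deriv (fun t => ∫ s in a..t, χ s) = χ := funext fun t => (hd t).deriv
  have htot : ∫ s in a..b, χ s = 0 := by
    have h1 : ∫ s in (0 : ℝ)..T, χ s = 0 := by
      rw [intervalIntegral.integral_of_le (haT.1.le.trans haT.2.le), integral_Ioc_eq_integral_Ioo,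
        h0]
    have h2 : ∫ s in (0 : ℝ)..a, χ s = 0 := by
      rw [intervalIntegral.integral_of_le haT.1.le, integral_Ioc_eq_integral_Ioo]
      exact setIntegral_eq_zero_of_forall_eq_zero fun t ht => hzl t ht.2
    have h3 : ∫ s in b..T, χ s = 0 := by
      rw [intervalIntegral.integral_of_le hbT.2.le]
      exact setIntegral_eq_zero_of_forall_eq_zero fun t ht => hzr t ht.1
    have hi : ∀ x y, IntervalIntegrable χ volume x y := fun x y =>
      hχ.continuous.intervalIntegrable x y
    rw [← intervalIntegral.integral_add_adjacent_intervals (hi 0 a) (hi a T),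
      ← intervalIntegral.integral_add_adjacent_intervals (hi a b) (hi b T), h2, h3] at h1
    simpa using h1
  have hsub : tsupport (fun t => ∫ s in a..t, χ s) ⊆ Icc a b := by
    refine closure_minimal (fun t ht => ?_) isClosed_Icc
    by_contra hn
    apply ht
    rw [mem_Icc, not_and_or, not_le, not_le] at hn
    rcases hn with hn | hn
    · simp only
      rw [intervalIntegral.integral_symm, intervalIntegral.integral_of_le hn.le,
        integral_Ioc_eq_integral_Ioo,
        setIntegral_eq_zero_of_forall_eq_zero fun t ht => hzl t ht.2, neg_zero]
    · simp only
      rw [← intervalIntegral.integral_add_adjacent_intervals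
        (hχ.continuous.intervalIntegrable a b) (hχ.continuous.intervalIntegrable b t), htot,
        intervalIntegral.integral_of_le hn.le,
        setIntegral_eq_zero_of_forall_eq_zero fun t ht => hzr t ht.1, zero_add]
  refine ⟨_, ?_, ?_, hsub.trans (Icc_subset_Ioo haT.1 hbT.2), hder⟩
  · rw [contDiff_infty_iff_deriv]
    exact ⟨fun t => (hd t).differentiableAt, by rw [hder]; exact hχ⟩
  · exact isCompact_Icc.of_isClosed_subset (isClosed_tsupport _) hsub

/-- The lemma of du Bois-Reymond: a continuous function with zero weak derivative is constant. -/
lemma eqOn_const_of_integral_deriv_smul_eq_zero [CompleteSpace E] {T : ℝ} (hT : 0 < T)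
    {z : ℝ → E} (hz : ContinuousOn z (Icc 0 T))
    (h : ∀ φ : ℝ → ℝ, ContDiff ℝ ∞ φ → HasCompactSupport φ → tsupport φ ⊆ Ioo 0 T →
      ∫ t in Ioo 0 T, deriv φ t • z t = 0) : ∀ t ∈ Icc 0 T, z t = z 0 := by
  have hzi : IntegrableOn z (Ioo 0 T) := hz.integrableOn_Icc.mono_set Ioo_subset_Icc_self
  -- subtracting a multiple of the bump `ρ` of unit mass makes the mean of a test function zero
  let B : ContDiffBump (T / 2 : ℝ) := ⟨T / 8, T / 4, by positivity, by linarith⟩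
  set ρ : ℝ → ℝ := B.normed volume with hρ
  have hρs : tsupport ρ ⊆ Ioo 0 T := by
    rw [hρ, B.tsupport_normed_eq, Real.closedBall_eq_Icc]
    exact Icc_subset_Ioo (by show 0 < T/2 - T/4; linarith) (by show T/2 + T/4 < T; linarith)
  have hρc : ContDiff ℝ ∞ ρ := B.contDiff_normed
  have hint : ∀ {φ : ℝ → ℝ}, tsupport φ ⊆ Ioo 0 T → ∫ t in Ioo 0 T, φ t = ∫ t, φ t := fun hφ =>
    setIntegral_eq_integral_of_forall_compl_eq_zero
      (fun t ht => image_eq_zero_of_notMem_tsupport (fun h => ht (hφ h)))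
  have hρ1 : ∫ t in Ioo 0 T, ρ t = 1 := by rw [hint hρs, hρ, B.integral_normed]
  have hsm : ∀ {φ : ℝ → ℝ}, ContDiff ℝ ∞ φ → IntegrableOn (fun t => φ t • z t) (Ioo 0 T) :=
    fun hφ => ((hφ.continuous.continuousOn.smul hz).integrableOn_Icc).mono_set Ioo_subset_Icc_self
  have hsi : ∀ {φ : ℝ → ℝ}, ContDiff ℝ ∞ φ → IntegrableOn φ (Ioo 0 T) :=
    fun hφ => (hφ.continuous.integrableOn_Icc).mono_set Ioo_subset_Icc_self
  set c : E := ∫ t in Ioo 0 T, ρ t • z t with hcdef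
  have hkey : ∀ ψ : ℝ → ℝ, ContDiff ℝ ∞ ψ → HasCompactSupport ψ → tsupport ψ ⊆ Ioo 0 T →
      ∫ t, ψ t • (z t - c) = 0 := by
    intro ψ hψ hψc hψs
    set m : ℝ := ∫ t in Ioo 0 T, ψ t with hm
    obtain ⟨φ, h1, h2, h3, h4⟩ := exists_testFunction_deriv_eq (T := T) (χ := ψ - m • ρ)
      (hψ.sub (contDiff_const.smul hρc))
      (hψc.sub (B.hasCompactSupport_normed.smul_left (f := fun _ => m)))
      ((tsupport_sub _ _).trans (union_subset hψs
        ((tsupport_smul_subset_right (fun _ => m) ρ).trans hρs))) (by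
        simp only [Pi.sub_apply, Pi.smul_apply, smul_eq_mul]
        rw [integral_sub (hsi hψ) ((hsi hρc).const_mul m), integral_const_mul, hρ1]; simp [hm])
    have h5 := h φ h1 h2 h3
    rw [h4] at h5
    have h6 : ∫ t in Ioo 0 T, ψ t • z t = m • c := by
      simp only [Pi.sub_apply, Pi.smul_apply, sub_smul, smul_assoc] at h5
      have h6 : IntegrableOn (fun t => m • ρ t • z t) (Ioo 0 T) := (hsm hρc).smul m
      rw [integral_sub (hsm hψ) h6, integral_smul, sub_eq_zero] at h5
      exact h5
    have h7 : ∫ t, ψ t • (z t - c) = ∫ t in Ioo 0 T, ψ t • (z t - c) :=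
      (setIntegral_eq_integral_of_forall_compl_eq_zero (fun t ht => by
        rw [image_eq_zero_of_notMem_tsupport (fun h => ht (hψs h)), zero_smul])).symm
    rw [h7]
    simp only [smul_sub]
    rw [integral_sub (hsm hψ) ((hsi hψ).smul_const c), h6, integral_smul_const, ← hm, sub_self]
  have hae := isOpen_Ioo.ae_eq_zero_of_integral_contDiff_smul_eq_zero
    (f := fun t => z t - c) (U := Ioo (0 : ℝ) T) (μ := volume)
    ((hzi.sub (integrableOn_const (by simp))).locallyIntegrableOn) hkey
  have hae' : z =ᵐ[volume.restrict (Icc 0 T)] fun _ => c := by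
    rw [← restrict_Ioo_eq_restrict_Icc]
    rw [Filter.EventuallyEq, ae_restrict_iff' measurableSet_Ioo]
    filter_upwards [hae] with t ht h using sub_eq_zero.1 (ht h)
  have := Measure.eqOn_Icc_of_ae_eq (μ := volume) hT.ne hae' hz continuousOn_const
  intro t ht
  rw [this ht, this (left_mem_Icc.2 hT.le)]

/-- A continuous function in `W^{1,1}` is the primitive of its weak derivative. -/
lemma HasWeakTimeDeriv.eq_primitive [CompleteSpace E] {T : ℝ} (hT : 0 < T) {u h : ℝ → E}
    (hu : ContinuousOn u (Icc 0 T)) (hw : HasWeakTimeDeriv T u h) :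
    ∀ t ∈ Icc 0 T, u t = u 0 + ∫ s in (0 : ℝ)..t, h s := by
  obtain ⟨hc, hp⟩ := hasWeakTimeDeriv_of_primitive hT (u := fun t => 0 + ∫ s in (0 : ℝ)..t, h s)
    hw.integrable_deriv (fun t _ => rfl)
  have := eqOn_const_of_integral_deriv_smul_eq_zero hT (hu.sub hc) (fun φ h1 h2 h3 => by
    have hsm : ∀ {z : ℝ → E}, ContinuousOn z (Icc 0 T) →
        IntegrableOn (fun t => deriv φ t • z t) (Ioo 0 T) := fun hz =>
      (((h1.continuous_deriv (by simp)).continuousOn.smul hz).integrableOn_Icc).mono_set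
        Ioo_subset_Icc_self
    simp only [Pi.sub_apply, smul_sub]
    rw [integral_sub (hsm hu) (hsm hc), hw.integral_eq φ h1 h2 h3, hp.integral_eq φ h1 h2 h3,
      sub_self])
  intro t ht
  have := this t ht
  simp only [Pi.sub_apply, intervalIntegral.integral_same, zero_add, sub_zero] at this
  rw [← this]; abel

end WeakDerivative

/-! ### The power nonlinearity and its truncations -/

lemma psi_eq_sub {q : ℝ} (hq : 1 < q) (s : ℝ) :
    psi q s = max s 0 ^ (q - 1) - max (-s) 0 ^ (q - 1) := by
  have h0 : (0 : ℝ) ^ (q - 1) = 0 := Real.zero_rpow (by linarith)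
  rcases lt_trichotomy s 0 with h | h | h
  · rw [psi, max_eq_right h.le, max_eq_left (by linarith), h0, abs_of_neg h,
      show q - 1 = (q - 2) + 1 by ring, Real.rpow_add_one (by linarith)]
    ring
  · simp [psi, h]
  · rw [psi, max_eq_left h.le, max_eq_right (by linarith), h0, abs_of_pos h,
      show q - 1 = (q - 2) + 1 by ring, Real.rpow_add_one (by linarith)]
    ring

lemma continuous_psi {q : ℝ} (hq : 1 < q) : Continuous (psi q) := by
  rw [funext (psi_eq_sub hq)]
  have := Real.continuous_rpow_const (q := q - 1) (by linarith)
  exact (this.comp (by fun_prop)).sub (this.comp (by fun_prop))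

lemma monotone_psi {q : ℝ} (hq : 1 < q) : Monotone (psi q) := by
  intro a b hab
  rw [psi_eq_sub hq, psi_eq_sub hq]
  apply sub_le_sub
  · exact Real.rpow_le_rpow (le_max_right _ _) (max_le_max hab le_rfl) (by linarith)
  · exact Real.rpow_le_rpow (le_max_right _ _) (max_le_max (by linarith) le_rfl) (by linarith)

lemma psi_neg (q s : ℝ) : psi q (-s) = - psi q s := by simp [psi]

lemma psi_zero (q : ℝ) : psi q 0 = 0 := by simp [psi]

lemma abs_psi {q : ℝ} (hq : 1 < q) (s : ℝ) : |psi q s| = |s| ^ (q - 1) := by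
  rcases eq_or_ne s 0 with rfl | h
  · simp [psi, Real.zero_rpow (show q - 1 ≠ 0 by linarith)]
  · rw [psi, abs_mul, abs_of_nonneg (by positivity), show q - 1 = (q - 2) + 1 by ring,
      Real.rpow_add_one (by positivity)]

lemma psi_of_nonneg {q : ℝ} (hq : 1 < q) {s : ℝ} (hs : 0 ≤ s) : psi q s = s ^ (q - 1) := by
  rw [psi_eq_sub hq, max_eq_left hs, max_eq_right (by linarith),
    Real.zero_rpow (by linarith), sub_zero]

/-- The projection of `ℝ` onto `[-M, M]`. -/
def clamp (M s : ℝ) : ℝ := max (-M) (min s M)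

lemma continuous_clamp (M : ℝ) : Continuous (clamp M) := by unfold clamp; fun_prop

lemma monotone_clamp (M : ℝ) : Monotone (clamp M) :=
  fun _ _ h => max_le_max le_rfl (min_le_min h le_rfl)

lemma clamp_neg {M : ℝ} (hM : 0 ≤ M) (s : ℝ) : clamp M (-s) = - clamp M s := by
  unfold clamp; grind

lemma abs_clamp_le {M : ℝ} (hM : 0 ≤ M) (s : ℝ) : |clamp M s| ≤ M :=
  abs_le.2 ⟨le_max_left _ _, max_le (by linarith) (min_le_right _ _)⟩

lemma abs_clamp_le_abs {M : ℝ} (hM : 0 ≤ M) (s : ℝ) : |clamp M s| ≤ |s| := by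
  unfold clamp; grind

lemma clamp_eq_self {M s : ℝ} (h : |s| ≤ M) : clamp M s = s := by
  unfold clamp; grind

lemma clamp_of_nonneg {M s : ℝ} (hM : 0 ≤ M) (h : 0 ≤ s) : clamp M s = min s M := by
  unfold clamp; grind

lemma abs_clamp_sub_self_le {M : ℝ} (hM : 0 ≤ M) (s : ℝ) : |clamp M s - s| ≤ |s| := by
  unfold clamp; grind

lemma tendsto_clamp (s : ℝ) : Tendsto (fun n : ℕ => clamp n s) atTop (𝓝 s) := by
  obtain ⟨N, hN⟩ := exists_nat_ge |s|
  refine tendsto_const_nhds.congr' ?_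
  filter_upwards [eventually_ge_atTop N] with n hn
  exact (clamp_eq_self (hN.trans (by exact_mod_cast hn))).symm

lemma continuous_psi_clamp {q : ℝ} (hq : 1 < q) (M : ℝ) :
    Continuous fun s => psi q (clamp M s) := (continuous_psi hq).comp (continuous_clamp M)

lemma monotone_psi_clamp {q : ℝ} (hq : 1 < q) (M : ℝ) :
    Monotone fun s => psi q (clamp M s) := (monotone_psi hq).comp (monotone_clamp M)

lemma abs_psi_clamp_le {q : ℝ} (hq : 1 < q) {M : ℝ} (hM : 0 ≤ M) (s : ℝ) :
    |psi q (clamp M s)| ≤ M ^ (q - 1) := by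
  rw [abs_psi hq]
  exact Real.rpow_le_rpow (abs_nonneg _) (abs_clamp_le hM s) (by linarith)

/-- The convex function `s ↦ ∫₀ˢ Ψ(clamp M r) dr`, where `Ψ(r) = |r|^{q-2} r`: it equals `|s|^q / q`
for `|s| ≤ M` and grows linearly beyond. -/
noncomputable def truncPow (q M s : ℝ) : ℝ := ∫ r in (0 : ℝ)..s, psi q (clamp M r)

lemma truncPow_neg {q M : ℝ} (hM : 0 ≤ M) (s : ℝ) : truncPow q M (-s) = truncPow q M s := by
  have h := intervalIntegral.integral_comp_neg (a := 0) (b := s) (fun r => psi q (clamp M r))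
  simp only [clamp_neg hM, psi_neg, intervalIntegral.integral_neg, neg_zero] at h
  rw [truncPow, truncPow, intervalIntegral.integral_symm, ← h, neg_neg]

lemma truncPow_abs {q M : ℝ} (hM : 0 ≤ M) (s : ℝ) : truncPow q M |s| = truncPow q M s := by
  rcases abs_choice s with h | h <;> rw [h]
  exact truncPow_neg hM s

lemma truncPow_sub_le {q : ℝ} (hq : 1 < q) (M a b : ℝ) :
    truncPow q M b - truncPow q M a ≤ psi q (clamp M b) * (b - a) := by
  have hi : ∀ x y, IntervalIntegrable (fun r => psi q (clamp M r)) volume x y := fun x y =>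
    (continuous_psi_clamp hq M).intervalIntegrable x y
  rw [truncPow, truncPow, intervalIntegral.integral_interval_sub_left (hi _ _) (hi _ _)]
  rcases le_total a b with h | h
  · have := intervalIntegral.integral_mono_on h (hi a b)
      (intervalIntegrable_const (c := psi q (clamp M b))) (fun x hx => monotone_psi_clamp hq M hx.2)
    simpa [mul_comm] using this
  · rw [intervalIntegral.integral_symm]
    have := intervalIntegral.integral_mono_on h (intervalIntegrable_const (c := psi q (clamp M b)))
      (hi b a) (fun x hx => monotone_psi_clamp hq M hx.1)
    simp only [intervalIntegral.integral_const, smul_eq_mul] at this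
    linarith

lemma integral_rpow_sub_one {q : ℝ} (hq : 1 < q) (s : ℝ) :
    ∫ r in (0 : ℝ)..s, r ^ (q - 1) = s ^ q / q := by
  rw [integral_rpow (Or.inl (by linarith))]
  simp [Real.zero_rpow (show q ≠ 0 by linarith)]

lemma mul_truncPow_le {q : ℝ} (hq : 1 < q) {M : ℝ} (hM : 0 ≤ M) (s : ℝ) :
    q * truncPow q M s ≤ |s| ^ q := by
  rw [← truncPow_abs hM]
  have h : truncPow q M |s| ≤ ∫ r in (0 : ℝ)..|s|, r ^ (q - 1) := by
    refine intervalIntegral.integral_mono_on (abs_nonneg s)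
      ((continuous_psi_clamp hq M).intervalIntegrable _ _)
      ((Real.continuous_rpow_const (by linarith)).intervalIntegrable _ _) (fun x hx => ?_)
    rw [clamp_of_nonneg hM hx.1, psi_of_nonneg hq (le_min hx.1 hM)]
    exact Real.rpow_le_rpow (le_min hx.1 hM) (min_le_left _ _) (by linarith)
  rw [integral_rpow_sub_one hq, le_div_iff₀ (by linarith)] at h
  linarith

lemma le_mul_truncPow {q : ℝ} (hq : 1 < q) {M : ℝ} (hM : 0 ≤ M) (s : ℝ) :
    |clamp M s| ^ q ≤ q * truncPow q M s := by
  rw [← truncPow_abs hM]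
  have hc : |clamp M s| = min |s| M := by unfold clamp; grind
  have hi : ∀ x y, IntervalIntegrable (fun r => psi q (clamp M r)) volume x y := fun x y =>
    (continuous_psi_clamp hq M).intervalIntegrable x y
  have h1 : ∫ r in (0 : ℝ)..min |s| M, r ^ (q - 1)
      = ∫ r in (0 : ℝ)..min |s| M, psi q (clamp M r) := by
    refine intervalIntegral.integral_congr (fun x hx => ?_)
    rw [uIcc_of_le (le_min (abs_nonneg s) hM)] at hx
    have : min x M = x := min_eq_left (hx.2.trans (min_le_right _ _))
    simp only [clamp_of_nonneg hM hx.1, this, psi_of_nonneg hq hx.1]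
  have h2 : 0 ≤ ∫ r in min |s| M..|s|, psi q (clamp M r) := by
    refine intervalIntegral.integral_nonneg (min_le_left _ _) (fun x hx => ?_)
    have hx0 : 0 ≤ x := (le_min (abs_nonneg s) hM).trans hx.1
    rw [clamp_of_nonneg hM hx0, psi_of_nonneg hq (le_min hx0 hM)]
    exact Real.rpow_nonneg (le_min hx0 hM) _
  have h3 : truncPow q M |s| = (min |s| M) ^ q / q + ∫ r in min |s| M..|s|, psi q (clamp M r) := by
    rw [truncPow, ← intervalIntegral.integral_add_adjacent_intervals (hi 0 (min |s| M)) (hi _ _),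
      ← h1, integral_rpow_sub_one hq]
  rw [hc, h3, mul_add, mul_div_cancel₀ _ (by linarith : q ≠ 0)]
  have : 0 ≤ q * ∫ r in min |s| M..|s|, psi q (clamp M r) := mul_nonneg (by linarith) h2
  linarith

lemma truncPow_nonneg {q : ℝ} (hq : 1 < q) {M : ℝ} (hM : 0 ≤ M) (s : ℝ) : 0 ≤ truncPow q M s := by
  have h := le_mul_truncPow hq hM s
  have : 0 ≤ |clamp M s| ^ q := by positivity
  nlinarith

lemma abs_truncPow_sub_le {q : ℝ} (hq : 1 < q) {M : ℝ} (hM : 0 ≤ M) (a b : ℝ) :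
    |truncPow q M b - truncPow q M a| ≤ M ^ (q - 1) * |b - a| := by
  have key : ∀ a b, truncPow q M b - truncPow q M a ≤ M ^ (q - 1) * |b - a| := fun a b => by
    refine (truncPow_sub_le hq M a b).trans ((le_abs_self _).trans ?_)
    rw [abs_mul]
    exact mul_le_mul_of_nonneg_right (abs_psi_clamp_le hq hM b) (abs_nonneg _)
  rw [abs_le]
  have := key b a
  rw [abs_sub_comm] at this
  exact ⟨by linarith, key a b⟩

/-! ### Convex integral functionals along absolutely continuous curves in `L¹` -/

section Energy

variable {X : Type*} [MeasurableSpace X] {μ : Measure X}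

/-- The continuous linear functional `h ↦ ∫ b h` on `L¹(μ)`, for a bounded measurable `b`. -/
noncomputable def pairing (b : X → ℝ) (B : ℝ) (hb : AEStronglyMeasurable b μ)
    (hB : ∀ x, |b x| ≤ B) : Lp ℝ 1 μ →L[ℝ] ℝ :=
  LinearMap.mkContinuous
    { toFun := fun h => ∫ x, b x * h x ∂μ
      map_add' := fun h k => by
        rw [← integral_add ((L1.integrable_coeFn h).bdd_mul hb (.of_forall hB))
          ((L1.integrable_coeFn k).bdd_mul hb (.of_forall hB))]
        refine integral_congr_ae ?_
        filter_upwards [Lp.coeFn_add h k] with x hx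
        rw [hx, Pi.add_apply, mul_add]
      map_smul' := fun c h => by
        rw [RingHom.id_apply, smul_eq_mul, ← integral_const_mul]
        refine integral_congr_ae ?_
        filter_upwards [Lp.coeFn_smul c h] with x hx
        rw [hx, Pi.smul_apply, smul_eq_mul]; ring }
    B (fun h => by
      rw [L1.norm_eq_integral_norm, ← integral_const_mul]
      refine norm_integral_le_of_norm_le ((L1.integrable_coeFn h).norm.const_mul B)
        (.of_forall fun x => ?_)
      rw [norm_mul]
      exact mul_le_mul_of_nonneg_right (hB x) (norm_nonneg _))

lemma pairing_apply (b : X → ℝ) (B : ℝ) (hb : AEStronglyMeasurable b μ)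
    (hB : ∀ x, |b x| ≤ B) (h : Lp ℝ 1 μ) : pairing b B hb hB h = ∫ x, b x * h x ∂μ := rfl

lemma abs_integral_mul_coeFn_le {b : X → ℝ} {B : ℝ} (hB : ∀ x, |b x| ≤ B) (h : Lp ℝ 1 μ) :
    |∫ x, b x * h x ∂μ| ≤ B * ‖h‖ := by
  rw [L1.norm_eq_integral_norm, ← integral_const_mul, ← Real.norm_eq_abs]
  refine norm_integral_le_of_norm_le ((L1.integrable_coeFn h).norm.const_mul B)
    (.of_forall fun x => ?_)
  rw [norm_mul]
  exact mul_le_mul_of_nonneg_right (hB x) (norm_nonneg _)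

/-- Convergence in `L¹` turns, under a bounded continuous `β`, into weak-* convergence in `L^∞`. -/
lemma tendsto_integral_comp_mul {β : ℝ → ℝ} (hβ : Continuous β) {B : ℝ} (hB : ∀ s, |β s| ≤ B)
    {w : ℕ → Lp ℝ 1 μ} {w₀ : Lp ℝ 1 μ} (hw : Tendsto w atTop (𝓝 w₀)) (h : Lp ℝ 1 μ) :
    Tendsto (fun n => ∫ x, β (w n x) * h x ∂μ) atTop (𝓝 (∫ x, β (w₀ x) * h x ∂μ)) := by
  refine tendsto_of_subseq_tendsto fun ns hns => ?_
  obtain ⟨ms, hms, hae⟩ := (tendstoInMeasure_of_tendsto_Lp (hw.comp hns)).exists_seq_tendsto_ae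
  refine ⟨ms, tendsto_integral_of_dominated_convergence (fun x => B * ‖h x‖) (fun n => ?_)
    ((L1.integrable_coeFn h).norm.const_mul B) (fun n => .of_forall fun x => ?_) ?_⟩
  · exact (hβ.comp_aestronglyMeasurable (Lp.aestronglyMeasurable _)).mul
      (Lp.aestronglyMeasurable _)
  · rw [norm_mul]
    exact mul_le_mul_of_nonneg_right (hB _) (norm_nonneg _)
  · filter_upwards [hae] with x hx
    exact ((hβ.tendsto _).comp hx).mul_const _

variable {η β : ℝ → ℝ} {B : ℝ}

lemma integrable_comp_of_lipschitz (hη : Continuous η) (h0 : η 0 = 0)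
    (hL : ∀ a b, |η b - η a| ≤ B * |b - a|) (w : Lp ℝ 1 μ) : Integrable (fun x => η (w x)) μ := by
  refine ((L1.integrable_coeFn w).norm.const_mul B).mono'
    (hη.comp_aestronglyMeasurable (Lp.aestronglyMeasurable _)) (.of_forall fun x => ?_)
  simpa [h0] using hL 0 (w x)

lemma continuous_integral_comp (hη : Continuous η) (h0 : η 0 = 0)
    (hL : ∀ a b, |η b - η a| ≤ B * |b - a|) :
    Continuous fun w : Lp ℝ 1 μ => ∫ x, η (w x) ∂μ := by
  have hB : 0 ≤ B := by have := hL 0 1; simp at this; exact (abs_nonneg _).trans this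
  refine LipschitzWith.continuous (K := ⟨B, hB⟩) (LipschitzWith.of_dist_le_mul fun v w => ?_)
  rw [Real.dist_eq, ← integral_sub (integrable_comp_of_lipschitz hη h0 hL v)
    (integrable_comp_of_lipschitz hη h0 hL w), dist_eq_norm, L1.norm_eq_integral_norm]
  show _ ≤ B * _
  rw [← integral_const_mul, ← Real.norm_eq_abs]
  refine norm_integral_le_of_norm_le ((L1.integrable_coeFn _).norm.const_mul B) ?_
  filter_upwards [Lp.coeFn_sub v w] with x hx
  rw [hx]; exact hL _ _

lemma integral_comp_sub_le (hη : Continuous η) (h0 : η 0 = 0)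
    (hL : ∀ a b, |η b - η a| ≤ B * |b - a|) (hβ : Continuous β) (hB : ∀ s, |β s| ≤ B)
    (hc : ∀ a b, η b - η a ≤ β b * (b - a)) (v w : Lp ℝ 1 μ) :
    ∫ x, η (w x) ∂μ - ∫ x, η (v x) ∂μ ≤ ∫ x, β (w x) * (w - v : Lp ℝ 1 μ) x ∂μ := by
  rw [← integral_sub (integrable_comp_of_lipschitz hη h0 hL w)
    (integrable_comp_of_lipschitz hη h0 hL v)]
  refine integral_mono_ae ((integrable_comp_of_lipschitz hη h0 hL w).sub
    (integrable_comp_of_lipschitz hη h0 hL v))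
    ((L1.integrable_coeFn _).bdd_mul (hβ.comp_aestronglyMeasurable (Lp.aestronglyMeasurable _))
      (.of_forall fun x => hB _)) ?_
  filter_upwards [Lp.coeFn_sub w v] with x hx
  rw [hx]; exact hc _ _

/-- The chain rule, as an inequality, for `θ (∫ η(w(t)))` with `η` convex, `η' = β`, and `θ`
concave, along a primitive `w` of an integrable `h`. Convexity and concavity give the inequality
on each interval of a partition, with `β` taken at the right and `θ'` at the left end; the mesh then
tends to zero. -/
lemma chain_rule_le (hη : Continuous η) (h0 : η 0 = 0) (hpos : ∀ s, 0 ≤ η s)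
    (hL : ∀ a b, |η b - η a| ≤ B * |b - a|) (hβ : Continuous β) (hB : ∀ s, |β s| ≤ B)
    (hc : ∀ a b, η b - η a ≤ β b * (b - a))
    {θ θ' : ℝ → ℝ} {Bθ : ℝ} (hθ' : ContinuousOn θ' (Ici 0)) (hθn : ∀ y, 0 ≤ y → 0 ≤ θ' y)
    (hθB : ∀ y, 0 ≤ y → θ' y ≤ Bθ)
    (hθ : ∀ y₁ y₂, 0 ≤ y₁ → 0 ≤ y₂ → θ y₂ - θ y₁ ≤ θ' y₁ * (y₂ - y₁))
    {a b : ℝ} (hab : a < b) {w h : ℝ → Lp ℝ 1 μ} (hh : IntervalIntegrable h volume a b)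
    (hw : ∀ t ∈ Icc a b, w t = w a + ∫ s in a..t, h s) :
    θ (∫ x, η (w b x) ∂μ) - θ (∫ x, η (w a x) ∂μ) ≤
      ∫ t in a..b, θ' (∫ x, η (w t x) ∂μ) * ∫ x, β (w t x) * h t x ∂μ := by
  have hwc : ContinuousOn w (Icc a b) := by
    have := intervalIntegral.continuousOn_primitive_interval (f := h) (a := a) (b := b)
      (μ := volume) (by
        rw [uIcc_of_le hab.le, integrableOn_Icc_iff_integrableOn_Ioc]
        exact (intervalIntegrable_iff_integrableOn_Ioc_of_le hab.le).1 hh)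
    rw [uIcc_of_le hab.le] at this
    exact (continuousOn_const.add this).congr hw
  set y : ℝ → ℝ := fun t => ∫ x, η (w t x) ∂μ with hy
  have hy0 : ∀ t, 0 ≤ y t := fun t => integral_nonneg fun x => hpos _
  have hyc : ContinuousOn y (Icc a b) :=
    (continuous_integral_comp (μ := μ) hη h0 hL).comp_continuousOn hwc
  -- the partition into `n` intervals of equal length; `lo n r` and `hi n r` are the end points of
  -- the interval that contains `r`
  set t : ℕ → ℕ → ℝ := fun n i => a + (b - a) / n * i with ht
  set lo : ℕ → ℝ → ℝ := fun n r => a + (b - a) / n * ((⌈(r - a) * n / (b - a)⌉ : ℤ) - 1) with hlo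
  set hi : ℕ → ℝ → ℝ := fun n r => a + (b - a) / n * (⌈(r - a) * n / (b - a)⌉ : ℤ) with hhi
  set G : ℕ → ℝ → ℝ := fun n r => θ' (y (lo n r)) * ∫ x, β (w (hi n r) x) * h r x ∂μ with hG
  have hba : 0 < b - a := by linarith
  have hstep : ∀ n : ℕ, 0 < n → ∀ i : ℕ, ∀ r ∈ Ioc (t n i) (t n (i + 1)),
      lo n r = t n i ∧ hi n r = t n (i + 1) := by
    intro n hn i r hr
    have hn' : (0 : ℝ) < n := by exact_mod_cast hn
    have hce : ⌈(r - a) * n / (b - a)⌉ = (i : ℤ) + 1 := by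
      rw [Int.ceil_eq_iff]
      simp only [ht, mem_Ioc] at hr
      push_cast
      constructor
      · rw [lt_div_iff₀ hba]
        have := hr.1
        rw [div_mul_eq_mul_div, ← lt_sub_iff_add_lt', div_lt_iff₀ hn'] at this
        linarith
      · rw [div_le_iff₀ hba]
        have := hr.2
        rw [div_mul_eq_mul_div, ← sub_le_iff_le_add', le_div_iff₀ hn'] at this
        push_cast at this
        linarith
    simp only [hlo, hhi, ht, hce]
    push_cast
    exact ⟨by ring, rfl⟩
  have htmem : ∀ n : ℕ, 0 < n → ∀ i ≤ n, t n i ∈ Icc a b := by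
    intro n hn i hin
    have hn' : (0 : ℝ) < n := by exact_mod_cast hn
    have hin' : (i : ℝ) ≤ n := by exact_mod_cast hin
    constructor
    · simp only [ht]; have : 0 ≤ (b - a) / n * i := by positivity
      linarith
    · simp only [ht]
      have : (b - a) / n * i ≤ (b - a) / n * n := mul_le_mul_of_nonneg_left hin' (by positivity)
      rw [div_mul_cancel₀ _ hn'.ne'] at this
      linarith
  have htmono : ∀ n i, t n i ≤ t n (i + 1) := by
    intro n i
    simp only [ht]
    have : 0 ≤ (b - a) / n := by positivity
    push_cast
    nlinarith
  have hsub : ∀ n : ℕ, 0 < n → ∀ i < n, IntervalIntegrable h volume (t n i) (t n (i + 1)) := by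
    intro n hn i hin
    refine hh.mono_set ?_
    rw [uIcc_of_le (htmono n i), uIcc_of_le hab.le]
    exact Icc_subset_Icc (htmem n hn i hin.le).1 (htmem n hn (i + 1) hin).2
  have hbm : ∀ v : Lp ℝ 1 μ, AEStronglyMeasurable (fun x => β (v x)) μ := fun v =>
    hβ.comp_aestronglyMeasurable (Lp.aestronglyMeasurable _)
  -- on each interval of the partition
  have hpiece : ∀ n : ℕ, 0 < n → ∀ i < n,
      IntervalIntegrable (G n) volume (t n i) (t n (i + 1)) ∧
      θ (y (t n (i + 1))) - θ (y (t n i)) ≤ ∫ r in t n i..t n (i + 1), G n r := by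
    intro n hn i hin
    set P := pairing (μ := μ) (fun x => β (w (t n (i + 1)) x)) B (hbm _) (fun x => hB _) with hP
    have hGe : ∀ r ∈ Ioc (t n i) (t n (i + 1)), G n r = θ' (y (t n i)) * P (h r) := by
      intro r hr
      obtain ⟨e1, e2⟩ := hstep n hn i r hr
      simp only [hG, e1, e2, hP, pairing_apply]
    have hPi : IntervalIntegrable (fun r => P (h r)) volume (t n i) (t n (i + 1)) := by
      have := hsub n hn i hin
      exact ⟨P.integrable_comp this.1, P.integrable_comp this.2⟩
    constructor
    · refine (hPi.const_mul (θ' (y (t n i)))).congr ?_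
      rw [uIoc_of_le (htmono n i)]
      exact fun r hr => (hGe r hr).symm
    · have e : ∫ r in t n i..t n (i + 1), G n r
          = θ' (y (t n i)) * P (w (t n (i + 1)) - w (t n i)) := by
        rw [intervalIntegral.integral_congr_ae (g := fun r => θ' (y (t n i)) * P (h r))
          (.of_forall fun r hr => hGe r (by rwa [uIoc_of_le (htmono n i)] at hr)),
          intervalIntegral.integral_const_mul,
          P.intervalIntegral_comp_comm (hsub n hn i hin),
          hw _ (htmem n hn (i + 1) hin), hw _ (htmem n hn i hin.le)]
        have ha : ∀ s ∈ Icc a b, IntervalIntegrable h volume a s := fun s hs =>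
          hh.mono_set (by
            rw [uIcc_of_le hs.1, uIcc_of_le hab.le]; exact Icc_subset_Icc le_rfl hs.2)
        rw [add_sub_add_left_eq_sub, intervalIntegral.integral_interval_sub_left
          (ha _ (htmem n hn (i + 1) hin)) (ha _ (htmem n hn i hin.le))]
      rw [e]
      refine (hθ _ _ (hy0 _) (hy0 _)).trans (mul_le_mul_of_nonneg_left ?_ (hθn _ (hy0 _)))
      exact integral_comp_sub_le hη h0 hL hβ hB hc _ _
  have hle : ∀ n : ℕ, 0 < n → θ (y b) - θ (y a) ≤ ∫ r in a..b, G n r := by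
    intro n hn
    have hn' : (n : ℝ) ≠ 0 := by exact_mod_cast hn.ne'
    have e0 : t n 0 = a := by simp [ht]
    have en : t n n = b := by simp only [ht]; rw [div_mul_cancel₀ _ hn']; ring
    have := intervalIntegral.sum_integral_adjacent_intervals (f := G n) (μ := volume)
      (a := t n) (n := n) (fun k hk => (hpiece n hn k hk).1)
    rw [e0, en] at this
    rw [← this, ← e0, ← en]
    have htel := Finset.sum_range_sub (fun i => θ (y (t n i))) n
    rw [e0] at htel ⊢
    rw [← htel]
    exact Finset.sum_le_sum fun i hi => (hpiece n hn i (Finset.mem_range.1 hi)).2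
  have hmeas : ∀ n : ℕ, 0 < n → IntervalIntegrable (G n) volume a b := by
    intro n hn
    have hn' : (n : ℝ) ≠ 0 := by exact_mod_cast hn.ne'
    have e0 : t n 0 = a := by simp [ht]
    have en : t n n = b := by simp only [ht]; rw [div_mul_cancel₀ _ hn']; ring
    have := IntervalIntegrable.trans_iterate (f := G n) (μ := volume) (a := t n) (n := n)
      (fun k hk => (hpiece n hn k hk).1)
    rwa [e0, en] at this
  have hceil : ∀ n : ℕ, 0 < n → ∀ r ∈ Ioc a b, lo n r ∈ Icc a b ∧ hi n r ∈ Icc a b ∧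
      |lo n r - r| ≤ (b - a) / n ∧ |hi n r - r| ≤ (b - a) / n := by
    intro n hn r hr
    have hn' : (0 : ℝ) < n := by exact_mod_cast hn
    set c : ℤ := ⌈(r - a) * n / (b - a)⌉ with hcdef
    have c1 : (r - a) * n / (b - a) ≤ c := Int.le_ceil _
    have c2 : (c : ℝ) < (r - a) * n / (b - a) + 1 := Int.ceil_lt_add_one _
    have c3 : (1 : ℝ) ≤ c := by
      have : 0 < c := Int.ceil_pos.2 (by have := hr.1; have : 0 < r - a := by linarith
                                         positivity)
      exact_mod_cast this
    have c4 : (c : ℝ) ≤ n := by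
      have : c ≤ (n : ℤ) := Int.ceil_le.2 (by
        rw [div_le_iff₀ hba]; push_cast
        have := hr.2; nlinarith)
      exact_mod_cast this
    have hd : 0 < (b - a) / n := by positivity
    have hr1 : r = a + (b - a) / n * ((r - a) * n / (b - a)) := by field_simp; ring
    have hbn : b = a + (b - a) / n * n := by field_simp; ring
    have hlo' : lo n r = a + (b - a) / n * (c - 1) := rfl
    have hhi' : hi n r = a + (b - a) / n * c := rfl
    set d := (b - a) / n with hdd
    set z := (r - a) * n / (b - a) with hz
    rw [hlo', hhi']
    refine ⟨⟨by nlinarith, by nlinarith⟩, ⟨by nlinarith, by nlinarith⟩, ?_, ?_⟩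
    · rw [abs_le]; constructor <;> nlinarith
    · rw [abs_le]; constructor <;> nlinarith
  have hconv : ∀ r ∈ Ioc a b, ∀ (f : ℕ → ℝ → ℝ), (∀ n : ℕ, 0 < n → f n r ∈ Icc a b ∧
      |f n r - r| ≤ (b - a) / n) → Tendsto (fun n => f n r) atTop (𝓝[Icc a b] r) := by
    intro r hr f hf
    refine tendsto_nhdsWithin_iff.2 ⟨?_, ?_⟩
    · rw [tendsto_iff_dist_tendsto_zero]
      refine squeeze_zero' (.of_forall fun _ => dist_nonneg) ?_
        (tendsto_const_div_atTop_nhds_zero_nat (b - a))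
      filter_upwards [eventually_gt_atTop 0] with n hn
      exact (hf n hn).2
    · filter_upwards [eventually_gt_atTop 0] with n hn
      exact (hf n hn).1
  have hlim : Tendsto (fun n => ∫ r in a..b, G n r) atTop
      (𝓝 (∫ t in a..b, θ' (y t) * ∫ x, β (w t x) * h t x ∂μ)) := by
    refine intervalIntegral.tendsto_integral_filter_of_dominated_convergence
      (fun r => Bθ * (B * ‖h r‖)) ?_ ?_ ((hh.norm.const_mul B).const_mul Bθ) ?_
    · filter_upwards [eventually_gt_atTop 0] with n hn
      rw [uIoc_of_le hab.le]
      exact (hmeas n hn).1.aestronglyMeasurable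
    · filter_upwards with n
      refine .of_forall fun r _ => ?_
      simp only [hG, norm_mul, Real.norm_eq_abs]
      rw [abs_of_nonneg (hθn _ (hy0 _))]
      exact mul_le_mul (hθB _ (hy0 _)) (abs_integral_mul_coeFn_le (fun x => hB _) _)
        (abs_nonneg _) ((hθn _ (hy0 a)).trans (hθB _ (hy0 a)))
    · refine .of_forall fun r hr => ?_
      rw [uIoc_of_le hab.le] at hr
      have hr' : r ∈ Icc a b := Ioc_subset_Icc_self hr
      have h1 := hconv r hr lo (fun n hn => ⟨(hceil n hn r hr).1, (hceil n hn r hr).2.2.1⟩)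
      have h2 := hconv r hr hi (fun n hn => ⟨(hceil n hn r hr).2.1, (hceil n hn r hr).2.2.2⟩)
      refine Tendsto.mul ?_ ?_
      · have hcc : ContinuousOn (fun s => θ' (y s)) (Icc a b) :=
          hθ'.comp hyc (fun s _ => hy0 s)
        exact (hcc r hr').tendsto.comp h1
      · exact tendsto_integral_comp_mul hβ hB ((hwc r hr').tendsto.comp h2) _
  refine ge_of_tendsto hlim ?_
  filter_upwards [eventually_gt_atTop 0] with n hn using hle n hn

end Energy

section Dissipative

variable {X : Type*} [MeasurableSpace X] {μ : Measure X}

lemma ofReal_integral_le_lintegral_ofReal {α : Type*} [MeasurableSpace α] {ν : Measure α}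
    (G : α → ℝ) : ENNReal.ofReal (∫ a, G a ∂ν) ≤ ∫⁻ a, ENNReal.ofReal (G a) ∂ν := by
  by_cases hG : Integrable G ν
  · have h1 : ∫ a, G a ∂ν ≤ ∫ a, max (G a) 0 ∂ν :=
      integral_mono hG hG.pos_part fun a => le_max_left _ _
    refine (ENNReal.ofReal_le_ofReal h1).trans ?_
    rw [ofReal_integral_eq_lintegral_ofReal hG.pos_part (.of_forall fun a => le_max_right _ _)]
    refine lintegral_mono fun a => ?_
    rw [ENNReal.ofReal_max]; simp
  · simp [integral_undef hG]

lemma rpow_sub_rpow_le {s z₁ z₂ : ℝ} (hs0 : 0 ≤ s) (hs1 : s ≤ 1) (h1 : 0 < z₁) (h2 : 0 ≤ z₂) :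
    z₂ ^ s - z₁ ^ s ≤ s * z₁ ^ (s - 1) * (z₂ - z₁) := by
  have h := rpow_one_add_le_one_add_mul_self (s := z₂ / z₁ - 1) (p := s)
    (by have : 0 ≤ z₂ / z₁ := by positivity
        linarith) hs0 hs1
  rw [add_sub_cancel, Real.div_rpow h2 h1.le, div_le_iff₀ (by positivity)] at h
  rw [Real.rpow_sub_one h1.ne']
  have e : s * (z₁ ^ s / z₁) * (z₂ - z₁) = s * (z₂ / z₁ - 1) * z₁ ^ s := by
    field_simp
  rw [e]
  linarith

lemma eLpNorm_ofReal {q : ℝ} (hq : 0 < q) (f : X → ℝ) :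
    eLpNorm f (ENNReal.ofReal q) μ = (∫⁻ x, ENNReal.ofReal (|f x| ^ q) ∂μ) ^ (1 / q) := by
  rw [eLpNorm_eq_lintegral_rpow_enorm_toReal (by simpa using hq) (by simp),
    ENNReal.toReal_ofReal hq.le]
  congr 2
  ext x
  rw [Real.enorm_eq_ofReal_abs, ENNReal.ofReal_rpow_of_nonneg (abs_nonneg _) hq.le]

/-- Hölder's inequality for the derivative `psi q ∘ clamp M` of the truncated power. -/
lemma ofReal_integral_psi_clamp_mul_le {q : ℝ} (hq : 1 < q) {M : ℝ} (hM : 0 ≤ M) (w : Lp ℝ 1 μ)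
    {r : X → ℝ} (hr : AEStronglyMeasurable r μ) :
    ENNReal.ofReal (∫ x, psi q (clamp M (w x)) * r x ∂μ) ≤
      ENNReal.ofReal (q * ∫ x, truncPow q M (w x) ∂μ) ^ (1 - 1 / q) *
        eLpNorm r (ENNReal.ofReal q) μ := by
  have hq0 : 0 < q := by linarith
  have hlip := abs_truncPow_sub_le hq hM
  have hcont : Continuous (truncPow q M) :=
    intervalIntegral.continuous_primitive
      (fun x y => (continuous_psi_clamp hq M).intervalIntegrable x y) 0
  have hint : Integrable (fun x => truncPow q M (w x)) μ :=
    integrable_comp_of_lipschitz hcont (by simp [truncPow]) hlip w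
  have hpq := Real.HolderConjugate.conjExponent hq
  have hbm : AEStronglyMeasurable (fun x => psi q (clamp M (w x))) μ :=
    (continuous_psi_clamp hq M).comp_aestronglyMeasurable (Lp.aestronglyMeasurable _)
  calc ENNReal.ofReal (∫ x, psi q (clamp M (w x)) * r x ∂μ)
      ≤ ∫⁻ x, ENNReal.ofReal (psi q (clamp M (w x)) * r x) ∂μ :=
        ofReal_integral_le_lintegral_ofReal _
    _ ≤ ∫⁻ x, ((fun x => ‖psi q (clamp M (w x))‖ₑ) * fun x => ‖r x‖ₑ) x ∂μ := by
        refine lintegral_mono fun x => ?_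
        rw [Pi.mul_apply, ← enorm_mul]
        exact Real.ofReal_le_enorm _
    _ ≤ (∫⁻ x, ‖psi q (clamp M (w x))‖ₑ ^ (q.conjExponent) ∂μ) ^ (1 / q.conjExponent) *
          (∫⁻ x, ‖r x‖ₑ ^ q ∂μ) ^ (1 / q) :=
        ENNReal.lintegral_mul_le_Lp_mul_Lq μ hpq.symm hbm.enorm hr.enorm
    _ ≤ _ := by
        have e : 1 / q.conjExponent = 1 - 1 / q := by
          rw [Real.conjExponent]; field_simp
        rw [eLpNorm_eq_lintegral_rpow_enorm_toReal (by simpa using hq0) (by simp),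
          ENNReal.toReal_ofReal hq0.le, e]
        refine mul_le_mul_left (ENNReal.rpow_le_rpow ?_ ?_) _
        · rw [← integral_const_mul, ofReal_integral_eq_lintegral_ofReal (hint.const_mul q)
            (.of_forall fun x => mul_nonneg hq0.le (truncPow_nonneg hq hM _))]
          refine lintegral_mono fun x => ?_
          rw [Real.enorm_eq_ofReal_abs,
            ENNReal.ofReal_rpow_of_nonneg (abs_nonneg _) hpq.symm.nonneg, abs_psi hq,
            ← Real.rpow_mul (abs_nonneg _)]
          have : (q - 1) * q.conjExponent = q := by
            rw [Real.conjExponent]; field_simp [(by linarith : q - 1 ≠ 0)]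
          rw [this]
          exact ENNReal.ofReal_le_ofReal (le_mul_truncPow hq hM _)
        · rw [sub_nonneg, div_le_one hq0]; exact hq.le

/-- If `w' = h`, and if `h` is dominated by `r` when tested with monotone functions of `w`, then the
`L^q` norm of `w` grows at most like the integral of the `L^q` norm of `r`. Here `q` is finite, and
no integrability of `w` beyond `L¹` is assumed: the chain rule is applied to the `q`-th root of
`q ∫ truncPow q M (w)`, which tends to the `L^q` norm of `w` as `M → ∞`. -/
theorem eLpNorm_le_of_dissipative {q : ℝ} (hq : 1 < q) {a b : ℝ} (hab : a ≤ b)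
    {w h : ℝ → Lp ℝ 1 μ} (hh : IntervalIntegrable h volume a b)
    (hw : ∀ t ∈ Icc a b, w t = w a + ∫ s in a..t, h s) {ρ : ℝ → ℝ≥0∞}
    (H : ∀ᵐ t ∂(volume.restrict (Ioc a b)), ∃ r : X → ℝ, AEStronglyMeasurable r μ ∧
      (∀ β : ℝ → ℝ, Continuous β → Monotone β → (∃ B, ∀ s, |β s| ≤ B) →
        ∫ x, β (w t x) * h t x ∂μ ≤ ∫ x, β (w t x) * r x ∂μ) ∧
      eLpNorm r (ENNReal.ofReal q) μ ≤ ρ t) :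
    eLpNorm (w b) (ENNReal.ofReal q) μ ≤
      eLpNorm (w a) (ENNReal.ofReal q) μ + ∫⁻ t in Ioc a b, ρ t := by
  rcases hab.eq_or_lt with rfl | hab
  · exact le_self_add
  have hq0 : 0 < q := by linarith
  have hs0 : 0 ≤ 1 / q := by positivity
  have hs1 : 1 / q ≤ 1 := by rw [div_le_one hq0]; exact hq.le
  set N := eLpNorm (w a) (ENNReal.ofReal q) μ with hN
  rcases eq_or_ne N ⊤ with hNt | hNt
  · rw [hNt, top_add]; exact le_top
  -- `δ` regularizes the root `θ y = (q y + δ)^{1/q}` at `y = 0`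
  have main : ∀ (M δ : ℝ), 0 ≤ M → 0 < δ →
      eLpNorm (fun x => clamp M (w b x)) (ENNReal.ofReal q) μ ≤
        (N ^ q + ENNReal.ofReal δ) ^ (1 / q) + ∫⁻ t in Ioc a b, ρ t := by
    intro M δ hM hδ
    have hlip := abs_truncPow_sub_le hq hM
    have hcont : Continuous (truncPow q M) :=
      intervalIntegral.continuous_primitive
        (fun x y => (continuous_psi_clamp hq M).intervalIntegrable x y) 0
    have hint : ∀ v : Lp ℝ 1 μ, Integrable (fun x => truncPow q M (v x)) μ :=
      fun v => integrable_comp_of_lipschitz hcont (by simp [truncPow]) hlip v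
    have hpos : ∀ v : Lp ℝ 1 μ, 0 ≤ ∫ x, truncPow q M (v x) ∂μ :=
      fun v => integral_nonneg fun x => truncPow_nonneg hq hM _
    have hqδ : ∀ y : ℝ, 0 ≤ y → 0 < q * y + δ := fun y hy => by positivity
    have hch := chain_rule_le (μ := μ) hcont (by simp [truncPow]) (truncPow_nonneg hq hM) hlip
      (continuous_psi_clamp hq M) (abs_psi_clamp_le hq hM) (truncPow_sub_le hq M)
      (θ := fun y => (q * y + δ) ^ (1 / q)) (θ' := fun y => (q * y + δ) ^ (1 / q - 1))
      (Bθ := δ ^ (1 / q - 1))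
      (ContinuousOn.rpow_const (by fun_prop) (fun y hy => Or.inl (hqδ y hy).ne'))
      (fun y hy => Real.rpow_nonneg (hqδ y hy).le _)
      (fun y hy => Real.rpow_le_rpow_of_nonpos hδ (by nlinarith) (by linarith))
      (fun y₁ y₂ h1 h2 => by
        have := rpow_sub_rpow_le hs0 hs1 (hqδ y₁ h1) (hqδ y₂ h2).le
        refine this.trans (le_of_eq ?_)
        field_simp; ring)
      hab hh hw
    set y : ℝ → ℝ := fun t => ∫ x, truncPow q M (w t x) ∂μ with hy
    have hG : ENNReal.ofReal (∫ t in a..b, (q * y t + δ) ^ (1 / q - 1) *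
        ∫ x, psi q (clamp M (w t x)) * h t x ∂μ) ≤ ∫⁻ t in Ioc a b, ρ t := by
      rw [intervalIntegral.integral_of_le hab.le]
      refine (ofReal_integral_le_lintegral_ofReal _).trans (lintegral_mono_ae ?_)
      filter_upwards [H] with t ⟨r, hr, hβ, hρ⟩
      have h1 := hβ _ (continuous_psi_clamp hq M) (monotone_psi_clamp hq M)
        ⟨_, abs_psi_clamp_le hq hM⟩
      have h2 := hqδ (y t) (hpos _)
      rw [ENNReal.ofReal_mul (by positivity)]
      calc _ ≤ ENNReal.ofReal ((q * y t + δ) ^ (1 / q - 1)) *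
            (ENNReal.ofReal (q * y t) ^ (1 - 1 / q) * eLpNorm r (ENNReal.ofReal q) μ) :=
            mul_le_mul_right ((ENNReal.ofReal_le_ofReal h1).trans
              (ofReal_integral_psi_clamp_mul_le hq hM (w t) hr)) _
        _ ≤ 1 * ρ t := by
            rw [← mul_assoc]
            refine mul_le_mul' ?_ hρ
            rw [ENNReal.ofReal_rpow_of_nonneg (mul_nonneg hq0.le (hpos _)) (by linarith),
              ← ENNReal.ofReal_mul (by positivity)]
            refine ENNReal.ofReal_le_one.2 ?_
            have h3 : (q * y t) ^ (1 - 1 / q) ≤ (q * y t + δ) ^ (1 - 1 / q) :=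
              Real.rpow_le_rpow (mul_nonneg hq0.le (hpos _)) (by linarith) (by linarith)
            refine (mul_le_mul_of_nonneg_left h3 (by positivity)).trans (le_of_eq ?_)
            rw [← Real.rpow_add h2]; simp
        _ = ρ t := one_mul _
    have hb : eLpNorm (fun x => clamp M (w b x)) (ENNReal.ofReal q) μ ≤
        ENNReal.ofReal ((q * y b + δ) ^ (1 / q)) := by
      rw [eLpNorm_ofReal hq0, ← ENNReal.ofReal_rpow_of_nonneg (hqδ _ (hpos _)).le hs0]
      refine ENNReal.rpow_le_rpow ?_ hs0
      refine le_trans ?_ (ENNReal.ofReal_le_ofReal (le_add_of_nonneg_right hδ.le))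
      rw [← integral_const_mul, ofReal_integral_eq_lintegral_ofReal ((hint _).const_mul q)
            (.of_forall fun x => mul_nonneg hq0.le (truncPow_nonneg hq hM _))]
      exact lintegral_mono fun x => ENNReal.ofReal_le_ofReal (le_mul_truncPow hq hM _)
    have ha : ENNReal.ofReal ((q * y a + δ) ^ (1 / q)) ≤ (N ^ q + ENNReal.ofReal δ) ^ (1 / q) := by
      rw [← ENNReal.ofReal_rpow_of_nonneg (hqδ _ (hpos _)).le hs0,
        ENNReal.ofReal_add (mul_nonneg hq0.le (hpos _)) hδ.le]
      refine ENNReal.rpow_le_rpow (add_le_add_left ?_ _) hs0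
      rw [hN, eLpNorm_ofReal hq0, ← ENNReal.rpow_mul, one_div_mul_cancel hq0.ne', ENNReal.rpow_one,
        ← integral_const_mul, ofReal_integral_eq_lintegral_ofReal ((hint _).const_mul q)
            (.of_forall fun x => mul_nonneg hq0.le (truncPow_nonneg hq hM _))]
      exact lintegral_mono fun x => ENNReal.ofReal_le_ofReal (mul_truncPow_le hq hM _)
    calc _ ≤ ENNReal.ofReal ((q * y b + δ) ^ (1 / q)) := hb
      _ ≤ ENNReal.ofReal ((q * y a + δ) ^ (1 / q) + ∫ t in a..b, (q * y t + δ) ^ (1 / q - 1) *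
            ∫ x, psi q (clamp M (w t x)) * h t x ∂μ) :=
          ENNReal.ofReal_le_ofReal (by linarith [hch])
      _ ≤ _ := ENNReal.ofReal_add_le
      _ ≤ _ := add_le_add ha hG
  -- `M → ∞` by Fatou's lemma, `δ → 0` by continuity
  have hF := Lp.eLpNorm_lim_le_liminf_eLpNorm (μ := μ) (p := ENNReal.ofReal q)
    (f := fun (n : ℕ) x => clamp n (w b x))
    (fun n => (continuous_clamp _).comp_aestronglyMeasurable (Lp.aestronglyMeasurable _)) (w b)
    (.of_forall fun x => tendsto_clamp _)
  have hlim : Tendsto (fun n : ℕ => (N ^ q + ENNReal.ofReal (1 / ((n : ℝ) + 1))) ^ (1 / q) +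
      ∫⁻ t in Ioc a b, ρ t) atTop (𝓝 (N + ∫⁻ t in Ioc a b, ρ t)) := by
    refine Tendsto.add_const _ ?_
    have h1 : Tendsto (fun n : ℕ => N ^ q + ENNReal.ofReal (1 / ((n : ℝ) + 1))) atTop
        (𝓝 (N ^ q + ENNReal.ofReal 0)) :=
      tendsto_const_nhds.add (ENNReal.tendsto_ofReal tendsto_one_div_add_atTop_nhds_zero_nat)
    have h2 := (ENNReal.continuous_rpow_const (y := 1 / q)).tendsto _ |>.comp h1
    rwa [ENNReal.ofReal_zero, add_zero, ← ENNReal.rpow_mul, mul_one_div_cancel hq0.ne',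
      ENNReal.rpow_one] at h2
  refine hF.trans ((liminf_le_liminf (.of_forall fun (n : ℕ) => main n (1 / ((n : ℝ) + 1))
    n.cast_nonneg (by positivity))).trans hlim.liminf_eq.le)

end Dissipative

/-! ### Nonlocal operators with a monotone nonlinearity -/

section Comparison

variable {X : Type*} [MeasurableSpace X] {μ : Measure X}

/-- Nonnegative measurable symmetric kernels on a measure space whose rows are bounded in `L²`, all
conditions being required almost everywhere only. -/
structure IsAEKernel (μ : Measure X) (K : X → X → ℝ) : Prop where
  nonneg : ∀ᵐ z ∂(μ.prod μ), 0 ≤ K z.1 z.2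
  measurable : AEStronglyMeasurable (Function.uncurry K) (μ.prod μ)
  symm : ∀ᵐ z ∂(μ.prod μ), K z.1 z.2 = K z.2 z.1
  bounded : ∃ κ : ℝ≥0∞, κ < ⊤ ∧ ∀ᵐ x ∂μ, eLpNorm (K x) 2 μ ≤ κ

/-- The domain condition for the nonlocal operator with nonlinearity `Ψ`. -/
def InDom (μ : Measure X) (K : X → X → ℝ) (Ψ : ℝ → ℝ) (v : X → ℝ) : Prop :=
  Integrable (fun z : X × X => K z.1 z.2 * Ψ (v z.2 - v z.1)) (μ.prod μ)

/-- The drift `x ↦ ∫ K(x,y) Ψ(v(y) - v(x)) dy`; for `Ψ = psi p` it is minus the nonlocal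
`p`-Laplacian. -/
noncomputable def drift (μ : Measure X) (K : X → X → ℝ) (Ψ : ℝ → ℝ) (v : X → ℝ) (x : X) : ℝ :=
  ∫ y, K x y * Ψ (v y - v x) ∂μ

/-- `u` solves `∂ₜ u = drift u + f`, `u(0) = g`, as the primitive in `L¹(μ)` of an integrable time
derivative `D`. -/
structure IsStrong (μ : Measure X) (T : ℝ) (K : X → X → ℝ) (Ψ : ℝ → ℝ) (g : X → ℝ)
    (f : ℝ → X → ℝ) (u D : ℝ → Lp ℝ 1 μ) : Prop where
  integrable : IntegrableOn D (Ioo 0 T)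
  primitive : ∀ t ∈ Icc 0 T, u t = u 0 + ∫ s in (0 : ℝ)..t, D s
  initial : u 0 =ᵐ[μ] g
  equation : ∀ᵐ t ∂(volume.restrict (Ioo 0 T)), InDom μ K Ψ (u t) ∧
    ∀ᵐ x ∂μ, D t x = drift μ K Ψ (u t) x + f t x

lemma InDom.congr {K : X → X → ℝ} {Ψ : ℝ → ℝ} {v w : X → ℝ} [SFinite μ] (hv : InDom μ K Ψ v)
    (h : v =ᵐ[μ] w) : InDom μ K Ψ w := by
  have h1 : ∀ᵐ z ∂(μ.prod μ), v z.1 = w z.1 := Measure.quasiMeasurePreserving_fst.ae h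
  have h2 : ∀ᵐ z ∂(μ.prod μ), v z.2 = w z.2 := Measure.quasiMeasurePreserving_snd.ae h
  refine Integrable.congr hv ?_
  filter_upwards [h1, h2] with z e1 e2
  rw [e1, e2]

lemma drift_congr {K : X → X → ℝ} {Ψ : ℝ → ℝ} {v w : X → ℝ} (h : v =ᵐ[μ] w) :
    drift μ K Ψ v =ᵐ[μ] drift μ K Ψ w := by
  filter_upwards [h] with x hx
  refine integral_congr_ae ?_
  filter_upwards [h] with y hy
  rw [hx, hy]

variable [SFinite μ]

lemma InDom.integrable_drift {K : X → X → ℝ} {Ψ : ℝ → ℝ} {v : X → ℝ} (hv : InDom μ K Ψ v) :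
    Integrable (drift μ K Ψ v) μ :=
  Integrable.integral_prod_left hv

lemma drift_sub_ae {K L : X → X → ℝ} {Ψ Θ : ℝ → ℝ} {v w : X → ℝ} (hv : InDom μ K Ψ v)
    (hw : InDom μ L Θ w) : ∀ᵐ x ∂μ, drift μ K Ψ v x - drift μ L Θ w x =
      ∫ y, (K x y * Ψ (v y - v x) - L x y * Θ (w y - w x)) ∂μ := by
  filter_upwards [Integrable.prod_right_ae hv, Integrable.prod_right_ae hw] with x h1 h2
  exact (integral_sub h1 h2).symm

/-- Complete accretivity of the nonlocal operator. The integrand is antisymmetric under the exchange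
of the two variables, and `β(v - w)` and `Ψ` are monotone. -/
lemma integral_comp_mul_drift_sub_nonpos {K : X → X → ℝ} (hK : IsAEKernel μ K) {Ψ : ℝ → ℝ}
    (hΨ : Monotone Ψ) (hodd : ∀ s, Ψ (-s) = - Ψ s) {v w : X → ℝ}
    (hvm : AEStronglyMeasurable v μ) (hwm : AEStronglyMeasurable w μ)
    (hv : InDom μ K Ψ v) (hw : InDom μ K Ψ w) {β : ℝ → ℝ} (hβ : Continuous β)
    (hmono : Monotone β) {B : ℝ} (hB : ∀ s, |β s| ≤ B) :
    ∫ x, β (v x - w x) * (drift μ K Ψ v x - drift μ K Ψ w x) ∂μ ≤ 0 := by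
  set k : X × X → ℝ := fun z => K z.1 z.2 * Ψ (v z.2 - v z.1) - K z.1 z.2 * Ψ (w z.2 - w z.1)
    with hk
  have hki : Integrable k (μ.prod μ) := Integrable.sub hv hw
  set b : X → ℝ := fun x => β (v x - w x) with hb
  have hbm : AEStronglyMeasurable b μ := hβ.comp_aestronglyMeasurable (hvm.sub hwm)
  have i1 : Integrable (fun z => b z.1 * k z) (μ.prod μ) :=
    hki.bdd_mul hbm.comp_fst (.of_forall fun z => hB _)
  have i2 : Integrable (fun z => b z.2 * k z) (μ.prod μ) :=
    hki.bdd_mul hbm.comp_snd (.of_forall fun z => hB _)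
  have e1 : ∫ x, b x * (drift μ K Ψ v x - drift μ K Ψ w x) ∂μ = ∫ z, b z.1 * k z ∂(μ.prod μ) := by
    rw [integral_prod _ i1]
    refine integral_congr_ae ?_
    filter_upwards [drift_sub_ae hv hw] with x hx
    rw [hx, integral_const_mul]
  have e2 : ∫ z, b z.1 * k z ∂(μ.prod μ) = - ∫ z, b z.2 * k z ∂(μ.prod μ) := by
    rw [← integral_prod_swap (fun z => b z.1 * k z), ← integral_neg]
    refine integral_congr_ae ?_
    filter_upwards [hK.symm] with z hz
    simp only [hk, Prod.fst_swap, Prod.snd_swap]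
    rw [← hz, show v z.1 - v z.2 = -(v z.2 - v z.1) by ring,
      show w z.1 - w z.2 = -(w z.2 - w z.1) by ring, hodd, hodd]
    ring
  have e3 : ∫ z, b z.1 * k z ∂(μ.prod μ) - ∫ z, b z.2 * k z ∂(μ.prod μ) ≤ 0 := by
    rw [← integral_sub i1 i2]
    refine integral_nonpos_of_ae ?_
    filter_upwards [hK.nonneg] with z hz
    simp only [hk, hb, Pi.zero_apply]
    rw [← mul_sub, ← sub_mul]
    rcases le_total (v z.1 - w z.1) (v z.2 - w z.2) with h | h
    · have h1 := hmono h
      have h2 : Ψ (w z.2 - w z.1) ≤ Ψ (v z.2 - v z.1) := hΨ (by linarith)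
      exact mul_nonpos_of_nonpos_of_nonneg (by linarith) (mul_nonneg hz (by linarith))
    · have h1 := hmono h
      have h2 : Ψ (v z.2 - v z.1) ≤ Ψ (w z.2 - w z.1) := hΨ (by linarith)
      exact mul_nonpos_of_nonneg_of_nonpos (by linarith)
        (mul_nonpos_of_nonneg_of_nonpos hz (by linarith))
  rw [e1]; linarith

/-- Comparison of two solutions in `L^q`. The residual on the right-hand side evaluates both
operators at the second solution. -/
theorem IsStrong.eLpNorm_sub_le {q : ℝ} (hq : 1 < q) {T : ℝ} {K L : X → X → ℝ} {Ψ Θ : ℝ → ℝ}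
    {g g' : X → ℝ} {f f' : ℝ → X → ℝ} {u D u' D' : ℝ → Lp ℝ 1 μ}
    (hK : IsAEKernel μ K) (hΨ : Monotone Ψ) (hodd : ∀ s, Ψ (-s) = - Ψ s)
    (hu : IsStrong μ T K Ψ g f u D) (hu' : IsStrong μ T L Θ g' f' u' D') {ρ : ℝ → ℝ≥0∞}
    (hρ : ∀ᵐ t ∂(volume.restrict (Ioo 0 T)), InDom μ K Ψ (u' t) ∧
      eLpNorm (fun x => drift μ K Ψ (u' t) x - drift μ L Θ (u' t) x + (f t x - f' t x))
        (ENNReal.ofReal q) μ ≤ ρ t) {t : ℝ} (ht : t ∈ Icc 0 T) :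
    eLpNorm (u t - u' t : Lp ℝ 1 μ) (ENNReal.ofReal q) μ ≤
      eLpNorm (g - g') (ENNReal.ofReal q) μ + ∫⁻ s in Ioc 0 t, ρ s := by
  have hii : ∀ {E : ℝ → Lp ℝ 1 μ}, IntegrableOn E (Ioo 0 T) → ∀ s ∈ Icc 0 T,
      IntervalIntegrable E volume 0 s := fun hE s hs => by
    rw [intervalIntegrable_iff_integrableOn_Ioo_of_le hs.1]
    exact hE.mono_set (Ioo_subset_Ioo_right hs.2)
  have h0 : eLpNorm (u 0 - u' 0 : Lp ℝ 1 μ) (ENNReal.ofReal q) μ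
      = eLpNorm (g - g') (ENNReal.ofReal q) μ := by
    refine eLpNorm_congr_ae ?_
    filter_upwards [Lp.coeFn_sub (u 0) (u' 0), hu.initial, hu'.initial] with x h1 h2 h3
    rw [h1, Pi.sub_apply, h2, h3, Pi.sub_apply]
  rw [← h0]
  refine eLpNorm_le_of_dissipative (w := fun s => u s - u' s) (h := fun s => D s - D' s) hq ht.1
    ((hii hu.integrable t ht).sub (hii hu'.integrable t ht)) (fun s hs => ?_) ?_
  · have hs' : s ∈ Icc 0 T := ⟨hs.1, hs.2.trans ht.2⟩
    rw [intervalIntegral.integral_sub (hii hu.integrable s hs') (hii hu'.integrable s hs')]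
    rw [hu.primitive s hs', hu'.primitive s hs']
    abel
  · have hmono : ∀ {P : ℝ → Prop}, (∀ᵐ t ∂(volume.restrict (Ioo 0 T)), P t) →
        ∀ᵐ s ∂(volume.restrict (Ioc 0 t)), P s := fun h => by
      rw [restrict_Ioo_eq_restrict_Ioc] at h
      exact ae_mono (Measure.restrict_mono (Ioc_subset_Ioc_right ht.2) le_rfl) h
    filter_upwards [hmono hu.equation, hmono hu'.equation, hmono hρ] with s ⟨hd, he⟩ ⟨hd', he'⟩
      ⟨hdc, hb⟩
    set r : X → ℝ := fun x => drift μ K Ψ (u' s) x - drift μ L Θ (u' s) x + (f s x - f' s x)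
      with hr
    have hsub : ∀ᵐ x ∂μ, (D s - D' s : Lp ℝ 1 μ) x =
        (drift μ K Ψ (u s) x - drift μ K Ψ (u' s) x) + r x := by
      filter_upwards [Lp.coeFn_sub (D s) (D' s), he, he'] with x h1 h2 h3
      rw [h1, Pi.sub_apply, h2, h3, hr]; ring
    have hαi : Integrable (fun x => drift μ K Ψ (u s) x - drift μ K Ψ (u' s) x) μ :=
      hd.integrable_drift.sub hdc.integrable_drift
    have hri : Integrable r μ := by
      refine ((L1.integrable_coeFn (D s - D' s)).sub hαi).congr ?_
      filter_upwards [hsub] with x hx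
      rw [Pi.sub_apply, hx]; ring
    refine ⟨r, hri.aestronglyMeasurable, fun β hβ hβm ⟨B, hB⟩ => ?_, hb⟩
    have hbm : AEStronglyMeasurable (fun x => β ((u s - u' s : Lp ℝ 1 μ) x)) μ :=
      hβ.comp_aestronglyMeasurable (Lp.aestronglyMeasurable _)
    have hacc := integral_comp_mul_drift_sub_nonpos hK hΨ hodd (Lp.aestronglyMeasurable (u s))
      (Lp.aestronglyMeasurable (u' s)) hd hdc hβ hβm hB
    have e : ∫ x, β ((u s - u' s : Lp ℝ 1 μ) x) * (D s - D' s : Lp ℝ 1 μ) x ∂μ =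
        ∫ x, β (u s x - u' s x) * (drift μ K Ψ (u s) x - drift μ K Ψ (u' s) x) ∂μ +
          ∫ x, β ((u s - u' s : Lp ℝ 1 μ) x) * r x ∂μ := by
      have e1 : ∀ᵐ x ∂μ, β ((u s - u' s : Lp ℝ 1 μ) x) *
          (drift μ K Ψ (u s) x - drift μ K Ψ (u' s) x) =
          β (u s x - u' s x) * (drift μ K Ψ (u s) x - drift μ K Ψ (u' s) x) := by
        filter_upwards [Lp.coeFn_sub (u s) (u' s)] with x hx
        rw [hx, Pi.sub_apply]
      rw [← integral_congr_ae e1, ← integral_add (hαi.bdd_mul hbm (.of_forall fun x => hB _))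
        (hri.bdd_mul hbm (.of_forall fun x => hB _))]
      refine integral_congr_ae ?_
      filter_upwards [hsub] with x hx
      rw [hx, mul_add]
    linarith

/-- The zero solution of the problem with zero data. -/
lemma isStrong_zero (T : ℝ) (K : X → X → ℝ) {Ψ : ℝ → ℝ} (h0 : Ψ 0 = 0) :
    IsStrong μ T K Ψ 0 0 (0 : ℝ → Lp ℝ 1 μ) 0 := by
  have hz : ((0 : Lp ℝ 1 μ) : X → ℝ) =ᵐ[μ] 0 := Lp.coeFn_zero _ _ _
  have hd : InDom μ K Ψ (0 : X → ℝ) := by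
    simp [InDom, h0]
  refine ⟨integrable_zero _ _ _, fun t _ => by simp, hz, .of_forall fun t => ⟨hd.congr hz.symm, ?_⟩⟩
  filter_upwards [hz, drift_congr (K := K) (Ψ := Ψ) hz] with x h1 h2
  simp only [Pi.zero_apply]
  rw [h2, h1]
  simp [drift, h0]

/-- The `L^q` norm of a solution is bounded by that of the data. -/
lemma IsStrong.eLpNorm_le {q : ℝ} (hq : 1 < q) {T : ℝ} {K : X → X → ℝ} {Ψ : ℝ → ℝ}
    {g : X → ℝ} {f : ℝ → X → ℝ} {u D : ℝ → Lp ℝ 1 μ}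
    (hK : IsAEKernel μ K) (hΨ : Monotone Ψ) (hodd : ∀ s, Ψ (-s) = - Ψ s)
    (hu : IsStrong μ T K Ψ g f u D) {t : ℝ} (ht : t ∈ Icc 0 T) :
    eLpNorm (u t) (ENNReal.ofReal q) μ ≤ eLpNorm g (ENNReal.ofReal q) μ +
      ∫⁻ s in Ioc 0 t, eLpNorm (f s) (ENNReal.ofReal q) μ := by
  have h0 : Ψ 0 = 0 := by have := hodd 0; simp at this; linarith
  have hz := isStrong_zero (μ := μ) T K h0
  have := IsStrong.eLpNorm_sub_le hq hK hΨ hodd hu hz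
    (ρ := fun s => eLpNorm (f s) (ENNReal.ofReal q) μ) (by
      filter_upwards [hz.equation] with s hs
      refine ⟨hs.1, le_of_eq (congrArg (fun F => eLpNorm F _ μ) ?_)⟩
      ext x; simp) ht
  simpa using this

end Comparison

/-! ### Bounds on the nonlocal operator -/

section Bounds

variable {X : Type*} [MeasurableSpace X] {μ : Measure X}

lemma enorm_sub_rpow_le {s : ℝ} (hs : 0 ≤ s) (a b : ℝ) :
    ‖a - b‖ₑ ^ s ≤ 2 ^ s * (‖a‖ₑ ^ s + ‖b‖ₑ ^ s) := by
  have h1 : ‖a - b‖ₑ ≤ 2 * max ‖a‖ₑ ‖b‖ₑ := by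
    refine (enorm_sub_le).trans ?_
    rw [two_mul]
    exact add_le_add (le_max_left _ _) (le_max_right _ _)
  refine (ENNReal.rpow_le_rpow h1 hs).trans ?_
  rw [ENNReal.mul_rpow_of_nonneg _ _ hs]
  refine mul_le_mul_right ?_ _
  rcases max_choice ‖a‖ₑ ‖b‖ₑ with h | h <;> rw [h]
  · exact le_self_add
  · exact le_add_self

/-- `x ↦ ∫ |H(x,y)| |v(y) - v(x)|^σ dy`, which dominates the drift. -/
noncomputable def absDrift (μ : Measure X) (H : X → X → ℝ) (σ : ℝ) (v : X → ℝ) (x : X) : ℝ≥0∞ :=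
  ∫⁻ y, ‖H x y‖ₑ * ‖v y - v x‖ₑ ^ σ ∂μ

/-- The exponent `q = max(2, 2(p-1))`: data in `L^q` make both `|v|^{p-1}` and `v` square
integrable. -/
noncomputable def dataExp (p : ℝ) : ℝ := max 2 (2 * (p - 1))

lemma two_le_dataExp (p : ℝ) : 2 ≤ dataExp p := le_max_left _ _

lemma le_dataExp (p : ℝ) : 2 * (p - 1) ≤ dataExp p := le_max_right _ _

/-- The bound for the `L²` norm of `absDrift`, per unit of the norm of the kernel, in terms of the
`L^q` norm `N` of the argument. The first factor comes from integrating
`|a - b|^{2(p-1)} ≤ 2^{2(p-1)} (|a|^{2(p-1)} + |b|^{2(p-1)})` over both variables, the power of the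
mass of `μ` from the inclusion of `L^q` in `L^{2(p-1)}`. -/
noncomputable def growth (μ : Measure X) (p : ℝ) (N : ℝ≥0∞) : ℝ≥0∞ :=
  (2 ^ (2 * (p - 1) + 1) * μ univ) ^ (1 / 2 : ℝ) *
    (N * μ univ ^ (1 / (2 * (p - 1)) - 1 / dataExp p)) ^ (p - 1)

lemma growth_mono {p : ℝ} (hp : 1 < p) {M N : ℝ≥0∞} (h : M ≤ N) :
    growth μ p M ≤ growth μ p N :=
  mul_le_mul_right (ENNReal.rpow_le_rpow (mul_le_mul_left h _) (by linarith)) _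

lemma aemeasurable_enorm_mul_rpow [SFinite μ] {H : X → X → ℝ}
    (hH : AEStronglyMeasurable (Function.uncurry H) (μ.prod μ)) {v : X → ℝ}
    (hv : AEStronglyMeasurable v μ) (σ : ℝ) :
    AEMeasurable (fun z : X × X => ‖H z.1 z.2‖ₑ * ‖v z.2 - v z.1‖ₑ ^ σ) (μ.prod μ) :=
  hH.enorm.mul ((hv.comp_snd.sub hv.comp_fst).enorm.pow_const σ)

lemma eLpNorm_two_eq {ε : Type*} [ENorm ε] (f : X → ε) :
    eLpNorm f 2 μ = (∫⁻ x, ‖f x‖ₑ ^ (2 : ℝ) ∂μ) ^ (1 / 2 : ℝ) := by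
  rw [eLpNorm_eq_lintegral_rpow_enorm_toReal (by simp) (by simp)]
  simp

lemma aestronglyMeasurable_mul_comp [SFinite μ] {K : X → X → ℝ}
    (hK : AEStronglyMeasurable (Function.uncurry K) (μ.prod μ)) {Ψ : ℝ → ℝ} (hΨ : Continuous Ψ)
    {v : X → ℝ} (hv : AEStronglyMeasurable v μ) :
    AEStronglyMeasurable (fun z : X × X => K z.1 z.2 * Ψ (v z.2 - v z.1)) (μ.prod μ) :=
  hK.mul (hΨ.comp_aestronglyMeasurable (hv.comp_snd.sub hv.comp_fst))

lemma enorm_psi {p : ℝ} (hp : 1 < p) (s : ℝ) : ‖psi p s‖ₑ = ‖s‖ₑ ^ (p - 1) := by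
  rw [Real.enorm_eq_ofReal_abs, abs_psi hp, Real.enorm_eq_ofReal_abs,
    ENNReal.ofReal_rpow_of_nonneg (abs_nonneg _) (by linarith)]

lemma enorm_drift_psi_le {p : ℝ} (hp : 1 < p) (K : X → X → ℝ) (v : X → ℝ) (x : X) :
    ‖drift μ K (psi p) v x‖ₑ ≤ absDrift μ K (p - 1) v x := by
  refine (enorm_integral_le_lintegral_enorm _).trans (le_of_eq ?_)
  simp only [enorm_mul, enorm_psi hp, absDrift]

lemma lintegral_enorm_rpow_two_mul_le {p : ℝ} (hp : 1 < p) {v : X → ℝ}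
    (hv : AEStronglyMeasurable v μ) :
    ∫⁻ x, ‖v x‖ₑ ^ (2 * (p - 1)) ∂μ ≤ (eLpNorm v (ENNReal.ofReal (dataExp p)) μ *
      μ univ ^ (1 / (2 * (p - 1)) - 1 / dataExp p)) ^ (2 * (p - 1)) := by
  have hs : 0 < 2 * (p - 1) := by linarith
  have h := eLpNorm_le_eLpNorm_mul_rpow_measure_univ (μ := μ)
    (ENNReal.ofReal_le_ofReal (le_dataExp p)) hv
  rw [ENNReal.toReal_ofReal hs.le, ENNReal.toReal_ofReal (by linarith [two_le_dataExp p])] at h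
  refine le_trans (le_of_eq ?_) (ENNReal.rpow_le_rpow h hs.le)
  rw [eLpNorm_eq_lintegral_rpow_enorm_toReal (by simpa using hp) ENNReal.ofReal_ne_top,
    ENNReal.toReal_ofReal hs.le, ← ENNReal.rpow_mul, one_div_mul_cancel hs.ne', ENNReal.rpow_one]

variable [IsFiniteMeasure μ]

lemma exponent_nonneg {p : ℝ} (hp : 1 < p) : 0 ≤ 1 / (2 * (p - 1)) - 1 / dataExp p :=
  sub_nonneg.2 (one_div_le_one_div_of_le (by linarith) (le_dataExp p))

lemma growth_lt_top {p : ℝ} (hp : 1 < p) {N : ℝ≥0∞} (h : N < ⊤) : growth μ p N < ⊤ := by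
  have h2 : (2 : ℝ≥0∞) ^ (2 * (p - 1) + 1) < ⊤ :=
    ENNReal.rpow_lt_top_of_nonneg (by linarith) (by simp)
  have hμ : μ univ < ⊤ := measure_lt_top _ _
  exact ENNReal.mul_lt_top
    (ENNReal.rpow_lt_top_of_nonneg (by norm_num) (ENNReal.mul_lt_top h2 hμ).ne)
    (ENNReal.rpow_lt_top_of_nonneg (by linarith) (ENNReal.mul_lt_top h
      (ENNReal.rpow_lt_top_of_nonneg (exponent_nonneg hp) hμ.ne)).ne)

lemma tendsto_growth_zero {p : ℝ} (hp : 1 < p) {N : ℕ → ℝ≥0∞} (h : Tendsto N atTop (𝓝 0)) :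
    Tendsto (fun n => growth μ p (N n)) atTop (𝓝 0) := by
  have hμ : μ univ < ⊤ := measure_lt_top _ _
  have h2 : (2 : ℝ≥0∞) ^ (2 * (p - 1) + 1) < ⊤ :=
    ENNReal.rpow_lt_top_of_nonneg (by linarith) (by simp)
  have hc : μ univ ^ (1 / (2 * (p - 1)) - 1 / dataExp p) ≠ ⊤ :=
    (ENNReal.rpow_lt_top_of_nonneg (exponent_nonneg hp) hμ.ne).ne
  have h1 := ENNReal.Tendsto.mul_const h (Or.inr hc)
  rw [zero_mul] at h1
  have h3 := ((ENNReal.continuous_rpow_const (y := p - 1)).tendsto _).comp h1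
  have h4 := ENNReal.Tendsto.const_mul (a := (2 ^ (2 * (p - 1) + 1) * μ univ) ^ (1 / 2 : ℝ)) h3
    (Or.inr (ENNReal.rpow_lt_top_of_nonneg (by norm_num) (ENNReal.mul_lt_top h2 hμ).ne).ne)
  rw [ENNReal.zero_rpow_of_pos (by linarith), mul_zero] at h4
  exact h4

lemma aemeasurable_absDrift {H : X → X → ℝ} (hH : AEStronglyMeasurable (Function.uncurry H)
    (μ.prod μ)) {v : X → ℝ} (hv : AEStronglyMeasurable v μ) (σ : ℝ) :
    AEMeasurable (absDrift μ H σ v) μ :=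
  (aemeasurable_enorm_mul_rpow hH hv σ).lintegral_prod_right'

lemma lintegral_absDrift {H : X → X → ℝ} (hH : AEStronglyMeasurable (Function.uncurry H)
    (μ.prod μ)) {v : X → ℝ} (hv : AEStronglyMeasurable v μ) (σ : ℝ) :
    ∫⁻ x, absDrift μ H σ v x ∂μ = ∫⁻ z, ‖H z.1 z.2‖ₑ * ‖v z.2 - v z.1‖ₑ ^ σ ∂(μ.prod μ) :=
  (lintegral_prod _ (aemeasurable_enorm_mul_rpow hH hv σ)).symm

/-- The `L²` bound of `absDrift` by the `L^{∞,2}` norm of the kernel: Hölder's inequality in `y`. -/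
lemma eLpNorm_absDrift_le {p : ℝ} (hp : 1 < p) {H : X → X → ℝ}
    (hH : AEStronglyMeasurable (Function.uncurry H) (μ.prod μ)) {κ : ℝ≥0∞}
    (hκ : ∀ᵐ x ∂μ, eLpNorm (H x) 2 μ ≤ κ) {v : X → ℝ} (hv : AEStronglyMeasurable v μ) :
    eLpNorm (absDrift μ H (p - 1) v) 2 μ ≤
      κ * growth μ p (eLpNorm v (ENNReal.ofReal (dataExp p)) μ) := by
  set σ := p - 1 with hσ
  have hσ0 : 0 < σ := by linarith
  set S := ∫⁻ x, ‖v x‖ₑ ^ (2 * σ) ∂μ with hS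
  have hvm : AEMeasurable (fun x => ‖v x‖ₑ ^ (2 * σ)) μ := hv.enorm.pow_const _
  have h1 : ∀ᵐ x ∂μ, absDrift μ H σ v x ^ (2 : ℝ) ≤
      κ ^ (2 : ℝ) * (2 ^ (2 * σ) * (S + ‖v x‖ₑ ^ (2 * σ) * μ univ)) := by
    filter_upwards [hκ, hH.prodMk_left] with x hx hm
    have ho := ENNReal.lintegral_mul_le_Lp_mul_Lq μ Real.HolderConjugate.two_two
      (f := fun y => ‖H x y‖ₑ) (g := fun y => ‖v y - v x‖ₑ ^ σ) hm.enorm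
      ((hv.sub aestronglyMeasurable_const).enorm.pow_const σ)
    rw [← eLpNorm_two_eq (H x)] at ho
    have h2 : absDrift μ H σ v x ≤ κ * (∫⁻ y, ‖v y - v x‖ₑ ^ (2 * σ) ∂μ) ^ (1 / 2 : ℝ) := by
      refine le_trans ho (mul_le_mul' hx (le_of_eq ?_))
      congr 2; ext y
      rw [← ENNReal.rpow_mul, mul_comm]
    refine (ENNReal.rpow_le_rpow h2 (by norm_num)).trans ?_
    rw [ENNReal.mul_rpow_of_nonneg _ _ (by norm_num), ← ENNReal.rpow_mul,
      one_div_mul_cancel (by norm_num), ENNReal.rpow_one]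
    refine mul_le_mul_right ?_ _
    calc ∫⁻ y, ‖v y - v x‖ₑ ^ (2 * σ) ∂μ
        ≤ ∫⁻ y, 2 ^ (2 * σ) * (‖v y‖ₑ ^ (2 * σ) + ‖v x‖ₑ ^ (2 * σ)) ∂μ :=
          lintegral_mono fun y => enorm_sub_rpow_le (by linarith) _ _
      _ = 2 ^ (2 * σ) * (S + ‖v x‖ₑ ^ (2 * σ) * μ univ) := by
          rw [lintegral_const_mul'' _ (hvm.add_const _), lintegral_add_left' hvm, lintegral_const]
  have h3 : ∫⁻ x, absDrift μ H σ v x ^ (2 : ℝ) ∂μ ≤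
      κ ^ (2 : ℝ) * (2 ^ (2 * σ + 1) * μ univ * S) := by
    refine (lintegral_mono_ae h1).trans (le_of_eq ?_)
    have hm : AEMeasurable (fun x => S + ‖v x‖ₑ ^ (2 * σ) * μ univ) μ :=
      aemeasurable_const.add (hvm.mul_const _)
    rw [lintegral_const_mul'' _ (hm.const_mul _), lintegral_const_mul'' _ hm,
      lintegral_add_left' aemeasurable_const, lintegral_const, lintegral_mul_const'' _ hvm, ← hS,
      ENNReal.rpow_add _ _ (by simp) (by simp), ENNReal.rpow_one]
    ring
  rw [eLpNorm_two_eq]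
  simp only [enorm_eq_self]
  refine (ENNReal.rpow_le_rpow h3 (by norm_num)).trans ?_
  rw [ENNReal.mul_rpow_of_nonneg _ _ (by norm_num), ← ENNReal.rpow_mul,
    mul_one_div_cancel (by norm_num), ENNReal.rpow_one,
    ENNReal.mul_rpow_of_nonneg _ _ (by norm_num), growth]
  refine mul_le_mul_right (mul_le_mul_right ?_ _) _
  refine (ENNReal.rpow_le_rpow (lintegral_enorm_rpow_two_mul_le hp hv) (by norm_num)).trans
    (le_of_eq ?_)
  rw [← ENNReal.rpow_mul]
  congr 1; ring

/-- The `L²` bound of `absDrift` for bounded arguments, by the `L²` norm of the kernel. -/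
lemma eLpNorm_absDrift_le_of_bounded {σ : ℝ} (hσ : 0 ≤ σ) {H : X → X → ℝ}
    (hH : AEStronglyMeasurable (Function.uncurry H) (μ.prod μ)) {v : X → ℝ} {R : ℝ≥0∞}
    (hR : eLpNorm v ⊤ μ ≤ R) :
    eLpNorm (absDrift μ H σ v) 2 μ ≤
      (2 * R) ^ σ * μ univ ^ (1 / 2 : ℝ) * eLpNorm (Function.uncurry H) 2 (μ.prod μ) := by
  have hb : ∀ᵐ x ∂μ, ‖v x‖ₑ ≤ R := by
    rw [eLpNorm_exponent_top] at hR
    filter_upwards [ae_le_eLpNormEssSup (f := v) (μ := μ)] with x hx using hx.trans hR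
  have h1 : ∀ᵐ x ∂μ, absDrift μ H σ v x ^ (2 : ℝ) ≤
      ((2 * R) ^ σ * μ univ ^ (1 / 2 : ℝ)) ^ (2 : ℝ) * ∫⁻ y, ‖H x y‖ₑ ^ (2 : ℝ) ∂μ := by
    filter_upwards [hb, hH.prodMk_left] with x hx hm
    have ho := ENNReal.lintegral_mul_le_Lp_mul_Lq μ Real.HolderConjugate.two_two
      (f := fun y => ‖H x y‖ₑ) (g := fun _ => (2 * R) ^ σ) hm.enorm aemeasurable_const
    have h2 : absDrift μ H σ v x ≤
        ∫⁻ y, ((fun y => ‖H x y‖ₑ) * (fun _ => (2 * R) ^ σ : X → ℝ≥0∞)) y ∂μ := by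
      refine lintegral_mono_ae ?_
      filter_upwards [hb] with y hy
      refine mul_le_mul_right (ENNReal.rpow_le_rpow ?_ hσ) _
      refine enorm_sub_le.trans ?_
      rw [two_mul]; exact add_le_add hy hx
    refine (ENNReal.rpow_le_rpow (h2.trans ho) (by norm_num)).trans (le_of_eq ?_)
    rw [lintegral_const, ENNReal.mul_rpow_of_nonneg _ _ (by norm_num : (0:ℝ) ≤ 2),
      ← ENNReal.rpow_mul, one_div_mul_cancel (by norm_num), ENNReal.rpow_one,
      ENNReal.mul_rpow_of_nonneg _ _ (by norm_num : (0:ℝ) ≤ 1 / 2), ← ENNReal.rpow_mul _ 2,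
      mul_one_div_cancel (by norm_num), ENNReal.rpow_one, mul_comm]
  have hHm : AEMeasurable (fun z : X × X => ‖H z.1 z.2‖ₑ ^ (2 : ℝ)) (μ.prod μ) :=
    hH.enorm.pow_const _
  rw [eLpNorm_two_eq, eLpNorm_two_eq]
  simp only [enorm_eq_self]
  refine (ENNReal.rpow_le_rpow (lintegral_mono_ae h1) (by norm_num)).trans (le_of_eq ?_)
  rw [lintegral_const_mul'' _ hHm.lintegral_prod_right',
    ENNReal.mul_rpow_of_nonneg _ _ (by norm_num : (0:ℝ) ≤ 1 / 2), ← ENNReal.rpow_mul _ 2,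
    mul_one_div_cancel (by norm_num), ENNReal.rpow_one,
    show ∫⁻ z, ‖Function.uncurry H z‖ₑ ^ (2 : ℝ) ∂(μ.prod μ) = _ from lintegral_prod _ hHm]
  rfl

lemma lintegral_absDrift_le {p : ℝ} (hp : 1 < p) {H : X → X → ℝ}
    (hH : AEStronglyMeasurable (Function.uncurry H) (μ.prod μ)) {κ : ℝ≥0∞}
    (hκ : ∀ᵐ x ∂μ, eLpNorm (H x) 2 μ ≤ κ) {v : X → ℝ} (hv : AEStronglyMeasurable v μ) :
    ∫⁻ x, absDrift μ H (p - 1) v x ∂μ ≤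
      κ * growth μ p (eLpNorm v (ENNReal.ofReal (dataExp p)) μ) * μ univ ^ (1 / 2 : ℝ) := by
  have h := eLpNorm_le_eLpNorm_mul_rpow_measure_univ (μ := μ) (p := 1) (q := 2) (by norm_num)
    (aemeasurable_absDrift hH hv (p - 1)).aestronglyMeasurable
  rw [eLpNorm_one_eq_lintegral_enorm] at h
  simp only [enorm_eq_self, ENNReal.toReal_one, ENNReal.toReal_ofNat] at h
  refine h.trans ?_
  rw [show (1 / 1 - 1 / 2 : ℝ) = 1 / 2 by norm_num]
  exact mul_le_mul_left (eLpNorm_absDrift_le hp hH hκ hv) _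

lemma inDom_psi {p : ℝ} (hp : 1 < p) {K : X → X → ℝ} (hK : IsAEKernel μ K) {v : X → ℝ}
    (hv : MemLp v (ENNReal.ofReal (dataExp p)) μ) : InDom μ K (psi p) v := by
  obtain ⟨κ, hκ, hκb⟩ := hK.bounded
  refine ⟨aestronglyMeasurable_mul_comp hK.measurable (continuous_psi hp) hv.1, ?_⟩
  have h := lintegral_absDrift_le hp hK.measurable hκb hv.1
  rw [lintegral_absDrift hK.measurable hv.1] at h
  rw [hasFiniteIntegral_iff_enorm]
  simp only [enorm_mul, enorm_psi hp]
  refine h.trans_lt (ENNReal.mul_lt_top (ENNReal.mul_lt_top hκ (growth_lt_top hp hv.2)) ?_)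
  exact ENNReal.rpow_lt_top_of_nonneg (by norm_num) (measure_lt_top _ _).ne

lemma enorm_drift_psi_sub_le {p : ℝ} (hp : 1 < p) {K L : X → X → ℝ} {v : X → ℝ}
    (hK : InDom μ K (psi p) v) (hL : InDom μ L (psi p) v) :
    ∀ᵐ x ∂μ, ‖drift μ K (psi p) v x - drift μ L (psi p) v x‖ₑ ≤ absDrift μ (K - L) (p - 1) v x := by
  filter_upwards [drift_sub_ae hK hL] with x hx
  rw [hx]
  refine (enorm_integral_le_lintegral_enorm _).trans (le_of_eq ?_)
  simp only [← sub_mul, enorm_mul, enorm_psi hp, absDrift, Pi.sub_apply]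

/-- Rows of the kernel are bounded in `L¹`, hence the Schur bound on `L¹(μ)`. -/
lemma IsAEKernel.lintegral_mul_sub_le {K : X → X → ℝ} (hK : IsAEKernel μ K) :
    ∃ κ : ℝ≥0∞, κ < ⊤ ∧ (∀ᵐ x ∂μ, ∫⁻ y, ‖K x y‖ₑ ∂μ ≤ κ) ∧ ∀ w : X → ℝ, AEStronglyMeasurable w μ →
      ∫⁻ z, ‖K z.1 z.2‖ₑ * ‖w z.2 - w z.1‖ₑ ∂(μ.prod μ) ≤ κ * eLpNorm w 1 μ := by
  obtain ⟨κ, hκ, hκb⟩ := hK.bounded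
  have hμ : μ univ ^ (1 / 2 : ℝ) < ⊤ :=
    ENNReal.rpow_lt_top_of_nonneg (by norm_num) (measure_lt_top _ _).ne
  have hrow : ∀ᵐ x ∂μ, ∫⁻ y, ‖K x y‖ₑ ∂μ ≤ κ * μ univ ^ (1 / 2 : ℝ) := by
    filter_upwards [hκb, hK.measurable.prodMk_left] with x hx hm
    have h := eLpNorm_le_eLpNorm_mul_rpow_measure_univ (μ := μ) (p := 1) (q := 2) (by norm_num) hm
    rw [eLpNorm_one_eq_lintegral_enorm] at h
    simp only [ENNReal.toReal_one, ENNReal.toReal_ofNat] at h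
    rw [show (1 / 1 - 1 / 2 : ℝ) = 1 / 2 by norm_num] at h
    exact h.trans (mul_le_mul_left hx _)
  refine ⟨2 * (κ * μ univ ^ (1 / 2 : ℝ)),
    ENNReal.mul_lt_top (by simp) (ENNReal.mul_lt_top hκ hμ),
    hrow.mono fun x hx => hx.trans (le_mul_of_one_le_left zero_le (by norm_num)),
    fun w hw => ?_⟩
  have hKm : AEMeasurable (fun z : X × X => ‖K z.1 z.2‖ₑ) (μ.prod μ) := hK.measurable.enorm
  have m1 : AEMeasurable (fun z : X × X => ‖K z.1 z.2‖ₑ * ‖w z.1‖ₑ) (μ.prod μ) :=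
    hKm.mul hw.comp_fst.enorm
  have m2 : AEMeasurable (fun z : X × X => ‖K z.1 z.2‖ₑ * ‖w z.2‖ₑ) (μ.prod μ) :=
    hKm.mul hw.comp_snd.enorm
  have e : ∫⁻ z, ‖K z.1 z.2‖ₑ * ‖w z.2‖ₑ ∂(μ.prod μ)
      = ∫⁻ z, ‖K z.1 z.2‖ₑ * ‖w z.1‖ₑ ∂(μ.prod μ) := by
    rw [← lintegral_prod_swap]
    refine lintegral_congr_ae ?_
    filter_upwards [hK.symm] with z hz
    simp only [Prod.fst_swap, Prod.snd_swap]
    rw [hz]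
  have h1 : ∫⁻ z, ‖K z.1 z.2‖ₑ * ‖w z.1‖ₑ ∂(μ.prod μ) ≤
      κ * μ univ ^ (1 / 2 : ℝ) * eLpNorm w 1 μ := by
    rw [lintegral_prod _ m1, eLpNorm_one_eq_lintegral_enorm, ← lintegral_const_mul'' _ hw.enorm]
    refine lintegral_mono_ae ?_
    filter_upwards [hrow, hK.measurable.prodMk_left] with x hx hm
    have hm' : AEMeasurable (fun y => ‖K x y‖ₑ) μ := hm.enorm
    rw [lintegral_mul_const'' _ hm']
    exact mul_le_mul_left hx _
  calc ∫⁻ z, ‖K z.1 z.2‖ₑ * ‖w z.2 - w z.1‖ₑ ∂(μ.prod μ)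
      ≤ ∫⁻ z, (‖K z.1 z.2‖ₑ * ‖w z.2‖ₑ + ‖K z.1 z.2‖ₑ * ‖w z.1‖ₑ) ∂(μ.prod μ) := by
        refine lintegral_mono fun z => ?_
        rw [← mul_add]
        exact mul_le_mul_right enorm_sub_le _
    _ = 2 * ∫⁻ z, ‖K z.1 z.2‖ₑ * ‖w z.1‖ₑ ∂(μ.prod μ) := by
        rw [lintegral_add_left' m2, e, two_mul]
    _ ≤ _ := by rw [mul_assoc]; exact mul_le_mul_right h1 _

end Bounds

/-- The continuity modulus of the power nonlinearity. By homogeneity it suffices to treat `b = 1`,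
where it follows from the continuity of `Ψ` at `1` and its growth. -/
lemma exists_abs_psi_sub_le {p : ℝ} (hp : 1 < p) {ε : ℝ} (hε : 0 < ε) :
    ∃ C : ℝ, 0 ≤ C ∧ ∀ a b : ℝ,
      |psi p a - psi p b| ≤ ε * |b| ^ (p - 1) + C * |a - b| ^ (p - 1) := by
  have hσ : 0 < p - 1 := by linarith
  have h1 : psi p 1 = 1 := by simp [psi]
  obtain ⟨δ, hδ, hδc⟩ := Metric.continuousAt_iff.1 ((continuous_psi hp).continuousAt (x := 1)) ε hε
  set C : ℝ := (1 / δ + 1) ^ (p - 1) + (1 / δ) ^ (p - 1) with hC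
  have hC1 : 1 ≤ C := by
    have : (1 : ℝ) ≤ (1 / δ + 1) ^ (p - 1) :=
      Real.one_le_rpow (by have : 0 < 1 / δ := by positivity
                           linarith) hσ.le
    have : 0 ≤ (1 / δ) ^ (p - 1) := by positivity
    linarith
  refine ⟨C, by linarith, fun a b => ?_⟩
  have hone : ∀ s : ℝ, |psi p s - 1| ≤ ε + C * |s - 1| ^ (p - 1) := by
    intro s
    have hnn : 0 ≤ C * |s - 1| ^ (p - 1) := by positivity
    by_cases hs : |s - 1| < δ
    · have := hδc (x := s) (by rwa [Real.dist_eq])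
      rw [Real.dist_eq, h1] at this
      linarith
    · rw [not_lt] at hs
      have e1 : |psi p s - 1| ≤ |s| ^ (p - 1) + 1 := by
        have := abs_sub (psi p s) 1
        rwa [abs_psi hp, abs_one] at this
      have hq : 1 ≤ 1 / δ * |s - 1| := by
        rw [div_mul_eq_mul_div, le_div_iff₀ hδ]; linarith
      have e2 : |s| ≤ (1 / δ + 1) * |s - 1| := by
        have : |s| ≤ |s - 1| + 1 := by
          have := abs_add_le (s - 1) 1
          simpa using this
        linarith
      have e3 : |s| ^ (p - 1) ≤ (1 / δ + 1) ^ (p - 1) * |s - 1| ^ (p - 1) := by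
        rw [← Real.mul_rpow (by positivity) (abs_nonneg _)]
        exact Real.rpow_le_rpow (abs_nonneg _) e2 hσ.le
      have e4 : 1 ≤ (1 / δ) ^ (p - 1) * |s - 1| ^ (p - 1) := by
        rw [← Real.mul_rpow (by positivity) (abs_nonneg _)]
        exact Real.one_le_rpow hq hσ.le
      rw [hC, add_mul]
      linarith
  rcases eq_or_ne b 0 with rfl | hb
  · rw [psi_zero, sub_zero, sub_zero, abs_psi hp, abs_zero, Real.zero_rpow hσ.ne', mul_zero,
      zero_add]
    exact le_mul_of_one_le_left (by positivity) hC1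
  · have hm : psi p a - psi p b = psi p b * (psi p (a / b) - 1) := by
      have : psi p a = psi p b * psi p (a / b) := by
        rw [psi, psi, psi, abs_div, Real.div_rpow (abs_nonneg _) (abs_nonneg _)]
        have : |b| ^ (p - 2) ≠ 0 := (Real.rpow_pos_of_pos (abs_pos.2 hb) _).ne'
        field_simp
      rw [this]; ring
    rw [hm, abs_mul, abs_psi hp]
    have h2 := mul_le_mul_of_nonneg_left (hone (a / b)) (by positivity : 0 ≤ |b| ^ (p - 1))
    refine h2.trans (le_of_eq ?_)
    have : |b| ^ (p - 1) * |a / b - 1| ^ (p - 1) = |a - b| ^ (p - 1) := by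
      rw [← Real.mul_rpow (abs_nonneg _) (abs_nonneg _), ← abs_mul]
      congr 2; field_simp
    rw [← this]; ring

/-! ### Mixed norms in space and time -/

section MixedNorms

variable {X : Type*} [MeasurableSpace X] {μ : Measure X}

/-- The class in `L¹(μ)` of an integrable function; non-integrable functions are sent to zero. -/
noncomputable def liftL1 (μ : Measure X) (v : X → ℝ) : Lp ℝ 1 μ :=
  open Classical in if h : MemLp v 1 μ then h.toLp v else 0

lemma coeFn_liftL1 {v : X → ℝ} (h : MemLp v 1 μ) : liftL1 μ v =ᵐ[μ] v := by
  rw [liftL1, dif_pos h]; exact h.coeFn_toLp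

lemma liftL1_congr {v w : X → ℝ} (h : v =ᵐ[μ] w) : liftL1 μ v = liftL1 μ w := by
  by_cases hv : MemLp v 1 μ
  · have hw : MemLp w 1 μ := (memLp_congr_ae h).1 hv
    rw [liftL1, liftL1, dif_pos hv, dif_pos hw, MemLp.toLp_eq_toLp_iff]
    exact h
  · rw [liftL1, liftL1, dif_neg hv, dif_neg (fun hw => hv ((memLp_congr_ae h).2 hw))]

lemma enorm_liftL1_le (v : X → ℝ) : ‖liftL1 μ v‖ₑ ≤ eLpNorm v 1 μ := by
  by_cases hv : MemLp v 1 μ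
  · rw [liftL1, dif_pos hv, Lp.enorm_toLp]
  · rw [liftL1, dif_neg hv]; simp

lemma aemeasurable_eLpNorm {α : Type*} [MeasurableSpace α] {ν : Measure α} [SFinite μ] {q : ℝ}
    (hq : 0 < q) {f : α → X → ℝ} (hf : AEStronglyMeasurable (Function.uncurry f) (ν.prod μ)) :
    AEMeasurable (fun t => eLpNorm (f t) (ENNReal.ofReal q) μ) ν := by
  have h : (fun t => eLpNorm (f t) (ENNReal.ofReal q) μ) =
      fun t => (∫⁻ x, ‖Function.uncurry f (t, x)‖ₑ ^ q ∂μ) ^ (1 / q) := by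
    ext t
    rw [eLpNorm_eq_lintegral_rpow_enorm_toReal (by simpa using hq) ENNReal.ofReal_ne_top,
      ENNReal.toReal_ofReal hq.le]
    rfl
  rw [h]
  exact ((hf.enorm.pow_const q).lintegral_prod_right').pow_const _

/-- A jointly measurable function is strongly measurable as a function with values in the separable
space `L¹`: preimages of balls are measurable because its distance to a fixed element is. -/
lemma aestronglyMeasurable_liftL1 {α : Type*} [MeasurableSpace α] {ν : Measure α} [SFinite ν]
    [SFinite μ] [SecondCountableTopology (Lp ℝ 1 μ)] {f : α → X → ℝ}
    (hf : AEStronglyMeasurable (Function.uncurry f) (ν.prod μ)) :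
    AEStronglyMeasurable (fun t => liftL1 μ (f t)) ν := by
  set F := hf.mk _ with hF
  have hFm : StronglyMeasurable F := hf.stronglyMeasurable_mk
  have hae : ∀ᵐ t ∂ν, liftL1 μ (fun x => F (t, x)) = liftL1 μ (f t) := by
    filter_upwards [Measure.ae_ae_of_ae_prod hf.ae_eq_mk] with t ht
    exact (liftL1_congr ht).symm
  refine AEStronglyMeasurable.congr ?_ hae
  let : MeasurableSpace (Lp ℝ 1 μ) := borel _
  have : BorelSpace (Lp ℝ 1 μ) := ⟨rfl⟩
  refine (Measurable.stronglyMeasurable ?_).aestronglyMeasurable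
  have hsec : ∀ t, AEStronglyMeasurable (fun x => F (t, x)) μ := fun t =>
    (hFm.comp_measurable measurable_prodMk_left).aestronglyMeasurable
  have hdist : ∀ c : Lp ℝ 1 μ, Measurable fun t => eLpNorm (fun x => F (t, x) - c x) 1 μ := by
    intro c
    simp only [eLpNorm_one_eq_lintegral_enorm]
    have : Measurable fun z : α × X => ‖F z - c z.2‖ₑ :=
      (hFm.sub ((Lp.stronglyMeasurable c).comp_measurable measurable_snd)).enorm
    exact this.lintegral_prod_right'
  have hfin : MeasurableSet {t | MemLp (fun x => F (t, x)) 1 μ} := by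
    have h1 : Measurable fun t => eLpNorm (fun x => F (t, x)) 1 μ := by
      simp only [eLpNorm_one_eq_lintegral_enorm]
      exact hFm.enorm.lintegral_prod_right'
    have : {t | MemLp (fun x => F (t, x)) 1 μ} = {t | eLpNorm (fun x => F (t, x)) 1 μ < ⊤} := by
      ext t; exact ⟨fun h => h.2, fun h => ⟨hsec t, h⟩⟩
    rw [this]
    exact measurableSet_lt h1 measurable_const
  have hball : ∀ (c : Lp ℝ 1 μ) (r : ℝ),
      MeasurableSet ((fun t => liftL1 μ (fun x => F (t, x))) ⁻¹' Metric.ball c r) := by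
    intro c r
    have e : (fun t => liftL1 μ (fun x => F (t, x))) ⁻¹' Metric.ball c r =
        ({t | MemLp (fun x => F (t, x)) 1 μ} ∩
          {t | eLpNorm (fun x => F (t, x) - c x) 1 μ < ENNReal.ofReal r}) ∪
        ({t | MemLp (fun x => F (t, x)) 1 μ}ᶜ ∩ {_t | (0 : Lp ℝ 1 μ) ∈ Metric.ball c r}) := by
      ext t
      simp only [mem_preimage, mem_union, mem_inter_iff, mem_ofPred_eq, mem_compl_iff]
      by_cases h : MemLp (fun x => F (t, x)) 1 μ
      · simp only [h, true_and, not_true, false_and, or_false]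
        rw [← Metric.eball_ofReal, Metric.mem_eball, edist_eq_enorm_sub, Lp.enorm_def,
          eLpNorm_congr_ae (g := fun x => F (t, x) - c x) (by
            filter_upwards [Lp.coeFn_sub (liftL1 μ (fun x => F (t, x))) c, coeFn_liftL1 h]
              with x h1 h2
            rw [h1, Pi.sub_apply, h2])]
      · simp only [h, false_and, not_false_iff, true_and, false_or]
        rw [liftL1, dif_neg h]
    rw [e]
    exact (hfin.inter (measurableSet_lt (hdist c) measurable_const)).union
      (hfin.compl.inter (MeasurableSet.const _))
  refine measurable_of_isOpen fun U hU => ?_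
  have hex : ∀ c : U, ∃ r > 0, Metric.ball (c : Lp ℝ 1 μ) r ⊆ U := fun c =>
    Metric.isOpen_iff.1 hU c c.2
  choose r hr hrU using hex
  obtain ⟨S, hS, hSU⟩ := TopologicalSpace.isOpen_iUnion_countable
    (fun c : U => Metric.ball (c : Lp ℝ 1 μ) (r c)) (fun c => Metric.isOpen_ball)
  have hU' : U = ⋃ c ∈ S, Metric.ball (c : Lp ℝ 1 μ) (r c) := by
    rw [hSU]
    refine Subset.antisymm (fun c hc => mem_iUnion.2 ⟨⟨c, hc⟩, Metric.mem_ball_self (hr _)⟩) ?_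
    exact iUnion_subset fun c => hrU c
  rw [hU', preimage_iUnion₂]
  exact MeasurableSet.biUnion hS fun c _ => hball _ _

lemma tendsto_eLpNorm_zero_of_dominated {q : ℝ} (hq : 0 < q) {F : ℕ → X → ℝ} {G : X → ℝ}
    (hF : ∀ n, AEStronglyMeasurable (F n) μ) (hb : ∀ᵐ x ∂μ, ∀ n, |F n x| ≤ |G x|)
    (hG : eLpNorm G (ENNReal.ofReal q) μ < ⊤)
    (hlim : ∀ᵐ x ∂μ, Tendsto (fun n => F n x) atTop (𝓝 0)) :
    Tendsto (fun n => eLpNorm (F n) (ENNReal.ofReal q) μ) atTop (𝓝 0) := by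
  have e : ∀ f : X → ℝ, eLpNorm f (ENNReal.ofReal q) μ = (∫⁻ x, ‖f x‖ₑ ^ q ∂μ) ^ (1 / q) := by
    intro f
    rw [eLpNorm_eq_lintegral_rpow_enorm_toReal (by simpa using hq) ENNReal.ofReal_ne_top,
      ENNReal.toReal_ofReal hq.le]
  have hG' : ∫⁻ x, ‖G x‖ₑ ^ q ∂μ ≠ ⊤ := by
    rw [e] at hG
    intro h
    rw [h, ENNReal.top_rpow_of_pos (by positivity)] at hG
    exact absurd hG (lt_irrefl _)
  have h := tendsto_lintegral_of_dominated_convergence' (μ := μ) (F := fun n x => ‖F n x‖ₑ ^ q)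
    (f := fun _ => 0) (fun x => ‖G x‖ₑ ^ q) (fun n => (hF n).enorm.pow_const q) (fun n => by
      filter_upwards [hb] with x hx
      refine ENNReal.rpow_le_rpow ?_ hq.le
      rw [Real.enorm_eq_ofReal_abs, Real.enorm_eq_ofReal_abs]
      exact ENNReal.ofReal_le_ofReal (hx n)) hG' (by
      filter_upwards [hlim] with x hx
      have h1 := ((ENNReal.continuous_rpow_const (y := q)).tendsto _).comp
        ((continuous_enorm.tendsto _).comp hx)
      simpa [ENNReal.zero_rpow_of_pos hq, Function.comp_def] using h1)
  rw [lintegral_zero] at h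
  have h2 := ((ENNReal.continuous_rpow_const (y := 1 / q)).tendsto _).comp h
  rw [ENNReal.zero_rpow_of_pos (by positivity)] at h2
  exact h2.congr fun n => (e _).symm

lemma tendsto_lintegral_eLpNorm_zero {α : Type*} [MeasurableSpace α] {ν : Measure α} [SFinite μ]
    [SFinite ν] {q : ℝ} (hq : 0 < q) {F : ℕ → α → X → ℝ} {G : α → X → ℝ}
    (hF : ∀ n, AEStronglyMeasurable (Function.uncurry (F n)) (ν.prod μ))
    (hb : ∀ᵐ z ∂(ν.prod μ), ∀ n, |F n z.1 z.2| ≤ |G z.1 z.2|)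
    (hG : AEStronglyMeasurable (Function.uncurry G) (ν.prod μ))
    (hGn : ∫⁻ t, eLpNorm (G t) (ENNReal.ofReal q) μ ∂ν < ⊤)
    (hlim : ∀ᵐ z ∂(ν.prod μ), Tendsto (fun n => F n z.1 z.2) atTop (𝓝 0)) :
    Tendsto (fun n => ∫⁻ t, eLpNorm (F n t) (ENNReal.ofReal q) μ ∂ν) atTop (𝓝 0) := by
  have hb' := Measure.ae_ae_of_ae_prod hb
  have hl' := Measure.ae_ae_of_ae_prod hlim
  have hm' : ∀ᵐ t ∂ν, ∀ n, AEStronglyMeasurable (F n t) μ :=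
    ae_all_iff.2 fun n => (hF n).prodMk_left
  have h := tendsto_lintegral_of_dominated_convergence' (μ := ν)
    (F := fun n t => eLpNorm (F n t) (ENNReal.ofReal q) μ) (f := fun _ => 0)
    (fun t => eLpNorm (G t) (ENNReal.ofReal q) μ) (fun n => aemeasurable_eLpNorm hq (hF n))
    (fun n => by
      filter_upwards [hb'] with t ht
      exact eLpNorm_mono_ae (ht.mono fun x hx => hx n)) hGn.ne (by
      filter_upwards [hb', hl', hm', ae_lt_top' (aemeasurable_eLpNorm hq hG) hGn.ne]
        with t h1 h2 h3 h4
      exact tendsto_eLpNorm_zero_of_dominated hq h3 h1 h4 h2)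
  simpa using h

lemma eLpNorm_ofReal_le_top {q : ℝ} (hq : 0 < q) {v : X → ℝ} (hv : AEStronglyMeasurable v μ) :
    eLpNorm v (ENNReal.ofReal q) μ ≤ eLpNorm v ⊤ μ * μ univ ^ (1 / q) := by
  have := eLpNorm_le_eLpNorm_mul_rpow_measure_univ (μ := μ) (p := ENNReal.ofReal q) le_top hv
  rwa [ENNReal.toReal_ofReal hq.le, ENNReal.toReal_top, div_zero, sub_zero] at this

lemma eLpNorm_top_le_of_forall_nat {w : X → ℝ} (hw : AEStronglyMeasurable w μ) [IsFiniteMeasure μ]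
    {R : ℝ≥0∞}
    (h : ∀ n : ℕ, 2 ≤ n → eLpNorm w (ENNReal.ofReal n) μ ≤ R * μ univ ^ (1 / (n : ℝ))) :
    eLpNorm w ⊤ μ ≤ R := by
  refine le_of_forall_gt_imp_ge_of_dense fun R' hR' => ?_
  rcases eq_or_ne R' ⊤ with rfl | hRt
  · exact le_top
  have hR0 : R' ≠ 0 := (zero_le.trans_lt hR').ne'
  rw [eLpNorm_exponent_top]
  refine eLpNormEssSup_le_of_ae_enorm_bound ?_
  -- Markov's inequality with exponent `n`, `n → ∞`
  have hn : ∀ n : ℕ, 2 ≤ n → μ {x | R' ≤ ‖w x‖ₑ} ≤ (R / R') ^ n * μ univ := by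
    intro n hn
    have hn0 : (0 : ℝ) < n := by exact_mod_cast (by omega : 0 < n)
    have h1 := meas_ge_le_mul_pow_eLpNorm_enorm μ (p := ENNReal.ofReal n) (by simpa using by omega)
      ENNReal.ofReal_ne_top hw hR0 (fun h => absurd h hRt)
    rw [ENNReal.toReal_ofReal hn0.le] at h1
    refine h1.trans ((mul_le_mul_right (ENNReal.rpow_le_rpow (h n hn) hn0.le) _).trans
      (le_of_eq ?_))
    rw [ENNReal.mul_rpow_of_nonneg _ _ hn0.le, ← ENNReal.rpow_mul, one_div_mul_cancel hn0.ne',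
      ENNReal.rpow_one, ← mul_assoc, ← ENNReal.mul_rpow_of_nonneg _ _ hn0.le,
      ENNReal.rpow_natCast, ENNReal.div_eq_inv_mul]
  have hlt : R / R' < 1 := by
    rw [ENNReal.div_lt_iff (Or.inl hR0) (Or.inl hRt), one_mul]; exact hR'
  have hlim : Tendsto (fun n : ℕ => (R / R') ^ n * μ univ) atTop (𝓝 0) := by
    have := ENNReal.Tendsto.mul_const (ENNReal.tendsto_pow_atTop_nhds_zero_of_lt_one hlt)
      (b := μ univ) (Or.inr (measure_ne_top _ _))
    rwa [zero_mul] at this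
  have h0 : μ {x | R' ≤ ‖w x‖ₑ} = 0 := by
    refine le_antisymm (ge_of_tendsto hlim ?_) zero_le
    filter_upwards [eventually_ge_atTop 2] with n h using hn n h
  have h1 : ∀ᵐ x ∂μ, ¬ (R' ≤ ‖w x‖ₑ) := by rw [ae_iff]; simpa using h0
  filter_upwards [h1] with x hx using (not_le.1 hx).le

/-- The maximum principle: the bound of the `L^q` norms in the limit `q → ∞`. -/
lemma IsStrong.eLpNorm_top_le [IsFiniteMeasure μ] {T : ℝ} {K : X → X → ℝ} {Ψ : ℝ → ℝ}
    {g : X → ℝ} {f : ℝ → X → ℝ} {u D : ℝ → Lp ℝ 1 μ}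
    (hK : IsAEKernel μ K) (hΨ : Monotone Ψ) (hodd : ∀ s, Ψ (-s) = - Ψ s)
    (hu : IsStrong μ T K Ψ g f u D)
    (hf : AEStronglyMeasurable (Function.uncurry f) ((volume.restrict (Icc 0 T)).prod μ))
    {t : ℝ} (ht : t ∈ Icc 0 T) :
    eLpNorm (u t) ⊤ μ ≤ eLpNorm g ⊤ μ + ∫⁻ s in Icc 0 T, eLpNorm (f s) ⊤ μ := by
  have hgm : AEStronglyMeasurable g μ := (Lp.aestronglyMeasurable (u 0)).congr hu.initial
  refine eLpNorm_top_le_of_forall_nat (Lp.aestronglyMeasurable _) fun n hn => ?_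
  have hn1 : (1 : ℝ) < n := by exact_mod_cast (by omega : 1 < n)
  have hμ : μ univ ^ (1 / (n : ℝ)) ≠ ⊤ :=
    (ENNReal.rpow_lt_top_of_nonneg (by positivity) (measure_ne_top _ _)).ne
  refine (hu.eLpNorm_le hn1 hK hΨ hodd ht).trans ?_
  rw [add_mul]
  refine add_le_add (eLpNorm_ofReal_le_top (by linarith) hgm) ?_
  rw [← lintegral_mul_const' _ _ hμ]
  have hsub : Ioc 0 t ⊆ Icc 0 T := fun s hs => ⟨hs.1.le, hs.2.trans ht.2⟩
  refine (lintegral_mono_set hsub).trans ?_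
  refine lintegral_mono_ae ?_
  filter_upwards [hf.prodMk_left] with s hs using eLpNorm_ofReal_le_top (by linarith) hs

end MixedNorms

/-! ### Solutions for Lipschitz nonlinearities -/

section Picard

variable {E : Type*} [NormedAddCommGroup E] [NormedSpace ℝ E] [CompleteSpace E]

/-- Global existence for `u' = A u + F` with `A` Lipschitz and `F` merely integrable: the integral
equation, rescaled by `exp(-ℓ t)` with `ℓ` large, is a contraction for the supremum norm. -/
lemma exists_integral_solution {T : ℝ} (hT : 0 < T) {A : E → E} {L : ℝ} (hL : 0 ≤ L)
    (hA : ∀ v w, ‖A v - A w‖ ≤ L * ‖v - w‖) {F : ℝ → E} (hF : IntegrableOn F (Ioo 0 T)) (c : E) :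
    ∃ u : ℝ → E, ContinuousOn u (Icc 0 T) ∧
      ∀ t ∈ Icc 0 T, u t = c + ∫ s in (0 : ℝ)..t, (A (u s) + F s) := by
  set ℓ : ℝ := 2 * (L + 1) with hℓ
  have hℓ0 : 0 < ℓ := by positivity
  have hAc : Continuous A := by
    refine LipschitzWith.continuous (K := ⟨L, hL⟩) (LipschitzWith.of_dist_le_mul fun v w => ?_)
    rw [dist_eq_norm, dist_eq_norm]; exact hA v w
  set I := Icc (0 : ℝ) T with hI
  have hFI : ∀ t ∈ I, IntervalIntegrable F volume 0 t := fun t ht => by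
    rw [intervalIntegrable_iff_integrableOn_Ioo_of_le ht.1]
    exact hF.mono_set (Ioo_subset_Ioo_right ht.2)
  -- the curve in the original scale
  set ex : C(I, E) → ℝ → E := fun z s => Real.exp (ℓ * s) • z (projIcc 0 T hT.le s) with hex
  have hexc : ∀ z, Continuous (ex z) := fun z => by
    have : Continuous fun s => z (projIcc 0 T hT.le s) := z.continuous.comp continuous_projIcc
    exact (by fun_prop : Continuous fun s => Real.exp (ℓ * s)).smul this
  have hint : ∀ z a b, IntervalIntegrable (fun s => A (ex z s)) volume a b := fun z a b =>
    (hAc.comp (hexc z)).intervalIntegrable a b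
  have hFc : ContinuousOn (fun t => ∫ s in (0 : ℝ)..t, F s) I := by
    have := intervalIntegral.continuousOn_primitive_interval (f := F) (a := 0) (b := T)
      (μ := volume) (by rw [uIcc_of_le hT.le, integrableOn_Icc_iff_integrableOn_Ioo]; exact hF)
    rwa [uIcc_of_le hT.le] at this
  set P : C(I, E) → ℝ → E := fun z t => Real.exp (-(ℓ * t)) •
    (c + ((∫ s in (0 : ℝ)..t, A (ex z s)) + ∫ s in (0 : ℝ)..t, F s)) with hP
  have hPc : ∀ z, ContinuousOn (P z) I := fun z => by
    have h1 : Continuous fun t => ∫ s in (0 : ℝ)..t, A (ex z s) :=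
      intervalIntegral.continuous_primitive (hint z) 0
    exact (by fun_prop : Continuous fun t => Real.exp (-(ℓ * t))).continuousOn.smul
      (continuousOn_const.add (h1.continuousOn.add hFc))
  set Φ : C(I, E) → C(I, E) := fun z => ⟨fun t => P z t, (hPc z).domRestrict⟩ with hΦ
  have hcontr : ContractingWith (1 / 2) Φ := by
    refine ⟨by rw [← NNReal.coe_lt_coe]; push_cast; norm_num,
      LipschitzWith.of_dist_le_mul fun z y => ?_⟩
    push_cast
    rw [ContinuousMap.dist_le (by positivity)]
    intro t
    have ht := t.2
    have e1 : dist (Φ z t) (Φ y t) = Real.exp (-(ℓ * t)) *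
        ‖∫ s in (0 : ℝ)..t, (A (ex z s) - A (ex y s))‖ := by
      rw [dist_eq_norm]
      show ‖P z t - P y t‖ = _
      rw [hP]
      simp only
      rw [← smul_sub, add_sub_add_left_eq_sub, add_sub_add_right_eq_sub, norm_smul,
        Real.norm_eq_abs, abs_of_pos (Real.exp_pos _),
        ← intervalIntegral.integral_sub (hint z _ _) (hint y _ _)]
    have e2 : ‖∫ s in (0 : ℝ)..t, (A (ex z s) - A (ex y s))‖ ≤
        ∫ s in (0 : ℝ)..t, L * dist z y * Real.exp (ℓ * s) := by
      refine intervalIntegral.norm_integral_le_of_norm_le ht.1 (.of_forall fun s _ => ?_)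
        ((by fun_prop : Continuous fun s => L * dist z y * Real.exp (ℓ * s)).intervalIntegrable _ _)
      refine (hA _ _).trans ?_
      rw [hex]
      simp only
      rw [← smul_sub, norm_smul, Real.norm_eq_abs, abs_of_pos (Real.exp_pos _)]
      have := ContinuousMap.dist_apply_le_dist (f := z) (g := y) (projIcc 0 T hT.le s)
      rw [dist_eq_norm] at this
      have h3 := mul_le_mul_of_nonneg_left this (Real.exp_pos (ℓ * s)).le
      nlinarith
    have e3 : ∫ s in (0 : ℝ)..t, L * dist z y * Real.exp (ℓ * s) =
        L * dist z y * ((Real.exp (ℓ * t) - 1) / ℓ) := by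
      rw [intervalIntegral.integral_const_mul, intervalIntegral.integral_comp_mul_left _ hℓ0.ne',
        integral_exp]
      simp [div_eq_inv_mul]
    rw [e1]
    rw [e3] at e2
    have h4 : Real.exp (-(ℓ * t)) * ((Real.exp (ℓ * t) - 1) / ℓ) ≤ 1 / ℓ := by
      rw [← mul_div_assoc, mul_sub, ← Real.exp_add, neg_add_cancel, Real.exp_zero]
      exact div_le_div_of_nonneg_right (by linarith [Real.exp_pos (-(ℓ * (t : ℝ)))]) hℓ0.le
    have h5 : L * (1 / ℓ) ≤ 1 / 2 := by
      rw [mul_one_div, div_le_div_iff₀ hℓ0 two_pos]; linarith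
    calc Real.exp (-(ℓ * t)) * ‖∫ s in (0 : ℝ)..t, (A (ex z s) - A (ex y s))‖
        ≤ Real.exp (-(ℓ * t)) * (L * dist z y * ((Real.exp (ℓ * t) - 1) / ℓ)) :=
          mul_le_mul_of_nonneg_left e2 (Real.exp_pos _).le
      _ = L * dist z y * (Real.exp (-(ℓ * t)) * ((Real.exp (ℓ * t) - 1) / ℓ)) := by ring
      _ ≤ L * dist z y * (1 / ℓ) := mul_le_mul_of_nonneg_left h4 (by positivity)
      _ = L * (1 / ℓ) * dist z y := by ring
      _ ≤ 1 / 2 * dist z y := mul_le_mul_of_nonneg_right h5 dist_nonneg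
  have : Nonempty C(I, E) := ⟨ContinuousMap.const _ 0⟩
  set z := hcontr.fixedPoint Φ with hz
  have hfix : Φ z = z := hcontr.fixedPoint_isFixedPt
  refine ⟨ex z, (hexc z).continuousOn, fun t ht => ?_⟩
  have h1 : z (projIcc 0 T hT.le t) = P z t := by
    have := congrArg (fun y : C(I, E) => y ⟨t, ht⟩) hfix
    rw [projIcc_of_mem hT.le ht]
    exact this.symm
  rw [intervalIntegral.integral_add (hint z _ _) (hFI t ht)]
  show Real.exp (ℓ * t) • z (projIcc 0 T hT.le t) = _
  rw [h1, hP]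
  simp only
  rw [smul_smul, ← Real.exp_add, add_neg_cancel, Real.exp_zero, one_smul]

end Picard

section Lipschitz

variable {X : Type*} [MeasurableSpace X] {μ : Measure X}

lemma enorm_liftL1_sub_le {v w : X → ℝ} (hv : MemLp v 1 μ) (hw : MemLp w 1 μ) :
    ‖liftL1 μ v - liftL1 μ w‖ₑ = eLpNorm (fun x => v x - w x) 1 μ := by
  rw [Lp.enorm_def]
  refine eLpNorm_congr_ae ?_
  filter_upwards [Lp.coeFn_sub (liftL1 μ v) (liftL1 μ w), coeFn_liftL1 hv, coeFn_liftL1 hw]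
    with x h1 h2 h3
  rw [h1, Pi.sub_apply, h2, h3]

lemma InDom.memLp_drift [SFinite μ] {K : X → X → ℝ} {Ψ : ℝ → ℝ} {v : X → ℝ}
    (hv : InDom μ K Ψ v) : MemLp (drift μ K Ψ v) 1 μ :=
  memLp_one_iff_integrable.2 hv.integrable_drift

lemma enorm_liftL1_drift_sub_le [SFinite μ] {K : X → X → ℝ} {Ψ Θ : ℝ → ℝ} {v w : X → ℝ}
    (hv : InDom μ K Ψ v) (hw : InDom μ K Θ w) :
    ‖liftL1 μ (drift μ K Ψ v) - liftL1 μ (drift μ K Θ w)‖ₑ ≤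
      ∫⁻ z, ‖K z.1 z.2‖ₑ * ‖Ψ (v z.2 - v z.1) - Θ (w z.2 - w z.1)‖ₑ ∂(μ.prod μ) := by
  rw [enorm_liftL1_sub_le hv.memLp_drift hw.memLp_drift, eLpNorm_one_eq_lintegral_enorm]
  have hm := (Integrable.sub hv hw).aestronglyMeasurable.enorm
  have e : ∀ z : X × X, ‖K z.1 z.2‖ₑ * ‖Ψ (v z.2 - v z.1) - Θ (w z.2 - w z.1)‖ₑ =
      ‖K z.1 z.2 * Ψ (v z.2 - v z.1) - K z.1 z.2 * Θ (w z.2 - w z.1)‖ₑ := fun z => by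
    rw [← enorm_mul, mul_sub]
  simp only [e]
  refine le_trans ?_ (lintegral_prod _ hm).symm.le
  refine lintegral_mono_ae ?_
  filter_upwards [drift_sub_ae hv hw] with x hx
  rw [hx]
  exact enorm_integral_le_lintegral_enorm _

lemma inDom_of_lipschitz [IsFiniteMeasure μ] {K : X → X → ℝ} (hK : IsAEKernel μ K) {Ψ : ℝ → ℝ}
    {L : NNReal} (hL : LipschitzWith L Ψ) (h0 : Ψ 0 = 0) {v : X → ℝ} (hv : MemLp v 1 μ) :
    InDom μ K Ψ v := by
  obtain ⟨κ, hκ, -, hS⟩ := hK.lintegral_mul_sub_le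
  refine ⟨aestronglyMeasurable_mul_comp hK.measurable hL.continuous hv.1, ?_⟩
  rw [hasFiniteIntegral_iff_enorm]
  have h1 : ∀ s, ‖Ψ s‖ₑ ≤ L * ‖s‖ₑ := fun s => by
    have := hL.edist_le_mul s 0
    rwa [h0, edist_zero_right, edist_zero_right] at this
  calc ∫⁻ z, ‖K z.1 z.2 * Ψ (v z.2 - v z.1)‖ₑ ∂(μ.prod μ)
      ≤ ∫⁻ z, L * (‖K z.1 z.2‖ₑ * ‖v z.2 - v z.1‖ₑ) ∂(μ.prod μ) := by
        refine lintegral_mono fun z => ?_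
        rw [enorm_mul, mul_left_comm]
        exact mul_le_mul_right (h1 _) _
    _ = L * ∫⁻ z, ‖K z.1 z.2‖ₑ * ‖v z.2 - v z.1‖ₑ ∂(μ.prod μ) :=
        lintegral_const_mul' _ _ (by simp)
    _ ≤ L * (κ * eLpNorm v 1 μ) := mul_le_mul_right (hS v hv.1) _
    _ < ⊤ := ENNReal.mul_lt_top (by simp) (ENNReal.mul_lt_top hκ hv.2)

/-- Existence for a Lipschitz nonlinearity: the operator is then Lipschitz on `L¹` by Schur's
test. -/
theorem exists_isStrong_of_lipschitz [IsFiniteMeasure μ] [SecondCountableTopology (Lp ℝ 1 μ)]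
    {T : ℝ} (hT : 0 < T) {K : X → X → ℝ} (hK : IsAEKernel μ K) {Ψ : ℝ → ℝ} {L : NNReal}
    (hL : LipschitzWith L Ψ) (h0 : Ψ 0 = 0) {g : X → ℝ} (hg : MemLp g 1 μ) {f : ℝ → X → ℝ}
    (hf : AEStronglyMeasurable (Function.uncurry f) ((volume.restrict (Icc 0 T)).prod μ))
    (hfn : ∫⁻ t in Icc 0 T, eLpNorm (f t) 1 μ < ⊤) :
    ∃ u D, IsStrong μ T K Ψ g f u D := by
  obtain ⟨κ, hκ, -, hS⟩ := hK.lintegral_mul_sub_le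
  have hdom : ∀ v : Lp ℝ 1 μ, InDom μ K Ψ v := fun v =>
    inDom_of_lipschitz hK hL h0 (Lp.memLp v)
  set A : Lp ℝ 1 μ → Lp ℝ 1 μ := fun v => liftL1 μ (drift μ K Ψ v) with hA
  have hAe : ∀ v w, ‖A v - A w‖ₑ ≤ L * κ * ‖v - w‖ₑ := by
    intro v w
    refine (enorm_liftL1_drift_sub_le (hdom v) (hdom w)).trans ?_
    have hvw : eLpNorm (fun x => v x - w x) 1 μ = ‖v - w‖ₑ := by
      rw [Lp.enorm_def]
      exact eLpNorm_congr_ae (Lp.coeFn_sub v w).symm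
    rw [← hvw, mul_assoc]
    refine le_trans ?_ (mul_le_mul_right (hS _ ((Lp.aestronglyMeasurable v).sub
      (Lp.aestronglyMeasurable w))) _)
    rw [← lintegral_const_mul' _ _ (by simp)]
    refine lintegral_mono fun z => ?_
    rw [mul_left_comm]
    refine mul_le_mul_right ?_ _
    have := hL.edist_le_mul (v z.2 - v z.1) (w z.2 - w z.1)
    rw [edist_eq_enorm_sub, edist_eq_enorm_sub] at this
    refine this.trans (le_of_eq ?_)
    congr 2; simp only [Pi.sub_apply]; ring
  have hAn : ∀ v w, ‖A v - A w‖ ≤ (L * κ.toReal) * ‖v - w‖ := by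
    intro v w
    have h := ENNReal.toReal_mono (ENNReal.mul_lt_top (ENNReal.mul_lt_top (by simp) hκ)
      enorm_lt_top).ne (hAe v w)
    simpa using h
  have hFm := aestronglyMeasurable_liftL1 hf
  have hFi : IntegrableOn (fun t => liftL1 μ (f t)) (Ioo 0 T) := by
    rw [← integrableOn_Icc_iff_integrableOn_Ioo]
    refine ⟨hFm, ?_⟩
    rw [hasFiniteIntegral_iff_enorm]
    exact (lintegral_mono fun t => enorm_liftL1_le (f t)).trans_lt hfn
  obtain ⟨u, huc, hu⟩ := exists_integral_solution hT (by positivity) hAn hFi (liftL1 μ g)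
  have hAc : Continuous A := by
    refine LipschitzWith.continuous (K := L * κ.toNNReal)
      (LipschitzWith.of_dist_le_mul fun v w => ?_)
    rw [dist_eq_norm, dist_eq_norm]; exact hAn v w
  have h0' : u 0 = liftL1 μ g := by
    rw [hu 0 ⟨le_rfl, hT.le⟩]; simp
  have hm1 : ∀ᵐ t ∂(volume.restrict (Ioo 0 T)), MemLp (f t) 1 μ := by
    rw [restrict_Ioo_eq_restrict_Icc]
    have h1 : AEMeasurable (fun t => eLpNorm (f t) 1 μ) (volume.restrict (Icc 0 T)) := by
      simpa using aemeasurable_eLpNorm one_pos hf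
    filter_upwards [hf.prodMk_left, ae_lt_top' h1 hfn.ne] with t h2 h3 using ⟨h2, h3⟩
  refine ⟨u, fun t => A (u t) + liftL1 μ (f t), ?_, fun t ht => by rw [h0', hu t ht], ?_, ?_⟩
  · exact ((hAc.comp_continuousOn huc).integrableOn_Icc.mono_set Ioo_subset_Icc_self).add hFi
  · rw [h0']; exact coeFn_liftL1 hg
  · filter_upwards [hm1] with t ht
    refine ⟨hdom _, ?_⟩
    filter_upwards [Lp.coeFn_add (A (u t)) (liftL1 μ (f t)), coeFn_liftL1 ht,
      coeFn_liftL1 (hdom (u t)).memLp_drift] with x h1 h2 h3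
    rw [h1, Pi.add_apply, h2, h3]

end Lipschitz

/-! ### Existence by approximation -/

section Existence

variable {X : Type*} [MeasurableSpace X] {μ : Measure X} [IsFiniteMeasure μ]

lemma one_le_ofReal_dataExp (p : ℝ) : 1 ≤ ENNReal.ofReal (dataExp p) := by
  rw [← ENNReal.ofReal_one]
  exact ENNReal.ofReal_le_ofReal (by linarith [two_le_dataExp p])

/-- The embedding of `L^q` into `L¹`. -/
lemma exists_eLpNorm_one_le (μ : Measure X) [IsFiniteMeasure μ] (p : ℝ) :
    ∃ c : ℝ≥0∞, c < ⊤ ∧ ∀ v : X → ℝ, AEStronglyMeasurable v μ →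
      eLpNorm v 1 μ ≤ c * eLpNorm v (ENNReal.ofReal (dataExp p)) μ := by
  refine ⟨μ univ ^ (1 / (1 : ℝ≥0∞).toReal - 1 / (ENNReal.ofReal (dataExp p)).toReal),
    ENNReal.rpow_lt_top_of_nonneg ?_ (measure_ne_top _ _), fun v hv => ?_⟩
  · rw [ENNReal.toReal_one, ENNReal.toReal_ofReal (by linarith [two_le_dataExp p]), div_one,
      sub_nonneg, div_le_one (by linarith [two_le_dataExp p])]
    linarith [two_le_dataExp p]
  · rw [mul_comm]
    exact eLpNorm_le_eLpNorm_mul_rpow_measure_univ (one_le_ofReal_dataExp p) hv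

/-- The operator is continuous from `L^q` to `L¹`, uniformly on bounded sets. -/
lemma exists_modulus {p : ℝ} (hp : 1 < p) {K : X → X → ℝ} (hK : IsAEKernel μ K) {N : ℝ≥0∞}
    (hN : N < ⊤) {e : ℕ → ℝ≥0∞} (he : Tendsto e atTop (𝓝 0)) :
    ∃ θ : ℕ → ℝ≥0∞, Tendsto θ atTop (𝓝 0) ∧ ∀ n (v w : X → ℝ), AEStronglyMeasurable v μ →
      AEStronglyMeasurable w μ → eLpNorm v (ENNReal.ofReal (dataExp p)) μ ≤ N →
      eLpNorm (w - v) (ENNReal.ofReal (dataExp p)) μ ≤ e n →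
      ∫⁻ z, ‖K z.1 z.2‖ₑ * ‖psi p (w z.2 - w z.1) - psi p (v z.2 - v z.1)‖ₑ ∂(μ.prod μ) ≤ θ n := by
  obtain ⟨κ, hκ, hκb⟩ := hK.bounded
  have hσ : 0 < p - 1 := by linarith
  have hμ : μ univ ^ (1 / 2 : ℝ) < ⊤ :=
    ENNReal.rpow_lt_top_of_nonneg (by norm_num) (measure_lt_top _ _).ne
  set J := κ * growth μ p N * μ univ ^ (1 / 2 : ℝ) with hJ
  have hJt : J < ⊤ := ENNReal.mul_lt_top (ENNReal.mul_lt_top hκ (growth_lt_top hp hN)) hμ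
  refine ⟨fun n => ⨆ (v : X → ℝ) (w : X → ℝ) (_ : AEStronglyMeasurable v μ)
    (_ : AEStronglyMeasurable w μ) (_ : eLpNorm v (ENNReal.ofReal (dataExp p)) μ ≤ N)
    (_ : eLpNorm (w - v) (ENNReal.ofReal (dataExp p)) μ ≤ e n),
    ∫⁻ z, ‖K z.1 z.2‖ₑ * ‖psi p (w z.2 - w z.1) - psi p (v z.2 - v z.1)‖ₑ ∂(μ.prod μ), ?_,
    fun n v w h1 h2 h3 h4 => le_iSup_of_le v (le_iSup_of_le w (le_iSup_of_le h1 (le_iSup_of_le h2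
      (le_iSup_of_le h3 (le_iSup_of_le h4 le_rfl)))))⟩
  rw [ENNReal.tendsto_nhds_zero]
  intro η hη
  -- split `η` between the two terms of the modulus of continuity of the nonlinearity
  obtain ⟨ε, hε, hεJ⟩ : ∃ ε : ℝ, 0 < ε ∧ ENNReal.ofReal ε * J ≤ η / 2 := by
    have hlim : Tendsto (fun n : ℕ => ENNReal.ofReal (1 / ((n : ℝ) + 1)) * J) atTop (𝓝 0) := by
      have h1 := ENNReal.tendsto_ofReal tendsto_one_div_add_atTop_nhds_zero_nat
      have := ENNReal.Tendsto.mul_const h1 (b := J) (Or.inr hJt.ne)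
      simpa using this
    obtain ⟨n, hn⟩ := ((ENNReal.tendsto_nhds_zero.1 hlim) (η / 2) (ENNReal.half_pos hη.ne')).exists
    exact ⟨1 / ((n : ℝ) + 1), by positivity, hn⟩
  obtain ⟨C, hC, hCb⟩ := exists_abs_psi_sub_le hp hε
  have hG : Tendsto (fun n => ENNReal.ofReal C * (κ * growth μ p (e n) * μ univ ^ (1 / 2 : ℝ)))
      atTop (𝓝 0) := by
    have h1 := ENNReal.Tendsto.const_mul (a := κ) (tendsto_growth_zero (μ := μ) hp he)
      (Or.inr hκ.ne)
    have h2 := ENNReal.Tendsto.mul_const h1 (b := μ univ ^ (1 / 2 : ℝ)) (Or.inr hμ.ne)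
    have h3 := ENNReal.Tendsto.const_mul (a := ENNReal.ofReal C) h2 (Or.inr ENNReal.ofReal_ne_top)
    simpa using h3
  filter_upwards [(ENNReal.tendsto_nhds_zero.1 hG) (η / 2) (ENNReal.half_pos hη.ne')] with n hn
  refine iSup_le fun v => iSup_le fun w => iSup_le fun hv => iSup_le fun hw => iSup_le fun hvN =>
    iSup_le fun hvw => ?_
  have hwv : AEStronglyMeasurable (w - v) μ := hw.sub hv
  have hpt : ∀ z : X × X, ‖K z.1 z.2‖ₑ * ‖psi p (w z.2 - w z.1) - psi p (v z.2 - v z.1)‖ₑ ≤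
      ENNReal.ofReal ε * (‖K z.1 z.2‖ₑ * ‖v z.2 - v z.1‖ₑ ^ (p - 1)) +
        ENNReal.ofReal C * (‖K z.1 z.2‖ₑ * ‖(w - v) z.2 - (w - v) z.1‖ₑ ^ (p - 1)) := by
    intro z
    rw [mul_left_comm, mul_left_comm (ENNReal.ofReal C), ← mul_add]
    refine mul_le_mul_right ?_ _
    have h := hCb (w z.2 - w z.1) (v z.2 - v z.1)
    rw [show w z.2 - w z.1 - (v z.2 - v z.1) = (w - v) z.2 - (w - v) z.1 by
      simp only [Pi.sub_apply]; ring] at h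
    rw [Real.enorm_eq_ofReal_abs]
    refine (ENNReal.ofReal_le_ofReal h).trans (le_of_eq ?_)
    rw [ENNReal.ofReal_add (by positivity) (by positivity), ENNReal.ofReal_mul hε.le,
      ENNReal.ofReal_mul hC, ← ENNReal.ofReal_rpow_of_nonneg (abs_nonneg _) hσ.le,
      ← ENNReal.ofReal_rpow_of_nonneg (abs_nonneg _) hσ.le, ← Real.enorm_eq_ofReal_abs,
      ← Real.enorm_eq_ofReal_abs]
  refine (lintegral_mono hpt).trans ?_
  rw [lintegral_add_left' ((aemeasurable_enorm_mul_rpow hK.measurable hv _).const_mul _),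
    lintegral_const_mul' _ _ ENNReal.ofReal_ne_top, lintegral_const_mul' _ _ ENNReal.ofReal_ne_top,
    ← lintegral_absDrift hK.measurable hv, ← lintegral_absDrift hK.measurable hwv]
  have b1 : ∫⁻ x, absDrift μ K (p - 1) v x ∂μ ≤ J :=
    (lintegral_absDrift_le hp hK.measurable hκb hv).trans
      (mul_le_mul_left (mul_le_mul_right (growth_mono hp hvN) _) _)
  have b2 : ∫⁻ x, absDrift μ K (p - 1) (w - v) x ∂μ ≤
      κ * growth μ p (e n) * μ univ ^ (1 / 2 : ℝ) :=
    (lintegral_absDrift_le hp hK.measurable hκb hwv).trans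
      (mul_le_mul_left (mul_le_mul_right (growth_mono hp hvw) _) _)
  calc _ ≤ ENNReal.ofReal ε * J +
        ENNReal.ofReal C * (κ * growth μ p (e n) * μ univ ^ (1 / 2 : ℝ)) :=
        add_le_add (mul_le_mul_right b1 _) (mul_le_mul_right b2 _)
    _ ≤ η / 2 + η / 2 := add_le_add hεJ hn
    _ = η := ENNReal.add_halves η

/-- Passage to the limit: solutions of approximate problems that are Cauchy in `C([0,T]; L^q)`
converge to a solution of the limit problem. The sequence `δ` bounds the error that the approximate
nonlinearities make at the approximate solutions. -/
theorem exists_isStrong_of_approx [SecondCountableTopology (Lp ℝ 1 μ)] {p : ℝ} (hp : 1 < p) {T : ℝ}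
    (hT : 0 < T) {K : X → X → ℝ} (hK : IsAEKernel μ K) {g : X → ℝ} {f : ℝ → X → ℝ}
    (hg : MemLp g (ENNReal.ofReal (dataExp p)) μ)
    (hf : AEStronglyMeasurable (Function.uncurry f) ((volume.restrict (Icc 0 T)).prod μ))
    (hfn : ∫⁻ t in Icc 0 T, eLpNorm (f t) (ENNReal.ofReal (dataExp p)) μ < ⊤)
    {Ψn : ℕ → ℝ → ℝ} {gn : ℕ → X → ℝ} {fn : ℕ → ℝ → X → ℝ} {un Dn : ℕ → ℝ → Lp ℝ 1 μ}
    (hs : ∀ n, IsStrong μ T K (Ψn n) (gn n) (fn n) (un n) (Dn n))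
    (hfm : ∀ n, AEStronglyMeasurable (Function.uncurry (fn n)) ((volume.restrict (Icc 0 T)).prod μ))
    (hfnn : ∀ n, ∫⁻ t in Icc 0 T, eLpNorm (fn n t) (ENNReal.ofReal (dataExp p)) μ < ⊤)
    {N : ℝ≥0∞} (hN : N < ⊤)
    (huN : ∀ n, ∀ t ∈ Icc 0 T, eLpNorm (un n t) (ENNReal.ofReal (dataExp p)) μ ≤ N)
    {e : ℕ → ℝ≥0∞} (he : Tendsto e atTop (𝓝 0))
    (hc : ∀ n m, n ≤ m → ∀ t ∈ Icc 0 T,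
      eLpNorm (un m t - un n t : Lp ℝ 1 μ) (ENNReal.ofReal (dataExp p)) μ ≤ e n)
    {δ : ℕ → ℝ≥0∞} (hδ : Tendsto δ atTop (𝓝 0))
    (hΨδ : ∀ n, ∀ t ∈ Icc 0 T, ∫⁻ z, ‖K z.1 z.2‖ₑ * ‖Ψn n (un n t z.2 - un n t z.1) -
      psi p (un n t z.2 - un n t z.1)‖ₑ ∂(μ.prod μ) ≤ δ n)
    (hgn : Tendsto (fun n => eLpNorm (gn n - g) (ENNReal.ofReal (dataExp p)) μ) atTop (𝓝 0))
    (hfn' : Tendsto (fun n => ∫⁻ t in Icc 0 T,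
      eLpNorm (fn n t - f t) (ENNReal.ofReal (dataExp p)) μ) atTop (𝓝 0)) :
    ∃ u D, IsStrong μ T K (psi p) g f u D := by
  set Q := ENNReal.ofReal (dataExp p) with hQ
  have hq0 : 0 < dataExp p := by linarith [two_le_dataExp p]
  obtain ⟨c, hct, hc1⟩ := exists_eLpNorm_one_le μ p
  obtain ⟨κ, hκ, hκb⟩ := hK.bounded
  have hμ : μ univ ^ (1 / 2 : ℝ) < ⊤ :=
    ENNReal.rpow_lt_top_of_nonneg (by norm_num) (measure_lt_top _ _).ne
  have hce : Tendsto (fun n => c * e n) atTop (𝓝 0) := by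
    simpa using ENNReal.Tendsto.const_mul he (Or.inr hct.ne)
  -- the limit in `L¹`, at each time
  have hlim : ∀ t ∈ Icc 0 T, ∃ v : Lp ℝ 1 μ, Tendsto (fun n => un n t) atTop (𝓝 v) := by
    intro t ht
    refine cauchySeq_tendsto_of_complete (EMetric.cauchySeq_iff'.2 fun ε hε => ?_)
    obtain ⟨n, hn⟩ := ((tendsto_order.1 hce).2 ε hε).exists
    refine ⟨n, fun m hm => lt_of_le_of_lt ?_ hn⟩
    rw [edist_eq_enorm_sub, Lp.enorm_def]
    exact (hc1 _ (Lp.aestronglyMeasurable _)).trans (mul_le_mul_right (hc n m hm t ht) _)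
  choose! u hu using hlim
  have hue : ∀ n, ∀ t ∈ Icc 0 T, eLpNorm (u t - un n t : Lp ℝ 1 μ) Q μ ≤ e n := by
    intro n t ht
    refine eLpNorm_le_of_tendstoInMeasure (u := atTop) (f := fun m => (un m t - un n t : Lp ℝ 1 μ))
      ?_ (tendstoInMeasure_of_tendsto_Lp ((hu t ht).sub_const _))
      (fun m => Lp.aestronglyMeasurable _)
    filter_upwards [eventually_ge_atTop n] with m hm using hc n m hm t ht
  have hmem : ∀ t ∈ Icc 0 T, eLpNorm (u t) Q μ ≤ N := fun t ht =>
    eLpNorm_le_of_tendstoInMeasure (u := atTop) (.of_forall fun m => huN m t ht)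
      (tendstoInMeasure_of_tendsto_Lp (hu t ht)) (fun m => Lp.aestronglyMeasurable _)
  have hdom : ∀ t ∈ Icc 0 T, InDom μ K (psi p) (u t) := fun t ht =>
    inDom_psi hp hK ⟨Lp.aestronglyMeasurable _, (hmem t ht).trans_lt hN⟩
  obtain ⟨θ, hθ, hθb⟩ := exists_modulus hp hK hN he
  -- convergence of the drifts
  set b : ℝ → Lp ℝ 1 μ := fun t => liftL1 μ (drift μ K (psi p) (u t)) with hb
  have hbconv : ∀ n, ∀ t ∈ Icc 0 T, InDom μ K (Ψn n) (un n t) →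
      ‖liftL1 μ (drift μ K (Ψn n) (un n t)) - b t‖ₑ ≤ δ n + θ n := by
    intro n t ht hd
    refine (enorm_liftL1_drift_sub_le hd (hdom t ht)).trans ?_
    have hθ' := hθb n (u t) (un n t) (Lp.aestronglyMeasurable _) (Lp.aestronglyMeasurable _)
      (hmem t ht) (by
        rw [eLpNorm_sub_comm]
        refine le_of_eq_of_le (eLpNorm_congr_ae (Lp.coeFn_sub _ _).symm) (hue n t ht))
    refine le_trans ?_ (add_le_add (hΨδ n t ht) hθ')
    have hm : AEMeasurable (fun z : X × X => ‖K z.1 z.2‖ₑ * ‖psi p (un n t z.2 - un n t z.1) -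
        psi p (u t z.2 - u t z.1)‖ₑ) (μ.prod μ) := by
      have hd' : ∀ v : Lp ℝ 1 μ, AEStronglyMeasurable (fun z : X × X => psi p (v z.2 - v z.1))
          (μ.prod μ) := fun v => (continuous_psi hp).comp_aestronglyMeasurable
        ((Lp.aestronglyMeasurable v).comp_snd.sub (Lp.aestronglyMeasurable v).comp_fst)
      exact hK.measurable.enorm.mul ((hd' _).sub (hd' _)).enorm
    rw [← lintegral_add_right' _ hm]
    refine lintegral_mono fun z => ?_
    rw [← mul_add]
    refine mul_le_mul_right ?_ _
    rw [← sub_add_sub_cancel _ (psi p (un n t z.2 - un n t z.1)) _]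
    exact enorm_add_le _ _
  have hδθ : Tendsto (fun n => δ n + θ n) atTop (𝓝 0) := by simpa using hδ.add hθ
  -- the sources as curves in `L¹`
  have hsrc : ∀ {h : ℝ → X → ℝ}, AEStronglyMeasurable (Function.uncurry h)
      ((volume.restrict (Icc 0 T)).prod μ) → ∫⁻ t in Icc 0 T, eLpNorm (h t) Q μ < ⊤ →
      IntegrableOn (fun t => liftL1 μ (h t)) (Ioo 0 T) ∧
        ∀ᵐ t ∂(volume.restrict (Ioo 0 T)), MemLp (h t) 1 μ := by
    intro h hm hi
    rw [← integrableOn_Icc_iff_integrableOn_Ioo, restrict_Ioo_eq_restrict_Icc]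
    have hsec : ∀ᵐ t ∂(volume.restrict (Icc 0 T)), AEStronglyMeasurable (h t) μ := hm.prodMk_left
    refine ⟨⟨aestronglyMeasurable_liftL1 hm, ?_⟩, ?_⟩
    · rw [hasFiniteIntegral_iff_enorm]
      refine lt_of_le_of_lt (lintegral_mono_ae (hsec.mono fun t ht =>
        (enorm_liftL1_le (h t)).trans (hc1 _ ht))) ?_
      rw [lintegral_const_mul' _ _ hct.ne]
      exact ENNReal.mul_lt_top hct hi
    · filter_upwards [hsec, ae_lt_top' (aemeasurable_eLpNorm hq0 hm) hi.ne] with t h1 h2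
      exact ⟨h1, (hc1 _ h1).trans_lt (ENNReal.mul_lt_top hct h2)⟩
  obtain ⟨hFi, hFm⟩ := hsrc hf hfn
  have hI : ∀ᵐ t ∂(volume.restrict (Ioo 0 T)), t ∈ Ioo 0 T := ae_restrict_mem measurableSet_Ioo
  have hDn : ∀ n, ∀ᵐ t ∂(volume.restrict (Ioo 0 T)), InDom μ K (Ψn n) (un n t) ∧
      Dn n t = liftL1 μ (drift μ K (Ψn n) (un n t)) + liftL1 μ (fn n t) := by
    intro n
    filter_upwards [(hs n).equation, (hsrc (hfm n) (hfnn n)).2] with t ⟨h1, h2⟩ h3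
    refine ⟨h1, Lp.ext ?_⟩
    filter_upwards [h2, Lp.coeFn_add (liftL1 μ (drift μ K (Ψn n) (un n t))) (liftL1 μ (fn n t)),
      coeFn_liftL1 h3, coeFn_liftL1 h1.memLp_drift] with x e1 e2 e3 e4
    rw [e1, e2, Pi.add_apply, e3, e4]
  have hbi : IntegrableOn b (Ioo 0 T) := by
    refine ⟨?_, ?_⟩
    · refine aestronglyMeasurable_of_tendsto_ae atTop (f := fun n t => Dn n t - liftL1 μ (fn n t))
        (fun n => ((hs n).integrable.sub (hsrc (hfm n) (hfnn n)).1).aestronglyMeasurable) ?_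
      filter_upwards [ae_all_iff.2 hDn, hI] with t ht htI
      rw [tendsto_iff_edist_tendsto_0]
      refine tendsto_of_tendsto_of_tendsto_of_le_of_le tendsto_const_nhds hδθ
        (fun _ => zero_le) (fun n => ?_)
      rw [edist_eq_enorm_sub, (ht n).2, add_sub_cancel_right]
      exact hbconv n t (Ioo_subset_Icc_self htI) (ht n).1
    · rw [hasFiniteIntegral_iff_enorm]
      refine lt_of_le_of_lt (lintegral_mono_ae
        (g := fun _ => κ * growth μ p N * μ univ ^ (1 / 2 : ℝ)) (hI.mono fun t ht => ?_)) ?_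
      · refine (enorm_liftL1_le _).trans ?_
        rw [eLpNorm_one_eq_lintegral_enorm]
        exact (lintegral_mono fun x => enorm_drift_psi_le hp K (u t) x).trans
          ((lintegral_absDrift_le hp hK.measurable hκb (Lp.aestronglyMeasurable _)).trans
          (mul_le_mul_left (mul_le_mul_right
            (growth_mono hp (hmem t (Ioo_subset_Icc_self ht))) _) _))
      · rw [lintegral_const]
        exact ENNReal.mul_lt_top (ENNReal.mul_lt_top
          (ENNReal.mul_lt_top hκ (growth_lt_top hp hN)) hμ) (by simp)
  have hDi : IntegrableOn (fun t => b t + liftL1 μ (f t)) (Ioo 0 T) := hbi.add hFi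
  -- convergence of the time derivatives
  have hDconv : Tendsto (fun n => ∫⁻ t in Ioo 0 T, ‖Dn n t - (b t + liftL1 μ (f t))‖ₑ) atTop
      (𝓝 0) := by
    have hup : Tendsto (fun n => (δ n + θ n) * volume (Ioo 0 T) +
        c * ∫⁻ t in Icc 0 T, eLpNorm (fn n t - f t) Q μ) atTop (𝓝 0) := by
      have h1 := ENNReal.Tendsto.mul_const hδθ (b := volume (Ioo 0 T)) (Or.inr (by simp))
      have h2 := ENNReal.Tendsto.const_mul hfn' (a := c) (Or.inr hct.ne)
      simpa using h1.add h2
    refine tendsto_of_tendsto_of_tendsto_of_le_of_le tendsto_const_nhds hup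
      (fun _ => zero_le) (fun n => ?_)
    have h1 : ∀ᵐ t ∂(volume.restrict (Ioo 0 T)), ‖Dn n t - (b t + liftL1 μ (f t))‖ₑ ≤
        (δ n + θ n) + c * eLpNorm (fn n t - f t) Q μ := by
      filter_upwards [hDn n, hI, hFm, (hsrc (hfm n) (hfnn n)).2] with t ⟨h1, h2⟩ h3 h4 h5
      rw [h2, add_sub_add_comm]
      refine (enorm_add_le _ _).trans (add_le_add (hbconv n t (Ioo_subset_Icc_self h3) h1) ?_)
      rw [enorm_liftL1_sub_le h5 h4]
      exact hc1 _ (h5.1.sub h4.1)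
    refine (lintegral_mono_ae h1).trans ?_
    rw [lintegral_add_left' aemeasurable_const, setLIntegral_const, lintegral_const_mul' _ _ hct.ne]
    exact add_le_add le_rfl (mul_le_mul_right (lintegral_mono_set Ioo_subset_Icc_self) _)
  refine ⟨u, fun t => b t + liftL1 μ (f t), hDi, fun t ht => ?_, ?_, ?_⟩
  · have h0 : (0 : ℝ) ∈ Icc 0 T := ⟨le_rfl, hT.le⟩
    have h1 : Tendsto (fun n => ∫ s in (0 : ℝ)..t, Dn n s) atTop
        (𝓝 (∫ s in (0 : ℝ)..t, (b s + liftL1 μ (f s)))) := by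
      simp only [intervalIntegral.integral_of_le ht.1, integral_Ioc_eq_integral_Ioo]
      refine tendsto_integral_of_L1 _
        (hDi.mono_set (Ioo_subset_Ioo_right ht.2)).aestronglyMeasurable
        (.of_forall fun n => (hs n).integrable.mono_set (Ioo_subset_Ioo_right ht.2)) ?_
      exact tendsto_of_tendsto_of_tendsto_of_le_of_le tendsto_const_nhds hDconv
        (fun _ => zero_le) (fun n => lintegral_mono_set (Ioo_subset_Ioo_right ht.2))
    have h2 := (hu 0 h0).add h1
    exact tendsto_nhds_unique (hu t ht) (h2.congr fun n => ((hs n).primitive t ht).symm)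
  · have h0 : (0 : ℝ) ∈ Icc 0 T := ⟨le_rfl, hT.le⟩
    have hzero : eLpNorm (fun x => u 0 x - g x) Q μ = 0 := by
      have hle : ∀ n, eLpNorm (fun x => u 0 x - g x) Q μ ≤ e n + eLpNorm (gn n - g) Q μ := by
        intro n
        have e1 : (fun x => u 0 x - g x) =ᵐ[μ]
            ((u 0 - un n 0 : Lp ℝ 1 μ) : X → ℝ) + (gn n - g) := by
          filter_upwards [Lp.coeFn_sub (u 0) (un n 0), (hs n).initial] with x h1 h2
          rw [Pi.add_apply, h1, Pi.sub_apply, Pi.sub_apply, h2]; ring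
        have hgm : AEStronglyMeasurable (gn n) μ :=
          (Lp.aestronglyMeasurable (un n 0)).congr (hs n).initial
        rw [eLpNorm_congr_ae e1]
        exact (eLpNorm_add_le (Lp.aestronglyMeasurable _) (hgm.sub hg.1)
          (one_le_ofReal_dataExp p)).trans (add_le_add (hue n 0 h0) le_rfl)
      have hl : Tendsto (fun n => e n + eLpNorm (gn n - g) Q μ) atTop (𝓝 0) := by
        simpa using he.add hgn
      exact le_antisymm (ge_of_tendsto' hl hle) zero_le
    have hz := (eLpNorm_eq_zero_iff (f := fun x => u 0 x - g x)
      ((Lp.aestronglyMeasurable (u 0)).sub hg.1)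
      (zero_lt_one.trans_le (one_le_ofReal_dataExp p)).ne').1 hzero
    filter_upwards [hz] with x hx using sub_eq_zero.1 hx
  · filter_upwards [hI, hFm] with t ht hft
    refine ⟨hdom t (Ioo_subset_Icc_self ht), ?_⟩
    filter_upwards [Lp.coeFn_add (b t) (liftL1 μ (f t)), coeFn_liftL1 hft,
      coeFn_liftL1 (hdom t (Ioo_subset_Icc_self ht)).memLp_drift] with x h1 h2 h3
    rw [h1, Pi.add_apply, h2, h3]

end Existence

/-- Steklov averages of the truncation of a continuous monotone odd function are Lipschitz,
monotone and odd, and approximate it uniformly on the interval of truncation. -/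
lemma exists_lipschitz_approx {Ψ : ℝ → ℝ} (hΨ : Continuous Ψ) (hmono : Monotone Ψ)
    (hodd : ∀ s, Ψ (-s) = - Ψ s) {M : ℝ} (hM : 0 ≤ M) {ε : ℝ} (hε : 0 < ε) :
    ∃ (Θ : ℝ → ℝ) (L : NNReal), LipschitzWith L Θ ∧ Monotone Θ ∧ (∀ s, Θ (-s) = - Θ s) ∧
      ∀ s, |s| ≤ M → |Θ s - Ψ s| ≤ ε := by
  set Φ : ℝ → ℝ := fun s => Ψ (clamp M s) with hΦ
  have hΦc : Continuous Φ := hΨ.comp (continuous_clamp M)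
  have hΦm : Monotone Φ := hmono.comp (monotone_clamp M)
  have hΦo : ∀ s, Φ (-s) = - Φ s := fun s => by simp only [hΦ, clamp_neg hM, hodd]
  have hmem : ∀ s, clamp M s ∈ Icc (-M) M := fun s => abs_le.1 (abs_clamp_le hM s)
  have huc : UniformContinuousOn Ψ (Icc (-M) M) :=
    isCompact_Icc.uniformContinuousOn_of_continuous hΨ.continuousOn
  obtain ⟨δ, hδ, hδc⟩ := Metric.uniformContinuousOn_iff.1 huc ε hε
  have hclip : ∀ s t, |clamp M s - clamp M t| ≤ |s - t| := fun s t => by unfold clamp; grind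
  set B : ℝ := Ψ M with hB
  have hBb : ∀ s, |Φ s| ≤ B := fun s => by
    rw [abs_le, hB, ← hodd]
    exact ⟨hmono (hmem s).1, hmono (hmem s).2⟩
  have hB0 : 0 ≤ B := (abs_nonneg _).trans (hBb 0)
  set r : ℝ := δ / 2 with hr
  have hr0 : 0 < r := by positivity
  have hi : ∀ a b, IntervalIntegrable Φ volume a b := fun a b => hΦc.intervalIntegrable a b
  have hi' : ∀ s a b, IntervalIntegrable (fun x => Φ (s + x)) volume a b := fun s a b =>
    (hΦc.comp (by fun_prop)).intervalIntegrable a b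
  set Θ : ℝ → ℝ := fun s => (1 / (2 * r)) * ∫ x in (-r)..r, Φ (s + x) with hΘ
  refine ⟨Θ, ⟨1 / (2 * r) * (2 * B), by positivity⟩, ?_, ?_, ?_, ?_⟩
  · refine LipschitzWith.of_dist_le_mul fun s t => ?_
    rw [Real.dist_eq, Real.dist_eq]
    show _ ≤ 1 / (2 * r) * (2 * B) * |s - t|
    have e : Θ s - Θ t = 1 / (2 * r) * ((∫ x in (t + r)..(s + r), Φ x) -
        ∫ x in (t + -r)..(s + -r), Φ x) := by
      simp only [hΘ]
      rw [← mul_sub, intervalIntegral.integral_comp_add_left (fun x => Φ x) s,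
        intervalIntegral.integral_comp_add_left (fun x => Φ x) t]
      congr 1
      rw [← intervalIntegral.integral_add_adjacent_intervals (hi (s + -r) (t + r)) (hi _ (s + r)),
        ← intervalIntegral.integral_add_adjacent_intervals (hi (t + -r) (s + -r)) (hi _ (t + r))]
      ring
    have hbd : ∀ a b, |∫ x in a..b, Φ x| ≤ B * |b - a| := fun a b =>
      (Real.norm_eq_abs _).symm.le.trans
        (intervalIntegral.norm_integral_le_of_norm_le_const fun x _ => hBb x)
    have h1 := hbd (t + r) (s + r)
    have h2 := hbd (t + -r) (s + -r)
    rw [add_sub_add_right_eq_sub] at h1 h2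
    rw [e, abs_mul, abs_of_pos (by positivity : 0 < 1 / (2 * r)), mul_assoc]
    refine mul_le_mul_of_nonneg_left ?_ (by positivity)
    have := abs_sub (∫ x in (t + r)..(s + r), Φ x) (∫ x in (t + -r)..(s + -r), Φ x)
    linarith
  · intro s t hst
    refine mul_le_mul_of_nonneg_left ?_ (by positivity)
    exact intervalIntegral.integral_mono_on (by linarith) (hi' s _ _) (hi' t _ _)
      (fun x _ => hΦm (by linarith))
  · intro s
    have h := intervalIntegral.integral_comp_neg (a := -r) (b := r) (fun x => Φ (-s + x))
    have e : ∀ x, Φ (-s + -x) = - Φ (s + x) := fun x => by rw [← neg_add, hΦo]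
    simp only [e, intervalIntegral.integral_neg, neg_neg] at h
    simp only [hΘ]
    rw [← h]; ring
  · intro s hs
    have e : Θ s - Ψ s = 1 / (2 * r) * ∫ x in (-r)..r, (Φ (s + x) - Ψ s) := by
      rw [intervalIntegral.integral_sub (hi' s _ _) intervalIntegrable_const,
        intervalIntegral.integral_const, smul_eq_mul, mul_sub]
      simp only [hΘ]
      congr 1
      field_simp; ring
    have hbd : |∫ x in (-r)..r, (Φ (s + x) - Ψ s)| ≤ ε * |r - -r| := by
      rw [← Real.norm_eq_abs]
      refine intervalIntegral.norm_integral_le_of_norm_le_const fun x hx => ?_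
      rw [uIoc_of_le (by linarith)] at hx
      have h1 : Ψ s = Ψ (clamp M s) := by rw [clamp_eq_self hs]
      have h2 : dist (clamp M (s + x)) (clamp M s) < δ := by
        rw [Real.dist_eq]
        refine (hclip _ _).trans_lt ?_
        rw [add_sub_cancel_left, abs_lt]
        exact ⟨by linarith [hx.1], by linarith [hx.2]⟩
      rw [h1]
      exact (hδc _ (hmem _) _ (hmem _) h2).le
    rw [e, abs_mul, abs_of_pos (by positivity : 0 < 1 / (2 * r))]
    refine (mul_le_mul_of_nonneg_left hbd (by positivity)).trans (le_of_eq ?_)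
    rw [show r - -r = 2 * r by ring, abs_of_pos (by positivity)]
    field_simp

section Existence

variable {X : Type*} [MeasurableSpace X] {μ : Measure X} [IsFiniteMeasure μ]

lemma rpow_measure_univ_lt_top {s : ℝ} (hs : 0 ≤ s) : μ univ ^ s < ⊤ :=
  ENNReal.rpow_lt_top_of_nonneg hs (measure_ne_top _ _)

/-- Existence for bounded data: the nonlinearity is replaced by Lipschitz ones which approximate it
uniformly on the range of the differences of the solutions, given by the maximum principle. -/
theorem exists_isStrong_of_bounded [SecondCountableTopology (Lp ℝ 1 μ)] {p : ℝ} (hp : 1 < p)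
    {T : ℝ} (hT : 0 < T) {K : X → X → ℝ} (hK : IsAEKernel μ K) {g : X → ℝ} {f : ℝ → X → ℝ}
    (hg : MemLp g ⊤ μ)
    (hf : AEStronglyMeasurable (Function.uncurry f) ((volume.restrict (Icc 0 T)).prod μ))
    (hfn : ∫⁻ t in Icc 0 T, eLpNorm (f t) ⊤ μ < ⊤) :
    ∃ u D, IsStrong μ T K (psi p) g f u D := by
  have hq1 : 1 < dataExp p := by linarith [two_le_dataExp p]
  have hq0 : 0 < dataExp p := by linarith
  set R := eLpNorm g ⊤ μ + ∫⁻ t in Icc 0 T, eLpNorm (f t) ⊤ μ with hR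
  have hRt : R < ⊤ := ENNReal.add_lt_top.2 ⟨hg.2, hfn⟩
  set M := 2 * R.toReal with hM
  have hM0 : 0 ≤ M := by positivity
  have hε : ∀ n : ℕ, 0 < 1 / ((n : ℝ) + 1) := fun n => by positivity
  choose Θ L hL hΘm hΘo hΘe using fun n : ℕ =>
    exists_lipschitz_approx (continuous_psi hp) (monotone_psi hp) (psi_neg p) hM0 (hε n)
  have hΘ0 : ∀ n, Θ n 0 = 0 := fun n => by have := hΘo n 0; simp at this; linarith
  have hc := rpow_measure_univ_lt_top (μ := μ) (s := 1 / dataExp p) (by positivity)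
  have hfQ : ∫⁻ t in Icc 0 T, eLpNorm (f t) (ENNReal.ofReal (dataExp p)) μ < ⊤ := by
    refine lt_of_le_of_lt (lintegral_mono_ae (hf.prodMk_left.mono fun t ht =>
      eLpNorm_ofReal_le_top hq0 ht)) ?_
    rw [lintegral_mul_const' _ _ hc.ne]
    exact ENNReal.mul_lt_top hfn hc
  have hf1 : ∫⁻ t in Icc 0 T, eLpNorm (f t) 1 μ < ⊤ := by
    obtain ⟨c, hct, hc1⟩ := exists_eLpNorm_one_le μ p
    refine lt_of_le_of_lt (lintegral_mono_ae (hf.prodMk_left.mono fun t ht => hc1 _ ht)) ?_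
    rw [lintegral_const_mul' _ _ hct.ne]
    exact ENNReal.mul_lt_top hct hfQ
  choose un Dn hs using fun n : ℕ => exists_isStrong_of_lipschitz hT hK (hL n) (hΘ0 n)
    (hg.mono_exponent le_top) hf hf1
  have hbd : ∀ n, ∀ t ∈ Icc 0 T, ∀ᵐ x ∂μ, |un n t x| ≤ R.toReal := by
    intro n t ht
    have h := (hs n).eLpNorm_top_le hK (hΘm n) (hΘo n) hf ht
    rw [eLpNorm_exponent_top] at h
    filter_upwards [ae_le_eLpNormEssSup (f := un n t) (μ := μ)] with x hx
    have h2 := hx.trans h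
    rw [Real.enorm_eq_ofReal_abs] at h2
    have := ENNReal.toReal_mono hRt.ne h2
    rwa [ENNReal.toReal_ofReal (abs_nonneg _)] at this
  have hdiff : ∀ {a b : ℝ}, |a| ≤ R.toReal → |b| ≤ R.toReal → |a - b| ≤ M := fun ha hb =>
    (abs_sub _ _).trans (by rw [hM]; linarith)
  obtain ⟨κ, hκ, hrow, -⟩ := hK.lintegral_mul_sub_le
  set ε : ℕ → ℝ≥0∞ := fun n => ENNReal.ofReal (1 / ((n : ℝ) + 1)) with hεdef
  have hεlim : Tendsto ε atTop (𝓝 0) := by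
    have := ENNReal.tendsto_ofReal tendsto_one_div_add_atTop_nhds_zero_nat
    rwa [ENNReal.ofReal_zero] at this
  have hεmono : ∀ n m, n ≤ m → ε m ≤ ε n := fun n m hnm =>
    ENNReal.ofReal_le_ofReal (one_div_le_one_div_of_le (by positivity) (by
      have : (n : ℝ) ≤ m := by exact_mod_cast hnm
      linarith))
  have hΘe' : ∀ n s, |s| ≤ M → ‖Θ n s - psi p s‖ₑ ≤ ε n := fun n s hs => by
    rw [Real.enorm_eq_ofReal_abs]; exact ENNReal.ofReal_le_ofReal (hΘe n s hs)
  have hfin : ∀ n, ∀ t ∈ Icc 0 T, ∀ᵐ z ∂(μ.prod μ), |un n t z.2 - un n t z.1| ≤ M := by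
    intro n t ht
    have h1 : ∀ᵐ z ∂(μ.prod μ), |un n t z.1| ≤ R.toReal :=
      Measure.quasiMeasurePreserving_fst.ae (hbd n t ht)
    have h2 : ∀ᵐ z ∂(μ.prod μ), |un n t z.2| ≤ R.toReal :=
      Measure.quasiMeasurePreserving_snd.ae (hbd n t ht)
    filter_upwards [h1, h2] with z e1 e2 using hdiff e2 e1
  refine exists_isStrong_of_approx hp hT hK (hg.mono_exponent le_top) hf hfQ hs (fun _ => hf)
    (fun _ => hfQ) (N := eLpNorm g (ENNReal.ofReal (dataExp p)) μ +
      ∫⁻ t in Icc 0 T, eLpNorm (f t) (ENNReal.ofReal (dataExp p)) μ)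
    (ENNReal.add_lt_top.2 ⟨(hg.mono_exponent le_top).2, hfQ⟩) (fun n t ht => ?_)
    (e := fun n => κ * (2 * ε n) * μ univ ^ (1 / dataExp p) * volume (Icc 0 T)) ?_
    (fun n m hnm t ht => ?_) (δ := fun n => κ * ε n * μ univ) ?_ (fun n t ht => ?_) ?_ ?_
  · refine ((hs n).eLpNorm_le hq1 hK (hΘm n) (hΘo n) ht).trans (add_le_add le_rfl ?_)
    exact lintegral_mono_set (fun s hs => ⟨hs.1.le, hs.2.trans ht.2⟩)
  · have h1 := ENNReal.Tendsto.const_mul (a := 2) hεlim (Or.inr (by simp))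
    have h2 := ENNReal.Tendsto.const_mul (a := κ) h1 (Or.inr hκ.ne)
    have h3 := ENNReal.Tendsto.mul_const h2 (Or.inr hc.ne)
    have h4 := ENNReal.Tendsto.mul_const (b := volume (Icc (0 : ℝ) T)) h3 (Or.inr (by simp))
    simpa using h4
  -- the solution of problem `n` in problem `m`: the residual is that of the nonlinearities
  · have hcmp := IsStrong.eLpNorm_sub_le hq1 hK (hΘm m) (hΘo m) (hs m) (hs n)
      (ρ := fun _ => κ * (2 * ε n) * μ univ ^ (1 / dataExp p)) (by
        have hI : ∀ᵐ t ∂(volume.restrict (Ioo 0 T)), t ∈ Ioo 0 T :=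
          ae_restrict_mem measurableSet_Ioo
        filter_upwards [hI, (hs n).equation] with s hsI ⟨hd, _⟩
        have hd' : InDom μ K (Θ m) (un n s) :=
          inDom_of_lipschitz hK (hL m) (hΘ0 m) (Lp.memLp _)
        refine ⟨hd', ?_⟩
        simp only [sub_self, add_zero]
        refine (eLpNorm_ofReal_le_top hq0 (hd'.integrable_drift.sub
          hd.integrable_drift).aestronglyMeasurable).trans (mul_le_mul_left ?_ _)
        rw [eLpNorm_exponent_top]
        refine eLpNormEssSup_le_of_ae_enorm_bound ?_
        filter_upwards [drift_sub_ae hd' hd, hrow,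
          Measure.ae_ae_of_ae_prod (hfin n s (Ioo_subset_Icc_self hsI))] with x h1 h2 h3
        rw [Pi.sub_apply, h1]
        refine (enorm_integral_le_lintegral_enorm _).trans ?_
        calc ∫⁻ y, ‖K x y * Θ m (un n s y - un n s x) - K x y * Θ n (un n s y - un n s x)‖ₑ ∂μ
            ≤ ∫⁻ y, ‖K x y‖ₑ * (2 * ε n) ∂μ := by
              refine lintegral_mono_ae ?_
              filter_upwards [h3] with y hy
              rw [← mul_sub, enorm_mul]
              refine mul_le_mul_right ?_ _
              rw [← sub_sub_sub_cancel_right _ _ (psi p (un n s y - un n s x)), two_mul]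
              refine enorm_sub_le.trans (add_le_add ((hΘe' m _ hy).trans (hεmono n m hnm))
                (hΘe' n _ hy))
          _ = (∫⁻ y, ‖K x y‖ₑ ∂μ) * (2 * ε n) :=
              lintegral_mul_const' _ _ (ENNReal.mul_ne_top (by simp) ENNReal.ofReal_ne_top)
          _ ≤ κ * (2 * ε n) := mul_le_mul_left h2 _) ht
    refine hcmp.trans ?_
    rw [sub_self, eLpNorm_zero, zero_add, setLIntegral_const]
    refine mul_le_mul_right (measure_mono fun s hs => ?_) _
    exact ⟨hs.1.le, hs.2.trans ht.2⟩
  · have h2 := ENNReal.Tendsto.const_mul (a := κ) hεlim (Or.inr hκ.ne)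
    have h3 := ENNReal.Tendsto.mul_const (b := μ univ) h2 (Or.inr (measure_ne_top _ _))
    simpa using h3
  · have hKm : AEMeasurable (fun z : X × X => ‖K z.1 z.2‖ₑ) (μ.prod μ) := hK.measurable.enorm
    calc ∫⁻ z, ‖K z.1 z.2‖ₑ * ‖Θ n (un n t z.2 - un n t z.1) -
          psi p (un n t z.2 - un n t z.1)‖ₑ ∂(μ.prod μ)
        ≤ ∫⁻ z, ‖K z.1 z.2‖ₑ * ε n ∂(μ.prod μ) := by
          refine lintegral_mono_ae ?_
          filter_upwards [hfin n t ht] with z hz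
          exact mul_le_mul_right (hΘe' n _ hz) _
      _ = (∫⁻ x, ∫⁻ y, ‖K x y‖ₑ ∂μ ∂μ) * ε n := by
          rw [lintegral_mul_const' _ _ ENNReal.ofReal_ne_top, lintegral_prod _ hKm]
      _ ≤ (∫⁻ _x, κ ∂μ) * ε n := mul_le_mul_left (lintegral_mono_ae hrow) _
      _ = κ * ε n * μ univ := by rw [lintegral_const]; ring
  · simp
  · simp

/-- Existence for data in `L^q`, `q = max(2, 2(p-1))`: the data are truncated, and the solutions of
the truncated problems form a Cauchy sequence by the contraction property in `L^q`. -/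
theorem exists_isStrong [SecondCountableTopology (Lp ℝ 1 μ)] {p : ℝ} (hp : 1 < p)
    {T : ℝ} (hT : 0 < T) {K : X → X → ℝ} (hK : IsAEKernel μ K) {g : X → ℝ} {f : ℝ → X → ℝ}
    (hg : MemLp g (ENNReal.ofReal (dataExp p)) μ)
    (hf : AEStronglyMeasurable (Function.uncurry f) ((volume.restrict (Icc 0 T)).prod μ))
    (hfn : ∫⁻ t in Icc 0 T, eLpNorm (f t) (ENNReal.ofReal (dataExp p)) μ < ⊤) :
    ∃ u D, IsStrong μ T K (psi p) g f u D := by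
  have hq1 : 1 < dataExp p := by linarith [two_le_dataExp p]
  have hq0 : 0 < dataExp p := by linarith
  set Q := ENNReal.ofReal (dataExp p) with hQ
  set gn : ℕ → X → ℝ := fun n x => clamp n (g x) with hgn
  set fn : ℕ → ℝ → X → ℝ := fun n t x => clamp n (f t x) with hfn'
  have hgm : ∀ n, AEStronglyMeasurable (gn n) μ := fun n =>
    (continuous_clamp n).comp_aestronglyMeasurable hg.1
  have hfm : ∀ n, AEStronglyMeasurable (Function.uncurry (fn n))
      ((volume.restrict (Icc 0 T)).prod μ) := fun n =>
    (continuous_clamp n).comp_aestronglyMeasurable hf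
  have htop : ∀ (n : ℕ) (v : X → ℝ), eLpNorm (fun x => clamp n (v x)) ⊤ μ ≤ ENNReal.ofReal n := by
    intro n v
    rw [eLpNorm_exponent_top]
    refine eLpNormEssSup_le_of_ae_enorm_bound (.of_forall fun x => ?_)
    rw [Real.enorm_eq_ofReal_abs]
    exact ENNReal.ofReal_le_ofReal (abs_clamp_le n.cast_nonneg _)
  choose un Dn hs using fun n : ℕ => exists_isStrong_of_bounded hp hT hK (g := gn n) (f := fn n)
    ⟨hgm n, (htop n g).trans_lt ENNReal.ofReal_lt_top⟩ (hfm n) (by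
      refine lt_of_le_of_lt (lintegral_mono fun t => htop n (f t)) ?_
      rw [setLIntegral_const]
      exact ENNReal.mul_lt_top ENNReal.ofReal_lt_top (by simp))
  have hle : ∀ (n : ℕ) (v : X → ℝ), eLpNorm (fun x => clamp n (v x)) Q μ ≤ eLpNorm v Q μ :=
    fun n v => eLpNorm_mono fun x => abs_clamp_le_abs n.cast_nonneg _
  have hfnn : ∀ n, ∫⁻ t in Icc 0 T, eLpNorm (fn n t) Q μ ≤ ∫⁻ t in Icc 0 T, eLpNorm (f t) Q μ :=
    fun n => lintegral_mono fun t => hle n (f t)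
  have hcm : ∀ (n m : ℕ), n ≤ m → ∀ s, |clamp m s - clamp n s| ≤ |clamp n s - s| := by
    intro n m hnm s
    have h1 : (n : ℝ) ≤ m := by exact_mod_cast hnm
    have h2 : (0 : ℝ) ≤ n := n.cast_nonneg
    unfold clamp; grind
  have hcl : ∀ s : ℝ, Tendsto (fun n : ℕ => clamp n s - s) atTop (𝓝 0) := fun s => by
    simpa using (tendsto_clamp s).sub_const s
  have hglim : Tendsto (fun n => eLpNorm (gn n - g) Q μ) atTop (𝓝 0) :=
    tendsto_eLpNorm_zero_of_dominated hq0 (fun n => (hgm n).sub hg.1)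
      (.of_forall fun x n => abs_clamp_sub_self_le n.cast_nonneg _) hg.2
      (.of_forall fun x => hcl _)
  have hflim : Tendsto (fun n => ∫⁻ t in Icc 0 T, eLpNorm (fn n t - f t) Q μ) atTop (𝓝 0) :=
    tendsto_lintegral_eLpNorm_zero (F := fun n t => fn n t - f t) hq0 (fun n => (hfm n).sub hf)
      (.of_forall fun z n => abs_clamp_sub_self_le n.cast_nonneg _) hf hfn
      (.of_forall fun z => hcl _)
  have hN : eLpNorm g Q μ + ∫⁻ t in Icc 0 T, eLpNorm (f t) Q μ < ⊤ :=
    ENNReal.add_lt_top.2 ⟨hg.2, hfn⟩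
  have hsub : ∀ t ∈ Icc 0 T, Ioc 0 t ⊆ Icc 0 T := fun t ht s hs => ⟨hs.1.le, hs.2.trans ht.2⟩
  have hNb : ∀ n, ∀ t ∈ Icc 0 T, eLpNorm (un n t) Q μ ≤
      eLpNorm g Q μ + ∫⁻ t in Icc 0 T, eLpNorm (f t) Q μ := fun n t ht =>
    ((hs n).eLpNorm_le hq1 hK (monotone_psi hp) (psi_neg p) ht).trans
      (add_le_add (hle n g) ((lintegral_mono_set (hsub t ht)).trans (hfnn n)))
  refine exists_isStrong_of_approx hp hT hK hg hf hfn hs hfm (fun n => (hfnn n).trans_lt hfn)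
    (N := eLpNorm g Q μ + ∫⁻ t in Icc 0 T, eLpNorm (f t) Q μ) hN hNb
    (e := fun n => eLpNorm (gn n - g) Q μ + ∫⁻ t in Icc 0 T, eLpNorm (fn n t - f t) Q μ)
    (by simpa using hglim.add hflim) (fun n m hnm t ht => ?_) (δ := 0) tendsto_const_nhds
    (fun n t ht => by simp) hglim hflim
  refine (IsStrong.eLpNorm_sub_le hq1 hK (monotone_psi hp) (psi_neg p) (hs m) (hs n)
    (ρ := fun t => eLpNorm (fn n t - f t) Q μ) ?_ ht).trans ?_
  · filter_upwards [(hs n).equation] with s ⟨hd, _⟩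
    refine ⟨hd, ?_⟩
    simp only [sub_self, zero_add]
    exact eLpNorm_mono fun x => hcm n m hnm _
  · exact add_le_add (eLpNorm_mono fun x => hcm n m hnm _) (lintegral_mono_set (hsub t ht))

end Existence

/-! ### Uniqueness, continuity in `L²` and dependence on the data -/

section Stability

variable {X : Type*} [MeasurableSpace X] {μ : Measure X}

lemma ae_restrict_Ioo_of_Icc {T : ℝ} {P : ℝ → Prop}
    (h : ∀ᵐ t ∂(volume.restrict (Icc 0 T)), P t) : ∀ᵐ t ∂(volume.restrict (Ioo 0 T)), P t :=
  ae_mono (Measure.restrict_mono Ioo_subset_Icc_self le_rfl) h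

lemma setLIntegral_Ioc_le_Icc {T t : ℝ} (ht : t ∈ Icc 0 T) (F : ℝ → ℝ≥0∞) :
    ∫⁻ s in Ioc 0 t, F s ≤ ∫⁻ s in Icc 0 T, F s :=
  lintegral_mono_set fun _ hs => ⟨hs.1.le, hs.2.trans ht.2⟩

theorem IsStrong.eqOn [SFinite μ] {T : ℝ} {K : X → X → ℝ} {Ψ : ℝ → ℝ} {g : X → ℝ}
    {f : ℝ → X → ℝ} {u D v E : ℝ → Lp ℝ 1 μ} (hK : IsAEKernel μ K) (hΨ : Monotone Ψ)
    (hodd : ∀ s, Ψ (-s) = - Ψ s) (hu : IsStrong μ T K Ψ g f u D) (hv : IsStrong μ T K Ψ g f v E) :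
    EqOn u v (Icc 0 T) := by
  intro t ht
  have h := IsStrong.eLpNorm_sub_le (q := 2) one_lt_two hK hΨ hodd hu hv (ρ := 0)
    (hv.equation.mono fun s hs => ⟨hs.1, by simp⟩) ht
  simp only [sub_self, eLpNorm_zero, Pi.zero_apply, lintegral_zero, add_zero] at h
  have h0 := (eLpNorm_eq_zero_iff (Lp.aestronglyMeasurable _) (by simp)).1 (le_antisymm h zero_le)
  exact sub_eq_zero.1 ((Lp.eq_zero_iff_ae_eq_zero).2 h0)

lemma eLpNorm_two_le {p : ℝ} {v : X → ℝ} (hv : AEStronglyMeasurable v μ) :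
    eLpNorm v 2 μ ≤ eLpNorm v (ENNReal.ofReal (dataExp p)) μ *
      μ univ ^ (1 / 2 - 1 / dataExp p) := by
  have h2 : ENNReal.ofReal 2 ≤ ENNReal.ofReal (dataExp p) :=
    ENNReal.ofReal_le_ofReal (two_le_dataExp p)
  have h := eLpNorm_le_eLpNorm_mul_rpow_measure_univ h2 hv
  rw [ENNReal.toReal_ofReal (by norm_num), ENNReal.toReal_ofReal (by linarith [two_le_dataExp p])]
    at h
  simpa using h

variable [IsFiniteMeasure μ]

lemma rpow_half_sub_lt_top (p : ℝ) : μ univ ^ (1 / 2 - 1 / dataExp p) < ⊤ :=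
  rpow_measure_univ_lt_top
    (sub_nonneg.2 (one_div_le_one_div_of_le two_pos (two_le_dataExp p)))

/-- Two solutions of problems with different kernels and data, where `A` bounds the difference of
the two operators at the second solution. -/
theorem IsStrong.eLpNorm_two_sub_le {p : ℝ} (hp : 1 < p) {T : ℝ} {K L : X → X → ℝ}
    {g g' : X → ℝ} {f f' : ℝ → X → ℝ} {u D u' D' : ℝ → Lp ℝ 1 μ}
    (hK : IsAEKernel μ K)
    (hu : IsStrong μ T K (psi p) g f u D) (hu' : IsStrong μ T L (psi p) g' f' u' D')
    (hf : AEStronglyMeasurable (Function.uncurry f) ((volume.restrict (Icc 0 T)).prod μ))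
    (hf' : AEStronglyMeasurable (Function.uncurry f') ((volume.restrict (Icc 0 T)).prod μ))
    (hu'q : ∀ t ∈ Icc 0 T, MemLp (u' t) (ENNReal.ofReal (dataExp p)) μ) {A : ℝ≥0∞}
    (hA : ∀ t ∈ Icc 0 T, eLpNorm (absDrift μ (K - L) (p - 1) (u' t)) 2 μ ≤ A)
    {t : ℝ} (ht : t ∈ Icc 0 T) :
    eLpNorm (u t - u' t : Lp ℝ 1 μ) 2 μ ≤
      eLpNorm (g - g') 2 μ + (∫⁻ s in Icc 0 T, eLpNorm (f s - f' s) 2 μ) +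
        A * ENNReal.ofReal T := by
  have h := IsStrong.eLpNorm_sub_le (q := 2) one_lt_two hK (monotone_psi hp) (psi_neg p) hu hu'
    (ρ := fun s => A + eLpNorm (f s - f' s) 2 μ) ?_ ht
  · simp only [ENNReal.ofReal_ofNat] at h
    refine h.trans ?_
    rw [lintegral_add_left measurable_const, setLIntegral_const, Real.volume_Ioc, sub_zero,
      add_assoc, add_comm (A * _)]
    gcongr
    · exact fun _ hs => ⟨hs.1.le, hs.2.trans ht.2⟩
    · exact ht.2
  · filter_upwards [hu'.equation, ae_restrict_mem measurableSet_Ioo,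
      ae_restrict_Ioo_of_Icc hf.prodMk_left, ae_restrict_Ioo_of_Icc hf'.prodMk_left]
      with s hs hsI hm hm'
    have hsI' := Ioo_subset_Icc_self hsI
    have hd := inDom_psi hp hK (hu'q s hsI')
    refine ⟨hd, ?_⟩
    simp only [ENNReal.ofReal_ofNat]
    refine (eLpNorm_add_le (hd.integrable_drift.sub hs.1.integrable_drift).aestronglyMeasurable
      (hm.sub hm') one_le_two).trans (add_le_add ?_ le_rfl)
    refine le_trans (eLpNorm_mono_enorm_ae ?_) (hA s hsI')
    filter_upwards [enorm_drift_psi_sub_le hp hd hs.1] with x hx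
    simpa using hx

/-- Solutions with data in `L^q`, `q = max(2, 2(p-1))`, are continuous in time with values in `L²`:
on a time interval the `L²` norm of an increment is bounded by the integral of the `L²` norm of the
right-hand side of the equation. -/
theorem IsStrong.tendsto_eLpNorm_two {p : ℝ} (hp : 1 < p) {T : ℝ} {K : X → X → ℝ}
    {g : X → ℝ} {f : ℝ → X → ℝ} {u D : ℝ → Lp ℝ 1 μ} (hK : IsAEKernel μ K)
    (hu : IsStrong μ T K (psi p) g f u D)
    (hf : AEStronglyMeasurable (Function.uncurry f) ((volume.restrict (Icc 0 T)).prod μ))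
    (hfn : ∫⁻ t in Icc 0 T, eLpNorm (f t) (ENNReal.ofReal (dataExp p)) μ < ⊤) {N : ℝ≥0∞}
    (hN : N < ⊤) (huN : ∀ t ∈ Icc 0 T, eLpNorm (u t) (ENNReal.ofReal (dataExp p)) μ ≤ N)
    {t : ℝ} (ht : t ∈ Icc 0 T) :
    Tendsto (fun s => eLpNorm (u s - u t : Lp ℝ 1 μ) 2 μ) (𝓝[Icc 0 T] t) (𝓝 0) := by
  obtain ⟨κ, hκ, hκb⟩ := hK.bounded
  set ρ : ℝ → ℝ≥0∞ := fun s => κ * growth μ p N + eLpNorm (f s) 2 μ with hρ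
  have hii : ∀ a ∈ Icc 0 T, IntervalIntegrable D volume 0 a := fun a ha => by
    rw [intervalIntegrable_iff_integrableOn_Ioo_of_le ha.1]
    exact hu.integrable.mono_set (Ioo_subset_Ioo_right ha.2)
  have hc := rpow_half_sub_lt_top (μ := μ) p
  have hρfin : ∫⁻ s in Icc 0 T, ρ s ≠ ⊤ := by
    rw [hρ, lintegral_add_left measurable_const, setLIntegral_const]
    refine (ENNReal.add_lt_top.2 ⟨ENNReal.mul_lt_top (ENNReal.mul_lt_top hκ (growth_lt_top hp hN))
      (by simp), lt_of_le_of_lt (lintegral_mono_ae (hf.prodMk_left.mono fun s hs =>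
        eLpNorm_two_le (p := p) hs)) ?_⟩).ne
    rw [lintegral_mul_const' _ _ hc.ne]
    exact ENNReal.mul_lt_top hfn hc
  -- the increment from time `a` to time `b`
  have key : ∀ a ∈ Icc 0 T, ∀ b ∈ Icc 0 T, a ≤ b →
      eLpNorm (u b - u a : Lp ℝ 1 μ) 2 μ ≤ ∫⁻ s in Ioc a b, ρ s := by
    intro a ha b hb hab
    have h := eLpNorm_le_of_dissipative (μ := μ) (q := 2) one_lt_two hab (w := fun s => u s - u a)
      (h := D) (ρ := ρ) ((hii a ha).symm.trans (hii b hb)) (fun s hs => ?_) ?_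
    · simp only [sub_self, ENNReal.ofReal_ofNat] at h
      rwa [eLpNorm_congr_ae (Lp.coeFn_zero ℝ 1 μ), eLpNorm_zero, zero_add] at h
    · have hs' : s ∈ Icc 0 T := ⟨ha.1.trans hs.1, hs.2.trans hb.2⟩
      rw [hu.primitive s hs', hu.primitive a ha,
        ← intervalIntegral.integral_interval_sub_left (hii s hs') (hii a ha)]
      abel
    · have hmono : ∀ {P : ℝ → Prop}, (∀ᵐ t ∂(volume.restrict (Ioo 0 T)), P t) →
          ∀ᵐ s ∂(volume.restrict (Ioc a b)), P s := fun h => by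
        rw [restrict_Ioo_eq_restrict_Ioc] at h
        exact ae_mono (Measure.restrict_mono (Ioc_subset_Ioc ha.1 hb.2) le_rfl) h
      filter_upwards [hmono hu.equation, ae_restrict_mem measurableSet_Ioc,
        hmono (ae_restrict_Ioo_of_Icc hf.prodMk_left)] with s hs hsI hm
      have hsI' : s ∈ Icc 0 T := ⟨ha.1.trans hsI.1.le, hsI.2.trans hb.2⟩
      refine ⟨D s, Lp.aestronglyMeasurable _, fun β _ _ _ => le_rfl, ?_⟩
      rw [ENNReal.ofReal_ofNat, eLpNorm_congr_ae hs.2]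
      refine (eLpNorm_add_le hs.1.integrable_drift.aestronglyMeasurable hm
        one_le_two).trans (add_le_add ?_ le_rfl)
      refine (eLpNorm_mono_enorm (fun x => ?_)).trans
        ((eLpNorm_absDrift_le hp hK.measurable hκb (Lp.aestronglyMeasurable (u s))).trans
          (mul_le_mul_right (growth_mono hp (huN s hsI')) _))
      simpa using enorm_drift_psi_le hp K (u s) x
  have hsym : ∀ a b, eLpNorm (u a - u b : Lp ℝ 1 μ) 2 μ = eLpNorm (u b - u a : Lp ℝ 1 μ) 2 μ :=
    fun a b => by
      rw [← neg_sub, eLpNorm_congr_ae (Lp.coeFn_neg _), eLpNorm_neg]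
  have hle : ∀ s ∈ Icc 0 T, eLpNorm (u s - u t : Lp ℝ 1 μ) 2 μ ≤
      ∫⁻ r in uIoc t s, ρ r ∂(volume.restrict (Icc 0 T)) := by
    intro s hs
    have hsub : uIoc t s ⊆ Icc 0 T := fun r hr =>
      ⟨(le_min ht.1 hs.1).trans hr.1.le, hr.2.trans (max_le ht.2 hs.2)⟩
    rw [Measure.restrict_restrict_of_subset hsub]
    rcases le_total t s with h | h
    · rw [uIoc_of_le h]; exact key t ht s hs h
    · rw [uIoc_of_ge h, hsym]; exact key s hs t ht h
  have hlim : Tendsto (fun s => ∫⁻ r in uIoc t s, ρ r ∂(volume.restrict (Icc 0 T)))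
      (𝓝[Icc 0 T] t) (𝓝 0) := by
    refine tendsto_setLIntegral_zero hρfin ?_
    have h0 : Tendsto (fun s => ENNReal.ofReal |s - t|) (𝓝[Icc 0 T] t) (𝓝 0) := by
      have : Tendsto (fun s => ENNReal.ofReal |s - t|) (𝓝 t) (𝓝 (ENNReal.ofReal |t - t|)) :=
        ENNReal.tendsto_ofReal (by apply Continuous.tendsto; fun_prop)
      simpa using this.mono_left nhdsWithin_le_nhds
    refine tendsto_of_tendsto_of_tendsto_of_le_of_le tendsto_const_nhds h0
      (fun _ => zero_le) (fun s => (Measure.restrict_apply_le _ _).trans (le_of_eq ?_))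
    rw [uIoc, Real.volume_Ioc, max_sub_min_eq_abs']
    rw [abs_sub_comm]
  exact tendsto_of_tendsto_of_tendsto_of_le_of_le' tendsto_const_nhds hlim
    (.of_forall fun _ => zero_le) (eventually_nhdsWithin_of_forall hle)

end Stability

/-! ### The problem on a bounded set -/

section Domain

variable {d : ℕ} {Ω : Set (Space d)}

lemma ae_eLpNorm_le_normLinfq (hΩ : MeasurableSet Ω) (F : Space d → Space d → ℝ) :
    ∀ᵐ x ∂(leb Ω), eLpNorm (F x) 2 (leb Ω) ≤ normLinfq Ω 2 F :=
  ae_restrict_of_forall_mem hΩ fun x hx =>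
    le_iSup₂ (f := fun x (_ : x ∈ Ω) => eLpNorm (F x) 2 (leb Ω)) x hx

lemma IsKernel.isAEKernel (hΩ : MeasurableSet Ω) {K : Space d → Space d → ℝ} (hK : IsKernel Ω K) :
    IsAEKernel (leb Ω) K where
  nonneg := by
    rw [Measure.prod_restrict]
    exact ae_restrict_of_forall_mem (hΩ.prod hΩ) fun z hz => hK.nonneg _ hz.1 _ hz.2
  measurable := hK.measurable
  symm := by
    rw [Measure.prod_restrict]
    exact ae_restrict_of_forall_mem (hΩ.prod hΩ) fun z hz => hK.symm _ hz.1 _ hz.2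
  bounded := ⟨_, hK.norm_lt_top, ae_eLpNorm_le_normLinfq hΩ K⟩

/-- A solution in the weak sense is the primitive of its weak time derivative, and conversely. -/
lemma isSolution_iff {p T : ℝ} (hT : 0 < T) {K : Space d → Space d → ℝ} {g : Space d → ℝ}
    {f : ℝ → Space d → ℝ} {u : ℝ → L1 Ω} :
    IsSolution Ω p T K g f u ↔ ∃ D, IsStrong (leb Ω) T K (psi p) g f u D := by
  have e : ∀ v : Space d → ℝ, ∀ x, - pLap Ω p K v x = drift (leb Ω) K (psi p) v x :=
    fun v x => neg_neg _
  constructor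
  · rintro ⟨hc, h0, D, hD, he⟩
    refine ⟨D, hD.integrable_deriv, hD.eq_primitive hT hc, h0, ?_⟩
    simp only [e] at he
    exact he
  · rintro ⟨D, hD⟩
    obtain ⟨hc, hw⟩ := hasWeakTimeDeriv_of_primitive hT hD.integrable hD.primitive
    refine ⟨hc, hD.initial, D, hw, ?_⟩
    simp only [e]
    exact hD.equation

lemma DataIn.mono [IsFiniteMeasure (leb Ω)] {T : ℝ} {q r : ℝ≥0∞} (hq : 0 < q) (hqr : q ≤ r)
    {g : Space d → ℝ} {f : ℝ → Space d → ℝ} (h : DataIn Ω T r g f) : DataIn Ω T q g f := by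
  refine ⟨h.initial.mono_exponent hqr, h.source_measurable, ?_⟩
  have hs : 0 ≤ 1 / q.toReal - 1 / r.toReal := by
    rcases eq_or_ne r ⊤ with rfl | hr
    · simp
    · have hq' : 0 < q.toReal := ENNReal.toReal_pos hq.ne' (ne_top_of_le_ne_top hr hqr)
      exact sub_nonneg.2 (one_div_le_one_div_of_le hq' (ENNReal.toReal_mono hr hqr))
  have hc := rpow_measure_univ_lt_top (μ := leb Ω) hs
  refine lt_of_le_of_lt (lintegral_mono_ae (h.source_measurable.prodMk_left.mono fun t ht =>
    eLpNorm_le_eLpNorm_mul_rpow_measure_univ hqr ht)) ?_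
  rw [lintegral_mul_const' _ _ hc.ne]
  exact ENNReal.mul_lt_top h.source_norm_lt_top hc

/-- In all cases the data belong to `L^q` with `q = max(2, 2(p-1))`. -/
lemma dataIn_of_cases [IsFiniteMeasure (leb Ω)] {p T : ℝ} {g : Space d → ℝ}
    {gn : ℕ → Space d → ℝ} {f : ℝ → Space d → ℝ} {fn : ℕ → ℝ → Space d → ℝ}
    (h : CaseA Ω p T g gn f fn ∨ CaseB Ω p T g gn f fn ∨ CaseC Ω T g gn f fn) :
    DataIn Ω T (ENNReal.ofReal (dataExp p)) g f ∧
      ∀ n, DataIn Ω T (ENNReal.ofReal (dataExp p)) (gn n) (fn n) := by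
  rcases h with ⟨hp, h⟩ | ⟨hp, h⟩ | h
  · have : dataExp p = 2 := max_eq_left (by linarith)
    rw [this, ENNReal.ofReal_ofNat]
    exact h
  · have : dataExp p = 2 * (p - 1) := max_eq_right (by linarith)
    rw [this]
    exact h
  · have hq : 0 < ENNReal.ofReal (dataExp p) :=
      ENNReal.ofReal_pos.2 (by linarith [two_le_dataExp p])
    exact ⟨h.1.mono hq le_top, fun n => (h.2 n).mono hq le_top⟩

lemma hasUniqueSolution [IsFiniteMeasure (leb Ω)] (hΩ : MeasurableSet Ω) {p : ℝ} (hp : 1 < p)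
    {T : ℝ} (hT : 0 < T) {K : Space d → Space d → ℝ} (hK : IsKernel Ω K) {g : Space d → ℝ}
    {f : ℝ → Space d → ℝ} (h : DataIn Ω T (ENNReal.ofReal (dataExp p)) g f) :
    HasUniqueSolution Ω p T K g f := by
  have : Fact ((1 : ℝ≥0∞) ≠ ⊤) := ⟨by simp⟩
  constructor
  · obtain ⟨u, D, hu⟩ := exists_isStrong hp hT (hK.isAEKernel hΩ) h.initial h.source_measurable
      h.source_norm_lt_top
    exact ⟨u, (isSolution_iff hT).2 ⟨D, hu⟩⟩
  · intro u v hu hv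
    obtain ⟨D, hu⟩ := (isSolution_iff hT).1 hu
    obtain ⟨E, hv⟩ := (isSolution_iff hT).1 hv
    exact hu.eqOn (hK.isAEKernel hΩ) (monotone_psi hp) (psi_neg p) hv

/-- The norm of the pair `(g, F)` in `L^q × L¹(ℝ; L^q)`. -/
noncomputable def dataNorm (Ω : Set (Space d)) (q : ℝ≥0∞) (g : Space d → ℝ)
    (F : ℝ → Space d → ℝ) : ℝ≥0∞ :=
  eLpNorm g q (leb Ω) + ∫⁻ t, eLpNorm (F t) q (leb Ω)

lemma dataNorm_indicator (T : ℝ) (q : ℝ≥0∞) (g : Space d → ℝ) (f : ℝ → Space d → ℝ) :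
    dataNorm Ω q g ((Icc 0 T).indicator f) = eLpNorm g q (leb Ω) + normL1Lq Ω T q f := by
  rw [dataNorm, normL1Lq, ← lintegral_indicator measurableSet_Icc]
  congr 2
  ext t
  by_cases ht : t ∈ Icc 0 T
  · simp [indicator_of_mem ht]
  · simp [indicator_of_notMem ht]

lemma DataIn.dataNorm_lt_top {T : ℝ} {q : ℝ≥0∞} {g : Space d → ℝ} {f : ℝ → Space d → ℝ}
    (h : DataIn Ω T q g f) : dataNorm Ω q g ((Icc 0 T).indicator f) < ⊤ := by
  rw [dataNorm_indicator]
  exact ENNReal.add_lt_top.2 ⟨h.initial.2, h.source_norm_lt_top⟩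

/-- The constant in front of `T` times the norm of the difference of the kernels. The two summands
belong to the norms `L^{∞,2}(Ω²)` and `L²(Ω²)`; `toReal` turns a summand into `0` when the data do
not have the integrability it needs. -/
noncomputable def stabilityConst (Ω : Set (Space d)) (p : ℝ) (g : Space d → ℝ)
    (F : ℝ → Space d → ℝ) : ℝ :=
  1 + (growth (leb Ω) p (dataNorm Ω (ENNReal.ofReal (dataExp p)) g F)).toReal +
    ((2 * dataNorm Ω ⊤ g F) ^ (p - 1) * leb Ω univ ^ (1 / 2 : ℝ)).toReal

lemma stabilityConst_pos (p : ℝ) (g : Space d → ℝ) (F : ℝ → Space d → ℝ) :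
    0 < stabilityConst Ω p g F := by
  unfold stabilityConst; positivity

lemma growth_le_stabilityConst [IsFiniteMeasure (leb Ω)] {p : ℝ} (hp : 1 < p) {g : Space d → ℝ}
    {F : ℝ → Space d → ℝ} (h : dataNorm Ω (ENNReal.ofReal (dataExp p)) g F < ⊤) :
    growth (leb Ω) p (dataNorm Ω (ENNReal.ofReal (dataExp p)) g F) ≤
      ENNReal.ofReal (stabilityConst Ω p g F) := by
  refine ENNReal.le_ofReal_iff_toReal_le (growth_lt_top hp h).ne (stabilityConst_pos _ _ _).le
    |>.2 ?_
  unfold stabilityConst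
  linarith [ENNReal.toReal_nonneg
    (a := (2 * dataNorm Ω ⊤ g F) ^ (p - 1) * leb Ω univ ^ (1 / 2 : ℝ))]

lemma rpow_mul_le_stabilityConst [IsFiniteMeasure (leb Ω)] {p : ℝ} (hp : 1 < p) {g : Space d → ℝ}
    {F : ℝ → Space d → ℝ} (h : dataNorm Ω ⊤ g F < ⊤) :
    (2 * dataNorm Ω ⊤ g F) ^ (p - 1) * leb Ω univ ^ (1 / 2 : ℝ) ≤
      ENNReal.ofReal (stabilityConst Ω p g F) := by
  have hfin : (2 * dataNorm Ω ⊤ g F) ^ (p - 1) * leb Ω univ ^ (1 / 2 : ℝ) < ⊤ :=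
    ENNReal.mul_lt_top (ENNReal.rpow_lt_top_of_nonneg (by linarith)
      (ENNReal.mul_lt_top (by simp) h).ne) (rpow_measure_univ_lt_top (by norm_num))
  refine ENNReal.le_ofReal_iff_toReal_le hfin.ne (stabilityConst_pos _ _ _).le |>.2 ?_
  unfold stabilityConst
  linarith [ENNReal.toReal_nonneg
    (a := growth (leb Ω) p (dataNorm Ω (ENNReal.ofReal (dataExp p)) g F))]

lemma IsSolution.eLpNorm_le (hΩ : MeasurableSet Ω) {p : ℝ} (hp : 1 < p) {T : ℝ} (hT : 0 < T)
    {K : Space d → Space d → ℝ} (hK : IsKernel Ω K) {g : Space d → ℝ} {f : ℝ → Space d → ℝ}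
    {u : ℝ → L1 Ω} (hu : IsSolution Ω p T K g f u) {t : ℝ} (ht : t ∈ Icc 0 T) :
    eLpNorm (u t) (ENNReal.ofReal (dataExp p)) (leb Ω) ≤
      dataNorm Ω (ENNReal.ofReal (dataExp p)) g ((Icc 0 T).indicator f) := by
  obtain ⟨D, hu⟩ := (isSolution_iff hT).1 hu
  rw [dataNorm_indicator]
  exact (hu.eLpNorm_le (by linarith [two_le_dataExp p]) (hK.isAEKernel hΩ) (monotone_psi hp)
    (psi_neg p) ht).trans (add_le_add le_rfl (setLIntegral_Ioc_le_Icc ht _))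

lemma IsSolution.memLp [IsFiniteMeasure (leb Ω)] (hΩ : MeasurableSet Ω) {p : ℝ} (hp : 1 < p)
    {T : ℝ} (hT : 0 < T) {K : Space d → Space d → ℝ} (hK : IsKernel Ω K) {g : Space d → ℝ}
    {f : ℝ → Space d → ℝ} (h : DataIn Ω T (ENNReal.ofReal (dataExp p)) g f) {u : ℝ → L1 Ω}
    (hu : IsSolution Ω p T K g f u) {t : ℝ} (ht : t ∈ Icc 0 T) :
    MemLp (u t) (ENNReal.ofReal (dataExp p)) (leb Ω) :=
  ⟨Lp.aestronglyMeasurable _, (hu.eLpNorm_le hΩ hp hT hK ht).trans_lt h.dataNorm_lt_top⟩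

lemma IsSolution.inCL2 [IsFiniteMeasure (leb Ω)] (hΩ : MeasurableSet Ω) {p : ℝ} (hp : 1 < p)
    {T : ℝ} (hT : 0 < T) {K : Space d → Space d → ℝ} (hK : IsKernel Ω K) {g : Space d → ℝ}
    {f : ℝ → Space d → ℝ} (h : DataIn Ω T (ENNReal.ofReal (dataExp p)) g f) {u : ℝ → L1 Ω}
    (hu : IsSolution Ω p T K g f u) : InCL2 Ω T u := by
  refine ⟨fun t ht => (hu.memLp hΩ hp hT hK h ht).mono_exponent ?_, fun t ht => ?_⟩
  · rw [← ENNReal.ofReal_ofNat]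
    exact ENNReal.ofReal_le_ofReal (two_le_dataExp p)
  · obtain ⟨D, hD⟩ := (isSolution_iff hT).1 hu
    exact hD.tendsto_eLpNorm_two hp (hK.isAEKernel hΩ) h.source_measurable h.source_norm_lt_top
      h.dataNorm_lt_top (fun s hs => hu.eLpNorm_le hΩ hp hT hK hs) ht

/-- The stability estimate, with a bound `c * k` for the difference of the two operators. -/
lemma IsSolution.normCL2_sub_le [IsFiniteMeasure (leb Ω)] (hΩ : MeasurableSet Ω) {p : ℝ}
    (hp : 1 < p) {T : ℝ} (hT : 0 < T) {K L : Space d → Space d → ℝ} (hK : IsKernel Ω K)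
    (hL : IsKernel Ω L) {g g' : Space d → ℝ} {f f' : ℝ → Space d → ℝ}
    (h : DataIn Ω T (ENNReal.ofReal (dataExp p)) g f)
    (h' : DataIn Ω T (ENNReal.ofReal (dataExp p)) g' f') {u u' : ℝ → L1 Ω}
    (hu : IsSolution Ω p T K g f u) (hu' : IsSolution Ω p T L g' f' u') {c : ℝ} (hc : 0 < c)
    {k : ℝ≥0∞} (hA : ∀ t ∈ Icc 0 T, eLpNorm (absDrift (leb Ω) (K - L) (p - 1) (u' t)) 2 (leb Ω) ≤
      ENNReal.ofReal c * k) :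
    normCL2 Ω T (u - u') ≤ eLpNorm (g - g') 2 (leb Ω) + normL1Lq Ω T 2 (f - f') +
      ENNReal.ofReal (c * T) * k := by
  obtain ⟨D, hD⟩ := (isSolution_iff hT).1 hu
  obtain ⟨D', hD'⟩ := (isSolution_iff hT).1 hu'
  refine iSup₂_le fun t ht => ?_
  refine (IsStrong.eLpNorm_two_sub_le hp (hK.isAEKernel hΩ) hD hD' h.source_measurable
    h'.source_measurable (fun s hs => hu'.memLp hΩ hp hT hL h' hs) hA ht).trans (le_of_eq ?_)
  rw [ENNReal.ofReal_mul hc.le, mul_right_comm]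
  rfl

/-- Stability with respect to the `L^{∞,2}` norm of the kernel. -/
lemma IsSolution.normCL2_sub_le_normLinfq [IsFiniteMeasure (leb Ω)] (hΩ : MeasurableSet Ω) {p : ℝ}
    (hp : 1 < p) {T : ℝ} (hT : 0 < T) {K L : Space d → Space d → ℝ} (hK : IsKernel Ω K)
    (hL : IsKernel Ω L) {g g' : Space d → ℝ} {f f' : ℝ → Space d → ℝ}
    (h : DataIn Ω T (ENNReal.ofReal (dataExp p)) g f)
    (h' : DataIn Ω T (ENNReal.ofReal (dataExp p)) g' f') {u u' : ℝ → L1 Ω}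
    (hu : IsSolution Ω p T K g f u) (hu' : IsSolution Ω p T L g' f' u') :
    normCL2 Ω T (u - u') ≤ eLpNorm (g - g') 2 (leb Ω) + normL1Lq Ω T 2 (f - f') +
      ENNReal.ofReal (stabilityConst Ω p g' ((Icc 0 T).indicator f') * T) *
        normLinfq Ω 2 (K - L) := by
  refine hu.normCL2_sub_le hΩ hp hT hK hL h h' hu' (stabilityConst_pos _ _ _) fun t ht => ?_
  refine (eLpNorm_absDrift_le hp (hK.measurable.sub hL.measurable)
    (ae_eLpNorm_le_normLinfq hΩ (K - L)) (Lp.aestronglyMeasurable _)).trans ?_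
  rw [mul_comm]
  exact mul_le_mul_left ((growth_mono hp (hu'.eLpNorm_le hΩ hp hT hL ht)).trans
    (growth_le_stabilityConst hp h'.dataNorm_lt_top)) _

/-- For bounded data, stability with respect to the `L²` norm of the kernel. -/
lemma IsSolution.normCL2_sub_le_normL2sq [IsFiniteMeasure (leb Ω)] (hΩ : MeasurableSet Ω) {p : ℝ}
    (hp : 1 < p) {T : ℝ} (hT : 0 < T) {K L : Space d → Space d → ℝ} (hK : IsKernel Ω K)
    (hL : IsKernel Ω L) {g g' : Space d → ℝ} {f f' : ℝ → Space d → ℝ}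
    (h : DataIn Ω T ⊤ g f) (h' : DataIn Ω T ⊤ g' f') {u u' : ℝ → L1 Ω}
    (hu : IsSolution Ω p T K g f u) (hu' : IsSolution Ω p T L g' f' u') :
    normCL2 Ω T (u - u') ≤ eLpNorm (g - g') 2 (leb Ω) + normL1Lq Ω T 2 (f - f') +
      ENNReal.ofReal (stabilityConst Ω p g' ((Icc 0 T).indicator f') * T) *
        normL2sq Ω (K - L) := by
  have hq : 0 < ENNReal.ofReal (dataExp p) :=
    ENNReal.ofReal_pos.2 (by linarith [two_le_dataExp p])
  refine hu.normCL2_sub_le hΩ hp hT hK hL (h.mono hq le_top) (h'.mono hq le_top) hu'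
    (stabilityConst_pos _ _ _) fun t ht => ?_
  obtain ⟨D', hD'⟩ := (isSolution_iff hT).1 hu'
  have hb : eLpNorm (u' t) ⊤ (leb Ω) ≤ dataNorm Ω ⊤ g' ((Icc 0 T).indicator f') := by
    rw [dataNorm_indicator]
    exact hD'.eLpNorm_top_le (hL.isAEKernel hΩ) (monotone_psi hp) (psi_neg p)
      h'.source_measurable ht
  exact (eLpNorm_absDrift_le_of_bounded (by linarith) (hK.measurable.sub hL.measurable) hb).trans
    (mul_le_mul_left (rpow_mul_le_stabilityConst hp h'.dataNorm_lt_top) _)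

end Domain

/-! ### Convergence of the data -/

section Convergence

variable {X : Type*} [MeasurableSpace X] {μ : Measure X}

lemma unifIntegrable_two_of_sq {F : ℕ → X → ℝ}
    (h : UnifIntegrable (fun n x => |F n x| ^ 2) 1 μ) : UnifIntegrable F 2 μ := by
  intro ε hε
  obtain ⟨δ, hδ, H⟩ := h (sq_pos_of_pos hε)
  refine ⟨δ, hδ, fun n s hs hμ => ?_⟩
  have h1 := H n s hs hμ
  have e : ∀ x, ‖s.indicator (fun x => |F n x| ^ 2) x‖ₑ = ‖s.indicator (F n) x‖ₑ ^ (2 : ℝ) := by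
    intro x
    by_cases hx : x ∈ s
    · simp [hx]
    · simp [hx]
  rw [eLpNorm_one_eq_lintegral_enorm] at h1
  simp only [e] at h1
  rw [eLpNorm_two_eq]
  refine (ENNReal.rpow_le_rpow h1 (by norm_num)).trans (le_of_eq ?_)
  rw [ENNReal.ofReal_pow hε.le, ← ENNReal.rpow_natCast, ← ENNReal.rpow_mul]
  norm_num

lemma IsAEKernel.memLp [IsFiniteMeasure μ] {K : X → X → ℝ} (hK : IsAEKernel μ K) :
    MemLp (Function.uncurry K) 2 (μ.prod μ) := by
  obtain ⟨κ, hκ, hκb⟩ := hK.bounded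
  refine ⟨hK.measurable, ?_⟩
  rw [eLpNorm_two_eq, lintegral_prod _ (hK.measurable.enorm.pow_const _)]
  refine ENNReal.rpow_lt_top_of_nonneg (by norm_num) (ne_of_lt ?_)
  refine lt_of_le_of_lt (lintegral_mono_ae (g := fun _ => κ ^ (2 : ℝ)) ?_) ?_
  · filter_upwards [hκb] with x hx
    have := ENNReal.rpow_le_rpow hx (z := 2) (by norm_num)
    rw [eLpNorm_two_eq, ← ENNReal.rpow_mul] at this
    simpa using this
  · rw [lintegral_const]
    exact ENNReal.mul_lt_top (ENNReal.rpow_lt_top_of_nonneg (by norm_num) hκ.ne)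
      (measure_lt_top _ _)

/-- A sequence of reals that is bounded by `M` and converges stays within `2 |M|` of its limit. -/
lemma abs_sub_le_of_tendsto {a : ℕ → ℝ} {b M : ℝ} (ha : ∀ n, |a n| ≤ M)
    (hab : Tendsto a atTop (𝓝 b)) (n : ℕ) : |a n - b| ≤ |2 * M| := by
  have hb : |b| ≤ M := le_of_tendsto hab.abs (.of_forall ha)
  have h1 := abs_sub (a n) b
  have h2 := ha n
  have h3 := le_abs_self (2 * M)
  linarith

variable {d : ℕ} {Ω : Set (Space d)}

lemma tendsto_initial_zero [IsFiniteMeasure (leb Ω)] {g : Space d → ℝ} {gn : ℕ → Space d → ℝ}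
    (hg : AEStronglyMeasurable g (leb Ω)) (hgn : ∀ n, AEStronglyMeasurable (gn n) (leb Ω)) {M : ℝ}
    (hM : ∀ᵐ x ∂(leb Ω), ∀ n, |gn n x| ≤ M)
    (hlim : ∀ᵐ x ∂(leb Ω), Tendsto (fun n => gn n x) atTop (𝓝 (g x))) :
    Tendsto (fun n => eLpNorm (gn n - g) 2 (leb Ω)) atTop (𝓝 0) := by
  have h := tendsto_eLpNorm_zero_of_dominated (μ := leb Ω) (q := 2) two_pos
    (F := fun n => gn n - g) (G := fun _ => 2 * M) (fun n => (hgn n).sub hg) ?_ ?_ ?_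
  · simpa only [ENNReal.ofReal_ofNat] using h
  · filter_upwards [hM, hlim] with x h1 h2 n using abs_sub_le_of_tendsto h1 h2 n
  · exact (memLp_const _).2
  · filter_upwards [hlim] with x hx
    simpa using hx.sub_const (g x)

lemma tendsto_source_zero [IsFiniteMeasure (leb Ω)] {T : ℝ} {f : ℝ → Space d → ℝ}
    {fn : ℕ → ℝ → Space d → ℝ}
    (hf : AEStronglyMeasurable (Function.uncurry f) ((volume.restrict (Icc 0 T)).prod (leb Ω)))
    (hfn : ∀ n, AEStronglyMeasurable (Function.uncurry (fn n))
      ((volume.restrict (Icc 0 T)).prod (leb Ω))) {M : ℝ}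
    (hM : ∀ᵐ z ∂((volume.restrict (Icc 0 T)).prod (leb Ω)), ∀ n, |fn n z.1 z.2| ≤ M)
    (hlim : ∀ᵐ z ∂((volume.restrict (Icc 0 T)).prod (leb Ω)),
      Tendsto (fun n => fn n z.1 z.2) atTop (𝓝 (f z.1 z.2))) :
    Tendsto (fun n => normL1Lq Ω T 2 (fn n - f)) atTop (𝓝 0) := by
  have h := tendsto_lintegral_eLpNorm_zero (μ := leb Ω) (ν := volume.restrict (Icc 0 T)) (q := 2)
    two_pos (F := fun n => fn n - f) (G := fun _ _ => 2 * M) (fun n => (hfn n).sub hf) ?_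
    aestronglyMeasurable_const ?_ ?_
  · simp only [ENNReal.ofReal_ofNat] at h
    exact h
  · filter_upwards [hM, hlim] with z h1 h2 n using abs_sub_le_of_tendsto h1 h2 n
  · rw [setLIntegral_const]
    exact ENNReal.mul_lt_top (memLp_const _).2 (by simp)
  · filter_upwards [hlim] with z hz
    simpa using hz.sub_const (f z.1 z.2)

lemma tendsto_kernel_zero [IsFiniteMeasure (leb Ω)] (hΩ : MeasurableSet Ω)
    {K : Space d → Space d → ℝ} {Kn : ℕ → Space d → Space d → ℝ} (hK : IsKernel Ω K)
    (hKn : ∀ n, IsKernel Ω (Kn n))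
    (hui : UnifIntegrable (fun n (z : Space d × Space d) => |Kn n z.1 z.2| ^ 2) 1
      ((leb Ω).prod (leb Ω)))
    (hlim : ∀ᵐ z ∂((leb Ω).prod (leb Ω)),
      Tendsto (fun n => Kn n z.1 z.2) atTop (𝓝 (K z.1 z.2))) :
    Tendsto (fun n => normL2sq Ω (Kn n - K)) atTop (𝓝 0) :=
  tendsto_Lp_finite_of_tendsto_ae one_le_two (by simp) (fun n => (hKn n).measurable)
    (hK.isAEKernel hΩ).memLp (unifIntegrable_two_of_sq hui) hlim

end Convergence

end NonlocalPLaplacian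

open NonlocalPLaplacian in
theorem mainTheorem1 (d : ℕ) (hd : 1 ≤ d) (Ω : Set (Space d)) (hΩ : MeasurableSet Ω)
    (hΩb : Bornology.IsBounded Ω) (p : ℝ) (hp : 1 < p) :
    -- `C` depends on `g` and on `f` as a function on `[0,T]` (extended by zero), but not on `T`.
    ∃ C : (Space d → ℝ) → (ℝ → Space d → ℝ) → ℝ, (∀ g f, 0 < C g f) ∧
    ∀ (T : ℝ), 0 < T →
    ∀ (K : Space d → Space d → ℝ) (Kn : ℕ → Space d → Space d → ℝ)
      (g : Space d → ℝ) (gn : ℕ → Space d → ℝ)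
      (f : ℝ → Space d → ℝ) (fn : ℕ → ℝ → Space d → ℝ),
    IsKernel Ω K → (∀ n, IsKernel Ω (Kn n)) →
    (CaseA Ω p T g gn f fn ∨ CaseB Ω p T g gn f fn ∨ CaseC Ω T g gn f fn) →
    (HasUniqueSolution Ω p T K g f ∧ ∀ n, HasUniqueSolution Ω p T (Kn n) (gn n) (fn n)) ∧
    ∀ (u : ℝ → L1 Ω) (un : ℕ → ℝ → L1 Ω),
      IsSolution Ω p T K g f u → (∀ n, IsSolution Ω p T (Kn n) (gn n) (fn n) (un n)) →
      (InCL2 Ω T u ∧ ∀ n, InCL2 Ω T (un n)) ∧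
      (CaseA Ω p T g gn f fn ∨ CaseB Ω p T g gn f fn → ∀ n,
        normCL2 Ω T (un n - u) ≤
          eLpNorm (gn n - g) 2 (leb Ω) + normL1Lq Ω T 2 (fn n - f) +
            ENNReal.ofReal (C g ((Set.Icc 0 T).indicator f) * T) * normLinfq Ω 2 (Kn n - K)) ∧
      (CaseC Ω T g gn f fn → ∀ n,
        normCL2 Ω T (un n - u) ≤
          eLpNorm (gn n - g) 2 (leb Ω) + normL1Lq Ω T 2 (fn n - f) +
            ENNReal.ofReal (C g ((Set.Icc 0 T).indicator f) * T) * normL2sq Ω (Kn n - K)) ∧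
      (CaseC Ω T g gn f fn → DataConverge Ω T K Kn g gn f fn →
        Tendsto (fun n => normCL2 Ω T (un n - u)) atTop (𝓝 0)) := by
  have : IsFiniteMeasure (leb Ω) := isFiniteMeasure_restrict.2 hΩb.measure_lt_top.ne
  refine ⟨stabilityConst Ω p, stabilityConst_pos p, ?_⟩
  intro T hT K Kn g gn f fn hK hKn hcase
  obtain ⟨h, hn⟩ := dataIn_of_cases hcase
  refine ⟨⟨hasUniqueSolution hΩ hp hT hK h, fun n => hasUniqueSolution hΩ hp hT (hKn n) (hn n)⟩, ?_⟩
  intro u un hu hun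
  have hC : CaseC Ω T g gn f fn → ∀ n, normCL2 Ω T (un n - u) ≤
      eLpNorm (gn n - g) 2 (leb Ω) + normL1Lq Ω T 2 (fn n - f) +
        ENNReal.ofReal (stabilityConst Ω p g ((Set.Icc 0 T).indicator f) * T) *
          normL2sq Ω (Kn n - K) := fun hc n =>
    (hun n).normCL2_sub_le_normL2sq hΩ hp hT (hKn n) hK (hc.2 n) hc.1 hu
  refine ⟨⟨hu.inCL2 hΩ hp hT hK h, fun n => (hun n).inCL2 hΩ hp hT (hKn n) (hn n)⟩,
    fun _ n => (hun n).normCL2_sub_le_normLinfq hΩ hp hT (hKn n) hK (hn n) h hu, hC, ?_⟩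
  intro hc hconv
  obtain ⟨M, hM⟩ := hconv.initial_bounded
  obtain ⟨M', hM'⟩ := hconv.source_bounded
  have h1 := tendsto_initial_zero h.initial.1 (fun n => (hn n).initial.1) hM hconv.initial_tendsto
  have h2 := tendsto_source_zero h.source_measurable (fun n => (hn n).source_measurable) hM'
    hconv.source_tendsto
  have h3 := tendsto_kernel_zero hΩ hK hKn hconv.kernel_unifIntegrable hconv.kernel_tendsto
  have h4 := (h1.add h2).add (ENNReal.Tendsto.const_mul
    (a := ENNReal.ofReal (stabilityConst Ω p g ((Set.Icc 0 T).indicator f) * T)) h3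
    (Or.inr ENNReal.ofReal_ne_top))
  simp only [mul_zero, add_zero] at h4
  exact tendsto_of_tendsto_of_tendsto_of_le_of_le tendsto_const_nhds h4 (fun _ => zero_le) (hC hc)
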